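/- All functions are complex-valued functions on $\mathbb{R}^d$, $\mathbb{N}=\{0,1,2,\dots\}$, $\mathcal{D}$ is the space of smooth compactly supported functions, $\mathcal{D}'$ the space of distributions, $\mathcal{D}(K)$ the set of $\varphi\in\mathcal D$ supported in the compact set $K$, and, for $L\in\mathbb{N}$, $\mathcal{D}_L(K)$ the set of those $\varphi\in\mathcal{D}(K)$ with $\int x^\alpha\varphi(x)\,dx=0$ for all $|\alpha|<L$. For $\phi\in\mathcal D$ and $j\in\mathbb N$ put $\phi_j=2^{jd}\phi(2^j\,\cdot\,)$. **Definitions.** A *solid translation-invariant Banach function space (TIBF) of bounded type* is a non-trivial Banach space $E$ continuously included in $L^1_{\mathrm{loc}}(\mathbb{R}^d)$ such that (A.1) $T_xE\subseteq E$ for all $x$, where $T_xf(t)=f(t-x)$; (A.2) there is $C_0>0$ with $\|T_xf\|_E\le C_0\|f\|_E$ for all $x$ and $f\in E$; (A.3) $E*C_{\mathrm c}(\mathbb{R}^d)\subseteq E$; and (solidity) if $f\in E$, $g\in L^1_{\mathrm{loc}}$ and $|g|\le|f|$ a.e., then $g\in E$ and $\|g\|_E\le\|f\|_E$. The semi-local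 space $E_{\mathrm{sl}}$ consists of all $f\in L^1_{\mathrm{loc}}$ with $1_Kf\in E$ for every compact $K$ and $\|f\|_{E_{\mathrm{sl}}}=\sup_{R>0}\|1_{\overline{B}(0,R)}f\|_E<\infty$. A *weight function system* is a sequence $\mathcal{W}=(w_n)_{n\in\mathbb{N}}$ of locally bounded measurable functions $w_n:\mathbb{R}^d\to[1,\infty)$ with $w_n\le w_{n+1}$ for all $n$. It satisfies (wM) if for every $n$ there are $m\ge n$ and $C>0$ with $w_n(x+y)\le C\,w_m(x)$ for all $x\in\mathbb{R}^d$, $|y|\le1$. Let $L^0$ be the space of all $f\in L^\infty$ such that for every $\varepsilon>0$ there is a compact $K$ with $|f|\le\varepsilon$ a.e. outside $K$. Put $$E^\infty_{\mathcal W}=\bigcap_{n\in\mathbb N}\{f\in C^n(\mathbb R^d): f^{(\alpha)}w_n\in E\ \text{for all } |\alpha|\le n\},\qquad \dot{\mathcal B}_{\mathcal W}=\bigcap_{n\in\mathbb N}\{f\in C^n(\mathbb R^d): f^{(\alpha)}w_n\in L^0\ \text{for all } |\alpha|\le n\},$$ $$\mathcal O_M(\dot{\mathcal B}_{\mathcal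 W},E^\infty_{\mathcal W})=\{f\in\mathcal D': f\cdot\varphi\in E^\infty_{\mathcal W}\ \text{for all }\varphi\in\dot{\mathcal B}_{\mathcal W}\}.$$ A pair $(\chi^0,\chi^1)\in\mathcal{D}\times\mathcal{D}$ has the *moment-wise decomposition factorization property (MDFP)* if there is a compact $K\subset\mathbb{R}^d$ with non-empty interior such that for every $L\in\mathbb{N}$ there are non-trivial pairs $(\varphi^\ell_L,\psi^\ell_L)\in\mathcal{D}(K)\times\mathcal{D}_L(K)$, $\ell\in\{0,1\}$, with $$2^d\varphi^0_L(2\,\cdot\,)-\varphi^0_L=\Delta\psi^0_L,\quad \int\varphi^0_L\,dx=1,\quad \varphi^0_L=\chi^0*\varphi^0_L+\chi^1*\varphi^1_L,\quad \psi^0_L=\chi^0*\psi^0_L+\chi^1*\psi^1_L.$$ **Theorem.** Let $E$ be a solid TIBF of bounded type and let $\mathcal W=(w_n)$ be a weight function system that satisfies (wM) and such that for every $n$ there is $m\ge n$ with $w_n^2/w_m\in L^\infty$. Let $(\chi^0,\chi^1)\in\mathcal D\times\mathcal D$ have the MDFP. Then, for every $f\in\mathcal D'$, the following are equivalent: (i)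 $f\in\mathcal O_M(\dot{\mathcal B}_{\mathcal W},E^\infty_{\mathcal W})$. (ii) For every $\phi\in\mathcal D$ and $\alpha\in\mathbb N^d$ there is $n\in\mathbb N$ such that $\{\partial^\alpha[f*\phi_j]/w_n : j\in\mathbb N\}$ is bounded in $E_{\mathrm{sl}}$. (iii) For every $\phi\in\mathcal D$ there is $r>0$ such that for every $\alpha\in\mathbb N^d$ there is $n\in\mathbb N$ such that $\{2^{-rj}\,\partial^\alpha[f*\phi_j]/w_n : j\in\mathbb N\}$ is bounded in $E_{\mathrm{sl}}$. (iv) There is $r>0$ such that for every $\alpha\in\mathbb N^d$ there is $n\in\mathbb N$ such that $\{2^{-rj}\,\partial^\alpha[f*\chi^\ell_j]/w_n : j\in\mathbb N,\ \ell\in\{0,1\}\}$ is bounded in $E_{\mathrm{sl}}$. -/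

import Mathlib

open MeasureTheory TopologicalSpace
open scoped Distributions ENNReal NNReal ContDiff

namespace Mollif

/-- The Euclidean space `ℝ^d`. -/
abbrev Rd (d : ℕ) := EuclideanSpace ℝ (Fin d)

/-- The space `𝓓` of complex-valued smooth functions with compact support in `ℝ^d`, with its
canonical (LF) topology. -/
abbrev Test (d : ℕ) := 𝓓((⊤ : Opens (Rd d)), ℂ)

/-- The space `𝓓'` of distributions: the continuous linear functionals on `𝓓`. -/
abbrev Distrib (d : ℕ) := Test d →L[ℂ] ℂ

variable {d : ℕ}

section Derivatives

/-- The partial derivative in the `i`-th coordinate direction. -/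
noncomputable def pderiv (i : Fin d) (g : Rd d → ℂ) : Rd d → ℂ :=
  fun x => fderiv ℝ g x (EuclideanSpace.single i 1)

/-- The derivative `∂^α g = ∂_1^{α_1} ⋯ ∂_d^{α_d} g` for a multi-index `α`. -/
noncomputable def mderiv (α : Fin d → ℕ) (g : Rd d → ℂ) : Rd d → ℂ :=
  (List.finRange d).foldr (fun i h => (pderiv i)^[α i] h) g

/-- The length `|α|` of a multi-index. -/
def order (α : Fin d → ℕ) : ℕ := ∑ i, α i

end Derivatives

section TestFunctions

/-- The test function `y ↦ φ (x - y)`. -/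
noncomputable def reflTranslate (φ : Test d) (x : Rd d) : Test d where
  toFun := fun y => φ (x - y)
  contDiff' := φ.contDiff.comp (contDiff_const.sub contDiff_id)
  hasCompactSupport' := φ.hasCompactSupport.comp_homeomorph (Homeomorph.subLeft x)
  tsupport_subset' := fun _ _ => trivial

/-- The convolution `f * φ` of a distribution and a test function, `(f * φ)(x) = ⟨f, φ(x - ·)⟩`. -/
noncomputable def conv (f : Distrib d) (φ : Test d) : Rd d → ℂ :=
  fun x => f (reflTranslate φ x)

/-- The dilated test function `φ_j = 2^{jd} φ(2^j ·)`. -/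
noncomputable def dil (φ : Test d) (j : ℕ) : Test d where
  toFun := fun x => (2 : ℂ) ^ (j * d) * φ ((2 : ℝ) ^ j • x)
  contDiff' := contDiff_const.mul (φ.contDiff.comp (contDiff_const_smul _))
  hasCompactSupport' := HasCompactSupport.mul_left
    (φ.hasCompactSupport.comp_homeomorph
      (Homeomorph.smulOfNeZero ((2 : ℝ) ^ j) (pow_ne_zero j two_ne_zero)))
  tsupport_subset' := fun _ _ => trivial

/-- The product of a smooth function and a test function. -/
noncomputable def smoothMul (φ : Rd d → ℂ) (hφ : ContDiff ℝ ∞ φ) (θ : Test d) : Test d where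
  toFun := fun x => φ x * θ x
  contDiff' := hφ.mul θ.contDiff
  hasCompactSupport' := HasCompactSupport.mul_left θ.hasCompactSupport
  tsupport_subset' := fun _ _ => trivial

end TestFunctions

section FunctionSpaces

variable {E : Type*} [NormedAddCommGroup E] [NormedSpace ℂ E]

/-- A Banach space `E` of (classes of) functions on `ℝ^d` is given by a linear map `ι` from `E` to
the space of measurable functions modulo a.e. equality. The function `g` belongs to `E`. -/
def MemE (ι : E →ₗ[ℂ] (Rd d →ₘ[volume] ℂ)) (g : Rd d → ℂ) : Prop :=
  ∃ e : E, ι e =ᵐ[volume] g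

/-- The norm `‖g‖_E` of a function `g`, with the value `∞` if `g` does not belong to `E`. -/
noncomputable def eNormE (ι : E →ₗ[ℂ] (Rd d →ₘ[volume] ℂ)) (g : Rd d → ℂ) : ℝ≥0∞ :=
  ⨅ (e : E) (_ : ι e =ᵐ[volume] g), ‖e‖ₑ

/-- The Banach space `E`, embedded into the measurable functions modulo a.e. equality by `ι`, is a
solid translation-invariant Banach function space (TIBF) of bounded type on `ℝ^d`. -/
structure IsSolidTIBF [CompleteSpace E] (ι : E →ₗ[ℂ] (Rd d →ₘ[volume] ℂ)) : Prop where
  injective : Function.Injective ι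
  nontrivial : Nontrivial E
  locallyIntegrable : ∀ e : E, LocallyIntegrable (ι e) volume
  /-- The inclusion `E ⊆ L^1_loc` is continuous. -/
  continuous_inclusion : ∀ K : Set (Rd d), IsCompact K →
    ∃ C : ℝ, ∀ e : E, ∫ x in K, ‖ι e x‖ ≤ C * ‖e‖
  /-- `E` is invariant under translations. -/
  translate_mem : ∀ (x : Rd d) (e : E), MemE ι (fun t => ι e (t - x))
  /-- The translations are uniformly bounded on `E`. -/
  translate_bound : ∃ C₀ : ℝ, 0 < C₀ ∧ ∀ (x : Rd d) (e e' : E),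
    ι e' =ᵐ[volume] (fun t => ι e (t - x)) → ‖e'‖ ≤ C₀ * ‖e‖
  /-- `E * C_c ⊆ E`. -/
  conv_mem : ∀ (e : E) (φ : Rd d → ℂ), Continuous φ → HasCompactSupport φ →
    MemE ι (convolution (ι e) φ (ContinuousLinearMap.mul ℂ ℂ) volume)
  solid : ∀ (e : E) (g : Rd d → ℂ), LocallyIntegrable g volume →
    (∀ᵐ x ∂volume, ‖g x‖ ≤ ‖ι e x‖) → ∃ e' : E, ι e' =ᵐ[volume] g ∧ ‖e'‖ ≤ ‖e‖

/-- The norm `sup_{R > 0} ‖1_{B(0,R)} g‖_E` of the semi-local space `E_sl`, with value `∞` if some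
`1_{B(0,R)} g` does not belong to `E` or the supremum is infinite. -/
noncomputable def eNormSl (ι : E →ₗ[ℂ] (Rd d →ₘ[volume] ℂ)) (g : Rd d → ℂ) : ℝ≥0∞ :=
  ⨆ (R : ℝ) (_ : 0 < R), eNormE ι ((Metric.closedBall (0 : Rd d) R).indicator g)

/-- The function `g` belongs to the semi-local space `E_sl`. -/
def MemSl (ι : E →ₗ[ℂ] (Rd d →ₘ[volume] ℂ)) (g : Rd d → ℂ) : Prop :=
  LocallyIntegrable g volume ∧ (∀ K : Set (Rd d), IsCompact K → MemE ι (K.indicator g)) ∧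
    eNormSl ι g < ⊤

/-- The set `S` of functions is a bounded subset of `E_sl`. -/
def BoundedSl (ι : E →ₗ[ℂ] (Rd d →ₘ[volume] ℂ)) (S : Set (Rd d → ℂ)) : Prop :=
  ∃ C : ℝ≥0, ∀ g ∈ S, MemSl ι g ∧ eNormSl ι g ≤ C

/-- The function `g` belongs to `L^0`, the space of essentially bounded functions that vanish at
infinity. -/
def MemL0 (g : Rd d → ℂ) : Prop :=
  MemLp g ⊤ volume ∧ ∀ ε : ℝ, 0 < ε → ∃ K : Set (Rd d), IsCompact K ∧
    ∀ᵐ x ∂volume, x ∉ K → ‖g x‖ ≤ ε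

/-- For a function space with membership predicate `M` and a weight `ρ`, the space `M^n_ρ` of the
`C^n` functions `g` such that `∂^α g · ρ` belongs to `M` for all `|α| ≤ n`. -/
def weightedCn (M : (Rd d → ℂ) → Prop) (n : ℕ) (ρ : Rd d → ℝ) : Set (Rd d → ℂ) :=
  {g | ContDiff ℝ n g ∧ ∀ α : Fin d → ℕ, order α ≤ n → M (fun x => ρ x • mderiv α g x)}

/-- The space `M^∞_𝒲 = ⋂_n M^n_{w_n}`. -/
def weightedSmooth (M : (Rd d → ℂ) → Prop) (w : ℕ → Rd d → ℝ) : Set (Rd d → ℂ) :=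
  ⋂ n : ℕ, weightedCn M n (w n)

/-- The Gelfand-Shilov-type space `E^∞_𝒲`. -/
def gelfandShilov (ι : E →ₗ[ℂ] (Rd d →ₘ[volume] ℂ)) (w : ℕ → Rd d → ℝ) : Set (Rd d → ℂ) :=
  weightedSmooth (MemE ι) w

/-- The space `Ḃ_𝒲 = (L^0)^∞_𝒲`. -/
def dotB (w : ℕ → Rd d → ℝ) : Set (Rd d → ℂ) := weightedSmooth MemL0 w

theorem contDiff_of_mem_weightedSmooth {M : (Rd d → ℂ) → Prop} {w : ℕ → Rd d → ℝ}
    {g : Rd d → ℂ} (hg : g ∈ weightedSmooth M w) : ContDiff ℝ ∞ g :=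
  contDiff_infty.2 fun n => (Set.mem_iInter.1 hg n).1

/-- The multiplier space `O_M(Ḃ_𝒱, E^∞_𝒲)`: the distributions `f` such that, for every
`φ ∈ Ḃ_𝒱`, the product `f · φ`, that is, the distribution `θ ↦ ⟨f, φ θ⟩`, is (given by integration
against) a function of `E^∞_𝒲`. -/
def multiplierSpace (ι : E →ₗ[ℂ] (Rd d →ₘ[volume] ℂ)) (v w : ℕ → Rd d → ℝ) :
    Set (Distrib d) :=
  {f | ∀ (φ : Rd d → ℂ) (hφ : φ ∈ dotB v), ∃ g ∈ gelfandShilov ι w, ∀ θ : Test d,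
    f (smoothMul φ (contDiff_of_mem_weightedSmooth hφ) θ) = ∫ x, g x * θ x}

end FunctionSpaces

section Weights

/-- A weight function system: an increasing sequence of locally bounded (Lebesgue) measurable
functions with values in `[1, ∞)`. -/
structure IsWeightSystem (w : ℕ → Rd d → ℝ) : Prop where
  measurable : ∀ n, AEMeasurable (w n) volume
  one_le : ∀ n x, 1 ≤ w n x
  locallyBounded : ∀ (n : ℕ) (K : Set (Rd d)), IsCompact K → ∃ C : ℝ, ∀ x ∈ K, w n x ≤ C
  increasing : ∀ n x, w n x ≤ w (n + 1) x

/-- The system is weak-moderate (condition (wM)). -/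
def WeakModerate (w : ℕ → Rd d → ℝ) : Prop :=
  ∀ n, ∃ m, n ≤ m ∧ ∃ C : ℝ, 0 < C ∧
    ∀ x, ∀ y ∈ Metric.closedBall (0 : Rd d) 1, w n (x + y) ≤ C * w m x

/-- For each `n` there is `m ≥ n` with `w_n ^ 2 / w_m ∈ L^∞`. -/
def Squarable (w : ℕ → Rd d → ℝ) : Prop :=
  ∀ n, ∃ m, n ≤ m ∧ MemLp (fun x => w n x ^ 2 / w m x) ⊤ volume

end Weights

section MDFP

/-- All moments of `ψ` of order less than `L` vanish. -/
def VanishingMoments (L : ℕ) (ψ : Test d) : Prop :=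
  ∀ α : Fin d → ℕ, order α < L → ∫ x : Rd d, ((∏ i, x i ^ α i : ℝ) : ℂ) * ψ x = 0

/-- The moment-wise decomposition factorization property of the pair `(χ^0, χ^1)`. -/
def MDFP (χ : Fin 2 → Test d) : Prop :=
  ∃ K : Set (Rd d), IsCompact K ∧ (interior K).Nonempty ∧ ∀ L : ℕ,
    ∃ φ ψ : Fin 2 → Test d,
      (∀ ℓ, (φ ℓ, ψ ℓ) ≠ 0 ∧ tsupport (φ ℓ) ⊆ K ∧ tsupport (ψ ℓ) ⊆ K ∧
        VanishingMoments L (ψ ℓ)) ∧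
      (∀ x : Rd d, (2 : ℂ) ^ d * φ 0 ((2 : ℝ) • x) - φ 0 x = Laplacian.laplacian (ψ 0 : Rd d → ℂ) x) ∧
      ∫ x, φ 0 x = 1 ∧
      (∀ x, φ 0 x = ∑ ℓ, convolution (χ ℓ) (φ ℓ) (ContinuousLinearMap.mul ℂ ℂ) volume x) ∧
      (∀ x, ψ 0 x = ∑ ℓ, convolution (χ ℓ) (ψ ℓ) (ContinuousLinearMap.mul ℂ ℂ) volume x)

end MDFP

end Mollif

/-! All four conditions say that `f` is a smooth function `F` each of whose derivatives, divided by
some `w m`, lies in `E_sl`. This common form is `IsSlSmooth` together with `Represents`, and the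
implications pass through it.

From multipliers to `IsSlSmooth`: products with cut-offs show that `f` is a smooth function. If `G /
w m` had infinite `E_sl` norm for every `m`, a gliding hump would contradict the multiplier
property. One builds a single `φ ∈ Ḃ_𝒲`, the mollified `envelope`, which is at least a constant `c
k` over a weight on balls so large that the norm of `G φ` exceeds every `k`
(`exists_eNormSl_wdiv_lt_top`). Derivatives of `F` are handled by `(∂ᵢ G) φ = ∂ᵢ (G φ) - G ∂ᵢ φ`.
Given `IsSlSmooth`, the functions `∂^α F * φ_j` are bounded pointwise, uniformly in `j`, by averages
of higher derivatives of `F`, which gives (ii). The steps (ii) to (iii) to (iv) only compare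
constants.

From (iv) back: pick `L` larger than the growth exponent `r` in the MDFP. With `φ = φ^0_L` of
integral one, `f` is the limit of `f * φ_j`, and the increments are `f * φ_{j+1} - f * φ_j = 4^{-j}
Δ (f * ψ_j)`. Here `f * ψ_j = ∑ (f * χ^ℓ_j) * ψ^ℓ_j`, so the increments see `f` only through the
`χ^ℓ`. By Taylor's formula the vanishing moments of `ψ^ℓ` gain a factor `2^{-jL}`, which beats
`2^{rj}`. The telescoping series then converges with all derivatives in weighted `E_sl`
(`exists_represents_of_expGrowth`). Finally `F φ ∈ E^∞_𝒲` for `φ ∈ Ḃ_𝒲`, since an `E_sl` function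
times an `L^0` function lies in `E` (`memE_mul_of_memL0`), with `w_n^2 / w_m ∈ L^∞` absorbing the
product of two weights.

A device used throughout replaces local suprema by convolutions, the only operation known to be
bounded on `E`. By a local Sobolev inequality, values near `x` are bounded by `avgJet`, the
convolution of a jet with a fixed cut-off. The closed graph theorem bounds this convolution on `E`,
and (wM) moves the weight across the support of the cut-off (`exists_eNormSl_wdiv_avgJet_le`). -/

namespace Mollif

variable {d : ℕ}

/-! ### Partial derivatives along lists of directions, and jets -/

section Derivatives

/-- The iterated partial derivative along a list of coordinate directions. -/
noncomputable def iterPd (l : List (Fin d)) (g : Rd d → ℂ) : Rd d → ℂ :=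
  l.foldr pderiv g

@[simp] theorem iterPd_nil (g : Rd d → ℂ) : iterPd [] g = g := rfl

theorem iterPd_cons (i : Fin d) (l : List (Fin d)) (g : Rd d → ℂ) :
    iterPd (i :: l) g = pderiv i (iterPd l g) := rfl

theorem iterPd_append (l l' : List (Fin d)) (g : Rd d → ℂ) :
    iterPd (l ++ l') g = iterPd l (iterPd l' g) := List.foldr_append

theorem iterPd_concat (l : List (Fin d)) (i : Fin d) (g : Rd d → ℂ) :
    iterPd (l ++ [i]) g = iterPd l (pderiv i g) := iterPd_append l [i] g

theorem contDiff_pderiv {g : Rd d → ℂ} (hg : ContDiff ℝ ∞ g) (i : Fin d) :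
    ContDiff ℝ ∞ (pderiv i g) :=
  (hg.fderiv_right (m := ∞) (by simp)).clm_apply contDiff_const

theorem contDiff_iterPd {g : Rd d → ℂ} (hg : ContDiff ℝ ∞ g) (l : List (Fin d)) :
    ContDiff ℝ ∞ (iterPd l g) := by
  induction l with
  | nil => exact hg
  | cons i l ih => exact contDiff_pderiv ih i

theorem pderiv_comm {g : Rd d → ℂ} (hg : ContDiff ℝ ∞ g) (i j : Fin d) :
    pderiv i (pderiv j g) = pderiv j (pderiv i g) := by
  have key : ∀ (a b : Fin d) (x : Rd d), pderiv a (pderiv b g) x =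
      fderiv ℝ (fderiv ℝ g) x (EuclideanSpace.single a 1) (EuclideanSpace.single b 1) := by
    intro a b x
    have hd : DifferentiableAt ℝ (fderiv ℝ g) x :=
      (hg.fderiv_right (m := ∞) (by simp)).differentiable (by simp) x
    unfold pderiv
    rw [fderiv_clm_apply hd (differentiableAt_const _)]
    simp
  funext x
  rw [key, key]
  exact (hg.contDiffAt.isSymmSndFDerivAt
    (by
      rw [minSmoothness_of_isRCLikeNormedField]
      exact WithTop.coe_le_coe.2 (le_top : (2 : ℕ∞) ≤ ⊤))) _ _

theorem iterPd_perm {g : Rd d → ℂ} (hg : ContDiff ℝ ∞ g) {l l' : List (Fin d)}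
    (h : l.Perm l') : iterPd l g = iterPd l' g := by
  induction h with
  | nil => rfl
  | cons i _ ih => rw [iterPd_cons, iterPd_cons, ih]
  | swap i j l => exact pderiv_comm (contDiff_iterPd hg l) _ _
  | trans _ _ h1 h2 => rw [h1, h2]

theorem iterPd_replicate (n : ℕ) (i : Fin d) (g : Rd d → ℂ) :
    iterPd (List.replicate n i) g = (pderiv i)^[n] g := by
  induction n with
  | zero => rfl
  | succ n ih => rw [List.replicate_succ, iterPd_cons, ih, Function.iterate_succ_apply']

/-- The list of coordinate directions of a multi-index. -/
def indexList (α : Fin d → ℕ) : List (Fin d) :=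
  (List.finRange d).flatMap fun i => List.replicate (α i) i

theorem mderiv_eq_iterPd (α : Fin d → ℕ) (g : Rd d → ℂ) : mderiv α g = iterPd (indexList α) g := by
  unfold mderiv indexList
  induction List.finRange d with
  | nil => rfl
  | cons i l ih => rw [List.foldr_cons, List.flatMap_cons, iterPd_append, iterPd_replicate, ← ih]

theorem count_indexList (α : Fin d → ℕ) (i : Fin d) : (indexList α).count i = α i := by
  unfold indexList
  rw [List.count_flatMap]
  have : (List.map (List.count i ∘ fun j => List.replicate (α j) j) (List.finRange d)).sum
      = ∑ j : Fin d, if j = i then α j else 0 := by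
    rw [← List.sum_ofFn]
    rw [List.ofFn_eq_map]
    congr 1
    apply List.map_congr_left
    intro j _
    simp [List.count_replicate]
  rw [this]
  simp

theorem iterPd_eq_mderiv {g : Rd d → ℂ} (hg : ContDiff ℝ ∞ g) (l : List (Fin d)) :
    iterPd l g = mderiv (fun i => l.count i) g := by
  rw [mderiv_eq_iterPd]
  exact iterPd_perm hg
    (List.perm_iff_count.2 fun i => (count_indexList (fun i => l.count i) i).symm)

theorem order_count (l : List (Fin d)) : order (fun i => l.count i) = l.length := by
  unfold order
  simpa using Multiset.sum_count_eq_card (s := Finset.univ) (m := (l : Multiset (Fin d))) (by simp)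

theorem pderiv_add {g h : Rd d → ℂ} (hg : ContDiff ℝ ∞ g) (hh : ContDiff ℝ ∞ h) (i : Fin d) :
    pderiv i (g + h) = pderiv i g + pderiv i h := by
  funext x
  simp only [pderiv, Pi.add_apply]
  rw [fderiv_add (hg.differentiable (by simp) x) (hh.differentiable (by simp) x)]
  rfl

theorem pderiv_const_smul {g : Rd d → ℂ} (hg : ContDiff ℝ ∞ g) (c : ℂ) (i : Fin d) :
    pderiv i (c • g) = c • pderiv i g := by
  funext x
  simp only [pderiv, Pi.smul_apply]
  rw [fderiv_const_smul (hg.differentiable (by simp) x)]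
  rfl

theorem pderiv_mul {g h : Rd d → ℂ} (hg : ContDiff ℝ ∞ g) (hh : ContDiff ℝ ∞ h) (i : Fin d) :
    pderiv i (g * h) = pderiv i g * h + g * pderiv i h := by
  funext x
  simp only [pderiv, Pi.add_apply, Pi.mul_apply]
  rw [fderiv_mul (hg.differentiable (by simp) x) (hh.differentiable (by simp) x)]
  simp [mul_comm, add_comm]

theorem iterPd_add {g h : Rd d → ℂ} (hg : ContDiff ℝ ∞ g) (hh : ContDiff ℝ ∞ h)
    (l : List (Fin d)) : iterPd l (g + h) = iterPd l g + iterPd l h := by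
  induction l with
  | nil => rfl
  | cons i l ih =>
    rw [iterPd_cons, ih, pderiv_add (contDiff_iterPd hg l) (contDiff_iterPd hh l)]; rfl

theorem iterPd_const_smul {g : Rd d → ℂ} (hg : ContDiff ℝ ∞ g) (c : ℂ) (l : List (Fin d)) :
    iterPd l (c • g) = c • iterPd l g := by
  induction l with
  | nil => rfl
  | cons i l ih => rw [iterPd_cons, ih, pderiv_const_smul (contDiff_iterPd hg l)]; rfl

theorem pderiv_zero (i : Fin d) : pderiv i (0 : Rd d → ℂ) = 0 := by
  funext x; simp [pderiv]

theorem iterPd_zero (l : List (Fin d)) : iterPd l (0 : Rd d → ℂ) = 0 := by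
  induction l with
  | nil => rfl
  | cons i l ih => rw [iterPd_cons, ih, pderiv_zero]

theorem iterPd_sum {κ : Type*} (s : Finset κ) {g : κ → Rd d → ℂ} (hg : ∀ k, ContDiff ℝ ∞ (g k))
    (l : List (Fin d)) : iterPd l (∑ k ∈ s, g k) = ∑ k ∈ s, iterPd l (g k) := by
  classical
  induction s using Finset.induction_on with
  | empty => simp [iterPd_zero]
  | insert a s ha ih =>
    rw [Finset.sum_insert ha, Finset.sum_insert ha, iterPd_add (hg a) _, ih]
    have : (∑ k ∈ s, g k) = fun x => ∑ k ∈ s, g k x := by funext x; simp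
    rw [this]
    exact ContDiff.sum fun k _ => hg k

theorem tsupport_iterPd_subset (g : Rd d → ℂ) (l : List (Fin d)) :
    tsupport (iterPd l g) ⊆ tsupport g := by
  induction l with
  | nil => exact subset_rfl
  | cons i l ih => exact (tsupport_fderiv_apply_subset ℝ _).trans ih

theorem hasCompactSupport_iterPd {g : Rd d → ℂ} (hg : HasCompactSupport g) (l : List (Fin d)) :
    HasCompactSupport (iterPd l g) :=
  hg.of_isClosed_subset (isClosed_tsupport _) (tsupport_iterPd_subset g l)

theorem iterPd_comp_sub (g : Rd d → ℂ) (z : Rd d) (l : List (Fin d)) :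
    iterPd l (fun y => g (y - z)) = fun y => iterPd l g (y - z) := by
  induction l with
  | nil => rfl
  | cons i l ih =>
    rw [iterPd_cons, ih, iterPd_cons]
    funext y
    simp only [pderiv]
    rw [fderiv_comp_sub]

theorem fderiv_apply_eq_sum (g : Rd d → ℂ) (x v : Rd d) :
    fderiv ℝ g x v = ∑ i, v i * pderiv i g x := by
  have hv : v = ∑ i, v i • (EuclideanSpace.single i (1 : ℝ) : Rd d) := by
    simpa using ((EuclideanSpace.basisFun (Fin d) ℝ).sum_repr v).symm
  conv_lhs => rw [hv]
  rw [map_sum]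
  exact Finset.sum_congr rfl fun i _ => by simp [pderiv]

theorem smulRightL_proj_apply (i : Fin d) (c : ℂ) (v : Rd d) :
    ContinuousLinearMap.smulRightL ℝ (Rd d) ℂ (EuclideanSpace.proj i) c v = v i • c := rfl

theorem fderiv_eq_sum (g : Rd d → ℂ) (x : Rd d) : fderiv ℝ g x =
    ∑ i, ContinuousLinearMap.smulRightL ℝ (Rd d) ℂ (EuclideanSpace.proj i) (pderiv i g x) := by
  ext v
  rw [fderiv_apply_eq_sum, sum_apply]
  exact Finset.sum_congr rfl fun i _ => by
    rw [smulRightL_proj_apply, Complex.real_smul]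

theorem norm_smulRightL_proj_le (i : Fin d) :
    ‖ContinuousLinearMap.smulRightL ℝ (Rd d) ℂ (EuclideanSpace.proj i)‖ ≤ 1 := by
  refine ContinuousLinearMap.opNorm_le_bound _ zero_le_one fun c => ?_
  refine ContinuousLinearMap.opNorm_le_bound _ (by positivity) fun v => ?_
  rw [smulRightL_proj_apply, norm_smul, one_mul, mul_comm]
  exact mul_le_mul_of_nonneg_left (PiLp.norm_apply_le v i) (norm_nonneg _)

theorem norm_fderiv_le_sum (g : Rd d → ℂ) (x : Rd d) :
    ‖fderiv ℝ g x‖ ≤ ∑ i, ‖pderiv i g x‖ := by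
  rw [fderiv_eq_sum]
  refine (norm_sum_le _ _).trans (Finset.sum_le_sum fun i _ => ?_)
  refine (ContinuousLinearMap.le_opNorm _ _).trans ?_
  exact mul_le_of_le_one_left (norm_nonneg _) (norm_smulRightL_proj_le i)

theorem norm_iteratedFDeriv_pderiv_le {g : Rd d → ℂ} (hg : ContDiff ℝ ∞ g) (i : Fin d) (k : ℕ)
    (x : Rd d) : ‖iteratedFDeriv ℝ k (pderiv i g) x‖ ≤ ‖iteratedFDeriv ℝ (k + 1) g x‖ := by
  let ev : (Rd d →L[ℝ] ℂ) →L[ℝ] ℂ :=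
    ContinuousLinearMap.apply ℝ ℂ (EuclideanSpace.single i (1 : ℝ) : Rd d)
  have h1 : pderiv i g = ev ∘ fderiv ℝ g := rfl
  have h2 : ‖ev‖ ≤ 1 := by
    refine ContinuousLinearMap.opNorm_le_bound _ zero_le_one fun T => ?_
    refine (T.le_opNorm _).trans ?_
    simp
  rw [h1, ← norm_iteratedFDeriv_fderiv]
  refine (ev.norm_iteratedFDeriv_comp_left (N := ∞)
    (hg.fderiv_right (m := ∞) (by simp)).contDiffAt (by exact_mod_cast le_top)).trans ?_
  exact mul_le_of_le_one_left (norm_nonneg _) h2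

theorem norm_iteratedFDeriv_iterPd_le {g : Rd d → ℂ} (hg : ContDiff ℝ ∞ g) (l : List (Fin d))
    (k : ℕ) (x : Rd d) :
    ‖iteratedFDeriv ℝ k (iterPd l g) x‖ ≤ ‖iteratedFDeriv ℝ (k + l.length) g x‖ := by
  induction l generalizing k with
  | nil => simp
  | cons i l ih =>
    refine (norm_iteratedFDeriv_pderiv_le (contDiff_iterPd hg l) i k x).trans ((ih _).trans ?_)
    rw [List.length_cons, show k + 1 + l.length = k + (l.length + 1) by ring]

theorem norm_iteratedFDeriv_succ_le_sum {g : Rd d → ℂ} (hg : ContDiff ℝ ∞ g) (k : ℕ) (x : Rd d) :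
    ‖iteratedFDeriv ℝ (k + 1) g x‖ ≤ ∑ i, ‖iteratedFDeriv ℝ k (pderiv i g) x‖ := by
  rw [← norm_iteratedFDeriv_fderiv]
  have h1 : fderiv ℝ g = fun x => ∑ i, (ContinuousLinearMap.smulRightL ℝ (Rd d) ℂ
      (EuclideanSpace.proj i) ∘ pderiv i g) x := by
    funext x; exact fderiv_eq_sum g x
  have h2 : ∀ i, ContDiff ℝ k ((ContinuousLinearMap.smulRightL ℝ (Rd d) ℂ
      (EuclideanSpace.proj i)) ∘ pderiv i g) := fun i =>
    (ContinuousLinearMap.contDiff _).comp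
      ((contDiff_pderiv hg i).of_le (by exact_mod_cast le_top))
  rw [h1, iteratedFDeriv_fun_sum_apply (fun i _ => (h2 i).contDiffAt)]
  refine (norm_sum_le _ _).trans (Finset.sum_le_sum fun i _ => ?_)
  refine (ContinuousLinearMap.norm_iteratedFDeriv_comp_left _ (N := ∞)
    (contDiff_pderiv hg i).contDiffAt (by exact_mod_cast le_top)).trans ?_
  exact mul_le_of_le_one_left (norm_nonneg _) (norm_smulRightL_proj_le i)

/-- The finite set of lists of coordinate directions of length at most `N`. -/
noncomputable def listsLE (d N : ℕ) : Finset (List (Fin d)) :=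
  (List.finite_length_le (Fin d) N).toFinset

@[simp] theorem mem_listsLE {N : ℕ} {l : List (Fin d)} : l ∈ listsLE d N ↔ l.length ≤ N := by
  simp [listsLE]

/-- Expanding one slot of the multilinear derivative in coordinates gives `d` terms of order one
less, so `k` expansions cost `d ^ k`. -/
theorem norm_iteratedFDeriv_le_sum {g : Rd d → ℂ} (hg : ContDiff ℝ ∞ g) (k : ℕ) (x : Rd d) :
    ‖iteratedFDeriv ℝ k g x‖ ≤ d ^ k * ∑ l ∈ listsLE d k, ‖iterPd l g x‖ := by
  induction k generalizing g with
  | zero =>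
    rw [norm_iteratedFDeriv_zero, pow_zero, one_mul]
    exact Finset.single_le_sum (f := fun l => ‖iterPd l g x‖) (fun _ _ => norm_nonneg _)
      (mem_listsLE.2 (le_refl 0) : ([] : List (Fin d)) ∈ _)
  | succ k ih =>
    refine (norm_iteratedFDeriv_succ_le_sum hg k x).trans ?_
    have : ∀ i ∈ (Finset.univ : Finset (Fin d)), ‖iteratedFDeriv ℝ k (pderiv i g) x‖ ≤
        d ^ k * ∑ l ∈ listsLE d (k + 1), ‖iterPd l g x‖ := by
      intro i _
      refine (ih (contDiff_pderiv hg i)).trans ?_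
      gcongr
      -- Appending `i` is injective, so the sum over the lists `l ++ [i]` is part of the sum over
      -- all lists of length at most `k + 1`.
      have h2 := Finset.sum_image (s := listsLE d k) (g := fun l => l ++ [i])
        (f := fun l => ‖iterPd l g x‖) (fun a _ b _ h => List.append_cancel_right h)
      simp only [iterPd_concat] at h2
      rw [← h2]
      refine Finset.sum_le_sum_of_subset_of_nonneg ?_ fun _ _ _ => norm_nonneg _
      intro l hl
      obtain ⟨l', hl', rfl⟩ := Finset.mem_image.1 hl
      rw [mem_listsLE] at hl' ⊢
      simpa using hl'
    refine (Finset.sum_le_sum this).trans (le_of_eq ?_)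
    rw [Finset.sum_const, Finset.card_univ, Fintype.card_fin, nsmul_eq_mul, pow_succ]
    ring

/-- The sum of the norms of the derivatives of order at most `N`. -/
noncomputable def jet (N : ℕ) (g : Rd d → ℂ) (x : Rd d) : ℝ :=
  ∑ k ∈ Finset.range (N + 1), ‖iteratedFDeriv ℝ k g x‖

theorem jet_nonneg (N : ℕ) (g : Rd d → ℂ) (x : Rd d) : 0 ≤ jet N g x :=
  Finset.sum_nonneg fun _ _ => norm_nonneg _

theorem continuous_jet (N : ℕ) {g : Rd d → ℂ} (hg : ContDiff ℝ ∞ g) :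
    Continuous (jet N g) :=
  continuous_finsetSum _ fun _ _ =>
    (hg.continuous_iteratedFDeriv (by exact_mod_cast le_top)).norm

theorem norm_iteratedFDeriv_le_jet {k N : ℕ} (h : k ≤ N) (g : Rd d → ℂ) (x : Rd d) :
    ‖iteratedFDeriv ℝ k g x‖ ≤ jet N g x :=
  Finset.single_le_sum (f := fun k => ‖iteratedFDeriv ℝ k g x‖) (fun _ _ => norm_nonneg _)
    (Finset.mem_range.2 (Nat.lt_succ_of_le h))

theorem jet_iterPd_le {N L : ℕ} {l : List (Fin d)} (hl : l.length ≤ L) {g : Rd d → ℂ}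
    (hg : ContDiff ℝ ∞ g) (x : Rd d) : jet N (iterPd l g) x ≤ jet (N + L) g x := by
  refine (Finset.sum_le_sum fun k _ => norm_iteratedFDeriv_iterPd_le hg l k x).trans ?_
  have h2 := Finset.sum_image (s := Finset.range (N + 1)) (g := fun k => k + l.length)
    (f := fun k => ‖iteratedFDeriv ℝ k g x‖) (fun a _ b _ h => Nat.add_right_cancel h)
  rw [← h2]
  refine Finset.sum_le_sum_of_subset_of_nonneg ?_ fun _ _ _ => norm_nonneg _
  intro l hl
  obtain ⟨k, hk, rfl⟩ := Finset.mem_image.1 hl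
  rw [Finset.mem_range] at hk ⊢
  omega

theorem exists_jet_le_sum_iterPd (d N : ℕ) : ∃ C : ℝ, 0 ≤ C ∧ ∀ g : Rd d → ℂ, ContDiff ℝ ∞ g →
    ∀ x, jet N g x ≤ C * ∑ l ∈ listsLE d N, ‖iterPd l g x‖ := by
  refine ⟨∑ k ∈ Finset.range (N + 1), (d : ℝ) ^ k, by positivity, fun g hg x => ?_⟩
  rw [Finset.sum_mul]
  refine Finset.sum_le_sum fun k hk => (norm_iteratedFDeriv_le_sum hg k x).trans ?_
  gcongr
  intro l hl
  rw [mem_listsLE] at hl ⊢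
  rw [Finset.mem_range] at hk
  omega

end Derivatives

/-! ### A local Sobolev inequality -/

section Sobolev

theorem integrable_norm_iteratedFDeriv {g : Rd d → ℂ} (hg : ContDiff ℝ ∞ g)
    (hc : HasCompactSupport g) (k : ℕ) : Integrable (fun x => ‖iteratedFDeriv ℝ k g x‖) :=
  ((hg.continuous_iteratedFDeriv (by exact_mod_cast le_top)).integrable_of_hasCompactSupport
    (hc.iteratedFDeriv k)).norm

theorem integrable_jet {g : Rd d → ℂ} (hg : ContDiff ℝ ∞ g) (hc : HasCompactSupport g) (N : ℕ) :
    Integrable (jet N g) :=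
  integrable_finsetSum _ fun _ _ => integrable_norm_iteratedFDeriv hg hc _

/-- Fourier inversion: integrability of `d + 1` derivatives makes the transform decay like `(1 +
‖ξ‖) ^ (-(d + 1))`, the first integer power that is integrable on `ℝ^d`. -/
theorem exists_norm_le_integral_jet_of_hasCompactSupport (d : ℕ) : ∃ C : ℝ, 0 ≤ C ∧
    ∀ g : Rd d → ℂ, ContDiff ℝ ∞ g → HasCompactSupport g →
      ∀ x, ‖g x‖ ≤ C * ∫ y, jet (d + 1) g y := by
  have hint : Integrable (fun ξ : Rd d => (1 + ‖ξ‖) ^ (-((d : ℝ) + 1))) :=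
    integrable_one_add_norm (by simp)
  refine ⟨(2 ^ (d + 1) * (2 * 2 ^ (d + 1))) * ∫ ξ : Rd d, (1 + ‖ξ‖) ^ (-((d : ℝ) + 1)), ?_, ?_⟩
  · have : 0 ≤ ∫ ξ : Rd d, (1 + ‖ξ‖) ^ (-((d : ℝ) + 1)) :=
      integral_nonneg fun ξ => by positivity
    positivity
  intro g hg hc x
  set I := ∫ y, jet (d + 1) g y with hI
  have hI0 : 0 ≤ I := integral_nonneg fun y => jet_nonneg _ _ _
  have hgi : Integrable g := hg.continuous.integrable_of_hasCompactSupport hc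
  have hpow : ∀ n ≤ d + 1, ∀ ξ, ‖ξ‖ ^ n * ‖FourierTransform.fourier g ξ‖ ≤ 2 ^ (d + 1) * I := by
    intro n hn ξ
    have h := Real.pow_mul_norm_iteratedFDeriv_fourier_le (f := g) (K := 0) (N := ⊤) hg
      (fun k n hk _ => by
        have hk0 : k = 0 := by exact_mod_cast (nonpos_iff_eq_zero.1 hk)
        subst hk0
        simpa using integrable_norm_iteratedFDeriv hg hc n) (k := 0) (n := n) (by simp)
      (by exact_mod_cast le_top) ξ
    rw [norm_iteratedFDeriv_zero] at h
    refine h.trans ?_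
    have h1 : ∑ p ∈ Finset.range (0 + 1) ×ˢ Finset.range (n + 1),
        ∫ v : Rd d, ‖v‖ ^ p.1 * ‖iteratedFDeriv ℝ p.2 g v‖ ≤ I := by
      rw [Finset.sum_product]
      simp only [zero_add, Finset.range_one, Finset.sum_singleton, pow_zero, one_mul]
      rw [← integral_finsetSum _ fun k _ => integrable_norm_iteratedFDeriv hg hc k]
      refine integral_mono (integrable_jet hg hc n) (integrable_jet hg hc (d + 1)) fun y => ?_
      refine Finset.sum_le_sum_of_subset_of_nonneg ?_ fun _ _ _ => norm_nonneg _
      exact Finset.range_mono (by omega)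
    have h2 : (2 * Real.pi) ^ 0 * (2 * ((0 : ℕ) : ℝ) + 2) ^ n ≤ 2 ^ (d + 1) := by
      simp only [pow_zero, one_mul, Nat.cast_zero, mul_zero, zero_add]
      exact pow_le_pow_right₀ (by norm_num) hn
    exact mul_le_mul h2 h1 (Finset.sum_nonneg fun p _ => integral_nonneg fun y => by positivity)
      (by positivity)
  have hF : ∀ ξ, ‖FourierTransform.fourier g ξ‖ ≤
      (2 ^ (d + 1) * (2 * 2 ^ (d + 1))) * I * (1 + ‖ξ‖) ^ (-((d : ℝ) + 1)) := by
    intro ξ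
    have hpos : 0 < (1 + ‖ξ‖) := by positivity
    rw [Real.rpow_neg hpos.le, ← div_eq_mul_inv, le_div_iff₀ (by positivity)]
    have e : (1 + ‖ξ‖) ^ ((d : ℝ) + 1) = (1 + ‖ξ‖) ^ (d + 1) := by
      rw [← Real.rpow_natCast]; push_cast; rfl
    rw [e]
    have h0 := hpow 0 (by omega) ξ
    have h1 := hpow (d + 1) le_rfl ξ
    rw [pow_zero, one_mul] at h0
    have h3 : (1 + ‖ξ‖) ^ (d + 1) ≤ 2 ^ (d + 1) * (1 + ‖ξ‖ ^ (d + 1)) := by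
      refine (add_pow_le zero_le_one (norm_nonneg ξ) (d + 1)).trans ?_
      rw [one_pow]
      have : (2 : ℝ) ^ (d + 1 - 1) ≤ 2 ^ (d + 1) := pow_le_pow_right₀ (by norm_num) (by omega)
      gcongr
    calc ‖FourierTransform.fourier g ξ‖ * (1 + ‖ξ‖) ^ (d + 1)
        ≤ ‖FourierTransform.fourier g ξ‖ * (2 ^ (d + 1) * (1 + ‖ξ‖ ^ (d + 1))) := by gcongr
      _ = 2 ^ (d + 1) * (‖FourierTransform.fourier g ξ‖ +
            ‖ξ‖ ^ (d + 1) * ‖FourierTransform.fourier g ξ‖) := by ring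
      _ ≤ 2 ^ (d + 1) * (2 ^ (d + 1) * I + 2 ^ (d + 1) * I) := by gcongr
      _ = _ := by ring
  have hFc : Continuous (FourierTransform.fourier g) :=
    VectorFourier.fourierIntegral_continuous Real.continuous_fourierChar
      (by exact continuous_inner) hgi
  have hFi : Integrable (FourierTransform.fourier g) := by
    refine (hint.const_mul ((2 ^ (d + 1) * (2 * 2 ^ (d + 1))) * I)).mono'
      hFc.aestronglyMeasurable (Filter.Eventually.of_forall hF)
  rw [← hgi.fourierInv_fourier_eq hFi hg.continuous.continuousAt (v := x)]
  rw [Real.fourierInv_eq]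
  refine (norm_integral_le_integral_norm _).trans ?_
  simp only [Circle.norm_smul]
  refine (integral_mono hFi.norm (hint.const_mul _) hF).trans (le_of_eq ?_)
  rw [integral_const_mul]
  ring

theorem exists_jet_mul_le (N : ℕ) : ∃ C : ℝ, 0 ≤ C ∧ ∀ g h : Rd d → ℂ, ContDiff ℝ ∞ g →
    ContDiff ℝ ∞ h → ∀ x, jet N (fun y => g y * h y) x ≤ C * (jet N g x * jet N h x) := by
  refine ⟨∑ k ∈ Finset.range (N + 1), ∑ i ∈ Finset.range (k + 1), (k.choose i : ℝ),
    by positivity, fun g h hg hh x => ?_⟩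
  rw [Finset.sum_mul]
  refine Finset.sum_le_sum fun k hk => ?_
  refine (norm_iteratedFDeriv_mul_le hg hh x (by exact_mod_cast le_top)).trans ?_
  rw [Finset.sum_mul]
  refine Finset.sum_le_sum fun i hi => ?_
  rw [Finset.mem_range] at hk hi
  rw [mul_assoc]
  gcongr
  · exact jet_nonneg _ _ _
  · exact norm_iteratedFDeriv_le_jet (by omega) _ _
  · exact norm_iteratedFDeriv_le_jet (by omega) _ _

/-- A local form of the Sobolev embedding `W^{d+1,1} ⊆ C`. -/
theorem exists_norm_le_setIntegral_jet (d : ℕ) : ∃ C : ℝ, 0 ≤ C ∧ ∀ g : Rd d → ℂ,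
    ContDiff ℝ ∞ g → ∀ x, ‖g x‖ ≤ C * ∫ y in Metric.closedBall x 1, jet (d + 1) g y := by
  obtain ⟨C, hC, hS⟩ := exists_norm_le_integral_jet_of_hasCompactSupport d
  obtain ⟨C₁, hC₁, hL⟩ := exists_jet_mul_le (d := d) (d + 1)
  -- The global inequality is applied to `g` times the bump translated to `x`. It equals one at `x`
  -- and vanishes outside the unit ball.
  let b : ContDiffBump (0 : Rd d) := ⟨1 / 2, 1, by norm_num, by norm_num⟩
  let κ : Rd d → ℂ := fun y => (b y : ℂ)
  have hκ : ContDiff ℝ ∞ κ := Complex.ofRealCLM.contDiff.comp b.contDiff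
  have hκc : HasCompactSupport κ :=
    b.hasCompactSupport.comp_left (g := fun t : ℝ => (t : ℂ)) (by simp)
  have hκs : ∀ y, 1 < ‖y‖ → κ y = 0 := by
    intro y hy
    have : b y = 0 := b.zero_of_le_dist (by simpa using hy.le)
    simp [κ, this]
  obtain ⟨M, hM⟩ := (continuous_jet (d + 1) hκ).bounded_above_of_compact_support (by
    have h0 : Function.support (jet (d + 1) κ) ⊆ tsupport κ := by
      intro y hy
      by_contra hcon
      apply hy
      refine Finset.sum_eq_zero fun k _ => ?_
      rw [norm_eq_zero]
      exact image_eq_zero_of_notMem_tsupport fun h => hcon (tsupport_iteratedFDeriv_subset k h)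
    exact HasCompactSupport.intro hκc fun y hy => by
      by_contra hne
      exact hy (h0 hne))
  have hM0 : 0 ≤ M := (norm_nonneg _).trans (hM 0)
  refine ⟨C * (C₁ * M), by positivity, fun g hg x => ?_⟩
  have hκx : ContDiff ℝ ∞ (fun y => κ (y - x)) := hκ.comp (contDiff_id.sub contDiff_const)
  have hκxc : HasCompactSupport (fun y => κ (y - x)) :=
    hκc.comp_homeomorph (Homeomorph.subRight x)
  have h1 := hS (fun y => κ (y - x) * g y) (hκx.mul hg) hκxc.mul_right x
  have h2 : κ (x - x) = 1 := by
    have : b 0 = 1 := b.one_of_mem_closedBall (by simp [b])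
    simp [κ, this]
  simp only [h2, one_mul] at h1
  refine h1.trans ?_
  rw [mul_assoc]
  gcongr
  rw [← setIntegral_eq_integral_of_forall_compl_eq_zero (s := Metric.closedBall x 1), ←
    integral_const_mul]
  · refine setIntegral_mono_on
      (integrable_jet (hκx.mul hg) hκxc.mul_right _).integrableOn
      (((continuous_const.mul (continuous_jet _ hg)).continuousOn).integrableOn_compact
        (isCompact_closedBall _ _)) Metric.isClosed_closedBall.measurableSet fun y _ => ?_
    refine (hL _ _ hκx hg y).trans ?_
    rw [mul_assoc]
    gcongr
    · exact jet_nonneg _ _ _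
    · have : jet (d + 1) (fun y => κ (y - x)) y = jet (d + 1) κ (y - x) := by
        unfold jet
        simp only [iteratedFDeriv_comp_sub]
      rw [this]
      exact (le_abs_self _).trans (hM _)
  · intro y hy
    have hy' : 1 < ‖y - x‖ := by simpa [dist_eq_norm] using hy
    -- Vanishing on a whole neighbourhood is needed in order to kill the derivatives in the jet too.
    have hev : (fun y => κ (y - x) * g y) =ᶠ[nhds y] fun _ => 0 := by
      have : ∀ᶠ z in nhds y, 1 < ‖z - x‖ :=
        ((continuous_id.sub continuous_const).norm.isOpen_preimage _ isOpen_Ioi).mem_nhds hy'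
      filter_upwards [this] with z hz
      rw [hκs _ hz, zero_mul]
    refine Finset.sum_eq_zero fun k _ => ?_
    rw [(hev.iteratedFDeriv ℝ k).eq_of_nhds]
    simp

end Sobolev

/-! ### Local finite order of distributions; smoothness of `f * φ` -/

section DistributionConvolution

/-- The test function given by a smooth compactly supported function. -/
def mkTest (g : Rd d → ℂ) (hg : ContDiff ℝ ∞ g) (hc : HasCompactSupport g) : Test d where
  toFun := g
  contDiff' := hg
  hasCompactSupport' := hc
  tsupport_subset' := fun _ _ => trivial

theorem test_contDiff (φ : Test d) : ContDiff ℝ ∞ φ := φ.contDiff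

/-- The iterated partial derivative of a test function. -/
noncomputable def testPd (l : List (Fin d)) (φ : Test d) : Test d :=
  mkTest (iterPd l φ) (contDiff_iterPd (test_contDiff φ) l)
    (hasCompactSupport_iterPd φ.hasCompactSupport l)

@[simp] theorem coe_testPd (l : List (Fin d)) (φ : Test d) : ⇑(testPd l φ) = iterPd l φ := rfl

@[simp] theorem coe_reflTranslate (φ : Test d) (x : Rd d) :
    ⇑(reflTranslate φ x) = fun y => φ (x - y) := rfl

@[simp] theorem coe_dil (φ : Test d) (j : ℕ) :
    ⇑(dil φ j) = fun x => (2 : ℂ) ^ (j * d) * φ ((2 : ℝ) ^ j • x) := rfl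

@[simp] theorem coe_smoothMul (φ : Rd d → ℂ) (hφ : ContDiff ℝ ∞ φ) (θ : Test d) :
    ⇑(smoothMul φ hφ θ) = fun x => φ x * θ x := rfl

theorem Test.coe_add (φ ψ : Test d) : ⇑(φ + ψ) = ⇑φ + ⇑ψ := rfl
theorem Test.coe_sub (φ ψ : Test d) : ⇑(φ - ψ) = ⇑φ - ⇑ψ := rfl
theorem Test.coe_smul (c : ℂ) (φ : Test d) : ⇑(c • φ) = c • ⇑φ := rfl

/-- Distributions have finite order on compact sets: the restriction of `f` to functions supported
in `K` is continuous, hence bounded by finitely many of the defining seminorms. `N` is the largest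
of their orders. -/
theorem exists_norm_apply_le_iteratedFDeriv (f : Distrib d) {K : Set (Rd d)} (hK : IsCompact K) :
    ∃ (N : ℕ) (C : ℝ), 0 ≤ C ∧ ∀ (θ : Test d), tsupport θ ⊆ K → ∀ M : ℝ, 0 ≤ M →
      (∀ k ≤ N, ∀ x, ‖iteratedFDeriv ℝ k θ x‖ ≤ M) → ‖f θ‖ ≤ C * M := by
  let Kc : Compacts (Rd d) := ⟨K, hK⟩
  have hKsub : (Kc : Set (Rd d)) ⊆ ((⊤ : Opens (Rd d)) : Set (Rd d)) := fun _ _ => trivial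
  let T := TestFunction.ofSupportedInCLM (E := Rd d) (F := ℂ) (n := ⊤) ℂ hKsub
  let q : Seminorm ℂ 𝓓_{Kc}(Rd d, ℂ) :=
    (normSeminorm ℂ ℂ).comp ((f ∘L T : 𝓓_{Kc}(Rd d, ℂ) →L[ℂ] ℂ) : 𝓓_{Kc}(Rd d, ℂ) →ₗ[ℂ] ℂ)
  have hq : Continuous q := (f ∘L T).continuous.norm
  obtain ⟨s, C, -, hb⟩ := Seminorm.bound_of_continuous
    (ContDiffMapSupportedIn.withSeminorms ℂ (Rd d) ℂ ⊤ Kc) q hq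
  refine ⟨s.sup id, C, C.2, fun θ hθ M hM hbd => ?_⟩
  let θ' : 𝓓_{Kc}(Rd d, ℂ) := ContDiffMapSupportedIn.of_support_subset (test_contDiff θ)
    (subset_closure.trans hθ)
  have h1 : T θ' = θ := by ext x; rfl
  have h2 := hb θ'
  have h3 : q θ' = ‖f θ‖ := by
    change ‖f (T θ')‖ = _
    rw [h1]
  rw [h3] at h2
  refine h2.trans ?_
  rw [smul_apply]
  refine mul_le_mul_of_nonneg_left ?_ C.2
  refine Seminorm.finset_sup_apply_le hM fun i hi => ?_
  rw [ContDiffMapSupportedIn.seminorm_top_le_iff ℂ hM]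
  exact fun x _ => hbd i (Finset.le_sup (f := id) hi) x

theorem exists_norm_apply_le (f : Distrib d) {K : Set (Rd d)} (hK : IsCompact K) :
    ∃ (N : ℕ) (C : ℝ), 0 ≤ C ∧ ∀ (θ : Test d), tsupport θ ⊆ K → ∀ M : ℝ, 0 ≤ M →
      (∀ l : List (Fin d), l.length ≤ N → ∀ x, ‖iterPd l θ x‖ ≤ M) → ‖f θ‖ ≤ C * M := by
  obtain ⟨N, C, hC, h⟩ := exists_norm_apply_le_iteratedFDeriv f hK
  obtain ⟨C₁, hC₁, h₁⟩ := exists_jet_le_sum_iterPd d N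
  refine ⟨N, C * (C₁ * (listsLE d N).card), by positivity, fun θ hθ M hM hb => ?_⟩
  have h2 := h θ hθ (C₁ * (listsLE d N).card * M) (by positivity) fun k hk x => by
    refine (norm_iteratedFDeriv_le_jet hk θ x).trans ((h₁ θ (test_contDiff θ) x).trans ?_)
    rw [mul_assoc]
    gcongr
    rw [← nsmul_eq_mul]
    exact Finset.sum_le_card_nsmul _ _ _ fun l hl => hb l (mem_listsLE.1 hl) x
  rwa [← mul_assoc] at h2

/-- Convergence of distributions along test functions with uniformly convergent derivatives. -/
theorem tendsto_apply_of_iterPd {κ : Type*} {F : Filter κ} (f : Distrib d) {K : Set (Rd d)}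
    (hK : IsCompact K) (θ : κ → Test d) (θ₀ : Test d) (hs : ∀ᶠ j in F, tsupport (θ j) ⊆ K)
    (hs₀ : tsupport θ₀ ⊆ K)
    (h : ∀ l : List (Fin d), ∀ ε > 0, ∀ᶠ j in F, ∀ x, ‖iterPd l (θ j) x - iterPd l θ₀ x‖ ≤ ε) :
    Filter.Tendsto (fun j => f (θ j)) F (nhds (f θ₀)) := by
  obtain ⟨N, C, hC, hb⟩ := exists_norm_apply_le f hK
  rw [Metric.tendsto_nhds]
  intro ε hε
  have hall : ∀ᶠ j in F, ∀ l ∈ listsLE d N, ∀ x,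
      ‖iterPd l (θ j) x - iterPd l θ₀ x‖ ≤ ε / (C + 1) := by
    rw [Filter.eventually_all_finset]
    exact fun l _ => h l _ (by positivity)
  filter_upwards [hs, hall] with j hj1 hj2
  rw [dist_eq_norm, ← map_sub]
  have h1 := hb (θ j - θ₀) ?_ (ε / (C + 1)) (by positivity) ?_
  · refine h1.trans_lt ?_
    rw [mul_div_assoc', div_lt_iff₀ (by positivity)]
    nlinarith
  · rw [Test.coe_sub]
    exact (tsupport_sub _ _).trans (Set.union_subset hj1 hs₀)
  · intro l hl x
    have e : (⇑(θ j - θ₀) : Rd d → ℂ) = ⇑(θ j) + (-1 : ℂ) • ⇑θ₀ := by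
      rw [Test.coe_sub]; funext y; simp [sub_eq_add_neg]
    have hs : ContDiff ℝ ∞ ((-1 : ℂ) • ⇑θ₀) := contDiff_const.smul (test_contDiff θ₀)
    rw [e, iterPd_add (test_contDiff _) hs, iterPd_const_smul (test_contDiff _)]
    have := hj2 l (mem_listsLE.2 hl) x
    simpa [sub_eq_add_neg] using this

/-- The reflection `y ↦ φ (-y)`. -/
noncomputable def testRefl (φ : Test d) : Test d := reflTranslate φ 0

/-- The translate `y ↦ g (y - z)`. -/
noncomputable def testTranslate (g : Test d) (z : Rd d) : Test d :=
  mkTest (fun y => g (y - z)) ((test_contDiff g).comp (contDiff_id.sub contDiff_const))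
    (g.hasCompactSupport.comp_homeomorph (Homeomorph.subRight z))

@[simp] theorem coe_testTranslate (g : Test d) (z : Rd d) :
    ⇑(testTranslate g z) = fun y => g (y - z) := rfl

theorem reflTranslate_eq (φ : Test d) (z : Rd d) :
    reflTranslate φ z = testTranslate (testRefl φ) z := by
  ext y; simp [testRefl]

theorem iterPd_testTranslate (g : Test d) (z : Rd d) (l : List (Fin d)) :
    iterPd l (testTranslate g z) = fun y => iterPd l g (y - z) := iterPd_comp_sub g z l

theorem exists_lipschitz_iterPd (g : Test d) (l : List (Fin d)) :
    ∃ C : ℝ≥0, LipschitzWith C (iterPd l g) :=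
  ContDiff.lipschitzWith_of_hasCompactSupport
    (hasCompactSupport_iterPd g.hasCompactSupport l)
    (contDiff_iterPd (test_contDiff g) l) (by simp)

theorem pderiv_comp_neg (g : Rd d → ℂ) (i : Fin d) :
    pderiv i (fun y => g (-y)) = fun y => -pderiv i g (-y) := by
  funext y
  simp only [pderiv]
  have h := (fderiv_comp_smul (𝕜 := ℝ) (f := g) (-1 : ℝ) (x := y))
  simp only [neg_smul, one_smul] at h
  rw [h]
  rfl

theorem tsupport_testTranslate_subset (g : Test d) {r R : ℝ}
    (hr : tsupport g ⊆ Metric.closedBall 0 r)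
    {z : Rd d} (hz : ‖z‖ ≤ R) : tsupport (testTranslate g z) ⊆ Metric.closedBall 0 (r + R) := by
  refine closure_minimal ?_ Metric.isClosed_closedBall
  intro y hy
  have h1 : y - z ∈ tsupport g := subset_closure (by simpa using hy)
  have h2 := hr h1
  rw [mem_closedBall_zero_iff] at h2 ⊢
  calc ‖y‖ = ‖(y - z) + z‖ := by simp
    _ ≤ r + R := (norm_add_le _ _).trans (add_le_add h2 hz)

theorem exists_tsupport_subset_closedBall (g : Test d) :
    ∃ r : ℝ, 0 ≤ r ∧ tsupport g ⊆ Metric.closedBall 0 r := by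
  obtain ⟨r, hr⟩ := g.hasCompactSupport.isCompact.isBounded.subset_closedBall 0
  exact ⟨max r 0, le_max_right _ _,
    hr.trans (Metric.closedBall_subset_closedBall (le_max_left _ _))⟩

/-- First order Taylor estimate for smooth compactly supported functions. -/
theorem exists_norm_sub_sub_fderiv_le {g : Rd d → ℂ} (hg : ContDiff ℝ ∞ g)
    (hc : HasCompactSupport g) :
    ∃ C : ℝ, 0 ≤ C ∧ ∀ x h, ‖g (x + h) - g x - fderiv ℝ g x h‖ ≤ C * ‖h‖ ^ 2 := by
  obtain ⟨C, hC⟩ := ContDiff.lipschitzWith_of_hasCompactSupport (n := ∞) (hc.fderiv (𝕜 := ℝ))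
    (hg.fderiv_right (m := ∞) (by simp)) (by simp)
  refine ⟨C, C.2, fun x h => ?_⟩
  -- On the segment the derivative differs from its value at `x` by at most `C * ‖h‖`, since it is
  -- Lipschitz. The mean value inequality contributes the second factor `‖h‖`.
  have := (convex_segment x (x + h)).norm_image_sub_le_of_norm_fderiv_le' (𝕜 := ℝ) (f := g)
    (φ := fderiv ℝ g x) (C := C * ‖h‖) (x := x) (y := x + h)
    (fun y _ => hg.differentiable (by simp) y) (fun y hy => by
      refine (hC.norm_sub_le y x).trans ?_
      gcongr
      obtain ⟨a, b, ha, hb, hab, rfl⟩ := hy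
      have : a • x + b • (x + h) - x = b • h := by
        rw [smul_add, ← add_assoc, ← add_smul, hab, one_smul, add_sub_cancel_left]
      rw [this, norm_smul, Real.norm_of_nonneg hb]
      exact mul_le_of_le_one_left (norm_nonneg _) (by linarith))
    (left_mem_segment _ _ _) (right_mem_segment _ _ _)
  rw [add_sub_cancel_left] at this
  refine this.trans (le_of_eq ?_)
  ring

/-- The Taylor remainder of `z ↦ g (· - z)` is quadratic in `h`, uniformly in space and for every
derivative up to the local order of `f`; hence so is the remainder after applying `f`. The minus
sign comes from `z` entering as `y - z`. -/
theorem hasFDerivAt_apply_testTranslate (f : Distrib d) (g : Test d) (x : Rd d) :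
    HasFDerivAt (fun z => f (testTranslate g z))
      (∑ i, ContinuousLinearMap.smulRightL ℝ (Rd d) ℂ (EuclideanSpace.proj i)
        (-f (testTranslate (testPd [i] g) x))) x := by
  obtain ⟨r, hr0, hr⟩ := exists_tsupport_subset_closedBall g
  -- This ball contains the supports of all translates `g (· - (x + h))` with `‖h‖ ≤ 1`, so one
  -- order `N` serves for all of them.
  obtain ⟨N, C, hC, hb⟩ := exists_norm_apply_le f (isCompact_closedBall (0 : Rd d) (r + (‖x‖ + 1)))
  have hlist : ∃ D : ℝ, 0 ≤ D ∧ ∀ l ∈ listsLE d N, ∀ y h,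
      ‖iterPd l g (y + h) - iterPd l g y - fderiv ℝ (iterPd l g) y h‖ ≤ D * ‖h‖ ^ 2 := by
    choose D hD0 hD using fun l : List (Fin d) => exists_norm_sub_sub_fderiv_le
      (contDiff_iterPd (test_contDiff g) l) (hasCompactSupport_iterPd g.hasCompactSupport l)
    refine ⟨∑ l ∈ listsLE d N, D l, Finset.sum_nonneg fun l _ => hD0 l, fun l hl y h => ?_⟩
    refine (hD l y h).trans ?_
    gcongr
    exact Finset.single_le_sum (fun l _ => hD0 l) hl
  obtain ⟨D, hD0, hD⟩ := hlist
  have hsum : ∀ h : Rd d, (∑ i, ContinuousLinearMap.smulRightL ℝ (Rd d) ℂ (EuclideanSpace.proj i)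
        (-f (testTranslate (testPd [i] g) x))) h =
      -f (∑ i, (h i : ℂ) • testTranslate (testPd [i] g) x) := by
    intro h
    rw [map_sum, ← Finset.sum_neg_distrib, sum_apply]
    refine Finset.sum_congr rfl fun i _ => ?_
    rw [smulRightL_proj_apply, map_smul, Complex.real_smul, smul_eq_mul, mul_neg]
  have hkey : ∀ h : Rd d, ‖h‖ ≤ 1 → ‖f (testTranslate g (x + h)) - f (testTranslate g x) -
      (∑ i, ContinuousLinearMap.smulRightL ℝ (Rd d) ℂ (EuclideanSpace.proj i)
        (-f (testTranslate (testPd [i] g) x))) h‖ ≤ C * (D * ‖h‖ ^ 2) := by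
    intro h hh
    set Θ : Test d := ∑ i, (h i : ℂ) • testTranslate (testPd [i] g) x with hΘ
    have hΘc : ⇑Θ = ∑ i, (h i : ℂ) • ⇑(testTranslate (testPd [i] g) x) := by
      rw [hΘ]
      induction (Finset.univ : Finset (Fin d)) using Finset.induction_on with
      | empty => rfl
      | insert a s ha ih => rw [Finset.sum_insert ha, Finset.sum_insert ha, Test.coe_add, ih]; rfl
    rw [hsum, sub_neg_eq_add, ← map_sub, ← map_add]
    have hsupp : ∀ z : Rd d, ‖z‖ ≤ ‖x‖ + 1 → tsupport (testTranslate g z) ⊆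
        Metric.closedBall 0 (r + (‖x‖ + 1)) := fun z hz => tsupport_testTranslate_subset g hr hz
    refine hb _ ?_ _ (by positivity) ?_
    · have hx1 := hsupp x (by linarith)
      have hx2 := hsupp (x + h) ((norm_add_le _ _).trans (by linarith))
      refine closure_minimal ?_ Metric.isClosed_closedBall
      intro y hy
      by_contra hcon
      apply hy
      have hz1 : y ∉ tsupport (testTranslate g x) := fun h' => hcon (hx1 h')
      have hz2 : y ∉ tsupport (testTranslate g (x + h)) := fun h' => hcon (hx2 h')
      have hz3 : Θ y = 0 := by
        rw [hΘc, Finset.sum_apply]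
        refine Finset.sum_eq_zero fun i _ => ?_
        have : iterPd [i] (testTranslate g x) y = 0 :=
          image_eq_zero_of_notMem_tsupport fun h' => hz1 (tsupport_iterPd_subset _ _ h')
        rw [iterPd_testTranslate] at this
        rw [Pi.smul_apply, coe_testTranslate, coe_testPd, this, smul_zero]
      rw [Test.coe_add, Test.coe_sub, Pi.add_apply, Pi.sub_apply, hz3,
        image_eq_zero_of_notMem_tsupport hz1, image_eq_zero_of_notMem_tsupport hz2]
      simp
    · intro l hl y
      have e : (⇑(testTranslate g (x + h) - testTranslate g x + Θ) : Rd d → ℂ) =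
          ⇑(testTranslate g (x + h)) + ((-1 : ℂ) • ⇑(testTranslate g x) + ⇑Θ) := by
        rw [Test.coe_add, Test.coe_sub]; funext y; simp [sub_eq_add_neg, add_assoc]
      have c1 : ContDiff ℝ ∞ ((-1 : ℂ) • ⇑(testTranslate g x)) :=
        contDiff_const.smul (test_contDiff _)
      have c2 : ∀ i, ContDiff ℝ ∞ ((h i : ℂ) • ⇑(testTranslate (testPd [i] g) x)) := fun i =>
        contDiff_const.smul (test_contDiff _)
      have c3 : ContDiff ℝ ∞ ((-1 : ℂ) • ⇑(testTranslate g x) + ⇑Θ) := c1.add (test_contDiff Θ)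
      rw [e, iterPd_add (test_contDiff _) c3, iterPd_add c1 (test_contDiff Θ),
        iterPd_const_smul (test_contDiff _), hΘc, iterPd_sum _ c2]
      simp only [Pi.add_apply, Pi.smul_apply, Finset.sum_apply, iterPd_testTranslate]
      -- Translating by `x + h` shifts the argument `y - x` by `-h`.
      have h3 := hD l (mem_listsLE.2 hl) (y - x) (-h)
      rw [norm_neg, map_neg, fderiv_apply_eq_sum] at h3
      have e2 : ∀ i, iterPd l ((h i : ℂ) • ⇑(testTranslate (testPd [i] g) x)) y =
          (h i : ℂ) * pderiv i (iterPd l g) (y - x) := by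
        intro i
        rw [iterPd_const_smul (test_contDiff _), Pi.smul_apply, iterPd_testTranslate, coe_testPd,
          ← iterPd_append, smul_eq_mul]
        congr 1
        have := iterPd_perm (test_contDiff g) (List.perm_append_comm (l₁ := l) (l₂ := [i]))
        exact congrFun this _
      rw [Finset.sum_congr rfl fun i _ => e2 i]
      convert h3 using 2
      rw [sub_neg_eq_add, show y - (x + h) = y - x + -h by abel]
      simp only [smul_eq_mul]
      ring
  rw [hasFDerivAt_iff_isLittleO_nhds_zero]
  have hO : (fun h : Rd d => f (testTranslate g (x + h)) - f (testTranslate g x) -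
      (∑ i, ContinuousLinearMap.smulRightL ℝ (Rd d) ℂ (EuclideanSpace.proj i)
        (-f (testTranslate (testPd [i] g) x))) h) =O[nhds 0] fun h => ‖h‖ ^ 2 := by
    refine Asymptotics.IsBigO.of_bound (C * D) ?_
    filter_upwards [Metric.closedBall_mem_nhds (0 : Rd d) one_pos] with h hh
    rw [mem_closedBall_zero_iff] at hh
    refine (hkey h hh).trans (le_of_eq ?_)
    rw [Real.norm_of_nonneg (by positivity)]; ring
  refine hO.trans_isLittleO ?_
  have := Asymptotics.isLittleO_norm_pow_id (E' := Rd d) (n := 2) (by norm_num)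
  exact this

theorem pderiv_apply_testTranslate (f : Distrib d) (g : Test d) (i : Fin d) :
    pderiv i (fun z => f (testTranslate g z)) = fun x => -f (testTranslate (testPd [i] g) x) := by
  funext x
  unfold pderiv
  rw [(hasFDerivAt_apply_testTranslate f g x).fderiv, sum_apply]
  rw [Finset.sum_eq_single i]
  · rw [smulRightL_proj_apply]; simp
  · intro j _ hj
    rw [smulRightL_proj_apply]
    simp [hj]
  · simp

theorem contDiff_of_pderiv {n : ℕ} {g : Rd d → ℂ} (hd : Differentiable ℝ g)
    (hp : ∀ i, ContDiff ℝ n (pderiv i g)) : ContDiff ℝ (n + 1) g := by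
  rw [contDiff_succ_iff_fderiv]
  refine ⟨hd, by simp, ?_⟩
  have : fderiv ℝ g = fun x => ∑ i, ContinuousLinearMap.smulRightL ℝ (Rd d) ℂ
      (EuclideanSpace.proj i) (pderiv i g x) := by
    funext x; exact fderiv_eq_sum g x
  rw [this]
  exact ContDiff.sum fun i _ => (ContinuousLinearMap.contDiff _).comp (hp i)

theorem contDiff_apply_testTranslate (f : Distrib d) (g : Test d) :
    ContDiff ℝ ∞ (fun z => f (testTranslate g z)) := by
  rw [contDiff_infty]
  intro n
  have hd : ∀ g : Test d, Differentiable ℝ (fun z => f (testTranslate g z)) := fun g x =>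
    (hasFDerivAt_apply_testTranslate f g x).differentiableAt
  induction n generalizing g with
  | zero => exact contDiff_zero.2 (hd g).continuous
  | succ n ih =>
    refine contDiff_of_pderiv (hd g) fun i => ?_
    rw [pderiv_apply_testTranslate]
    exact (ih _).neg

theorem conv_eq (f : Distrib d) (φ : Test d) :
    conv f φ = fun z => f (testTranslate (testRefl φ) z) := by
  funext z; rw [conv, reflTranslate_eq]

theorem contDiff_conv (f : Distrib d) (φ : Test d) : ContDiff ℝ ∞ (conv f φ) := by
  rw [conv_eq]; exact contDiff_apply_testTranslate f _

theorem pderiv_conv (f : Distrib d) (φ : Test d) (i : Fin d) :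
    pderiv i (conv f φ) = conv f (testPd [i] φ) := by
  rw [conv_eq, conv_eq, pderiv_apply_testTranslate]
  funext x
  rw [← map_neg]
  congr 1
  ext y
  have h : (⇑(testRefl φ) : Rd d → ℂ) = fun y => φ (-y) := by
    funext y; simp [testRefl]
  have h' : (⇑(testRefl (testPd [i] φ)) : Rd d → ℂ) = fun y => pderiv i φ (-y) := by
    funext y; simp [testRefl, iterPd_cons]
  change -(iterPd [i] (testRefl φ) (y - x)) = testRefl (testPd [i] φ) (y - x)
  rw [h', h, iterPd_cons, iterPd_nil, pderiv_comp_neg]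
  simp

theorem iterPd_conv (f : Distrib d) (φ : Test d) (l : List (Fin d)) :
    iterPd l (conv f φ) = conv f (testPd l φ) := by
  induction l with
  | nil => rfl
  | cons i l ih => rw [iterPd_cons, ih, pderiv_conv]; rfl

theorem conv_add (f : Distrib d) (φ ψ : Test d) : conv f (φ + ψ) = conv f φ + conv f ψ := by
  funext x
  simp only [conv, Pi.add_apply, ← map_add]
  rfl

theorem conv_sub (f : Distrib d) (φ ψ : Test d) : conv f (φ - ψ) = conv f φ - conv f ψ := by
  funext x
  simp only [conv, Pi.sub_apply, ← map_sub]
  rfl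

theorem conv_smul (f : Distrib d) (c : ℂ) (φ : Test d) : conv f (c • φ) = c • conv f φ := by
  funext x
  simp only [conv, Pi.smul_apply, ← map_smul]
  rfl

theorem conv_sum (f : Distrib d) {κ : Type*} (s : Finset κ) (φ : κ → Test d) :
    conv f (∑ k ∈ s, φ k) = ∑ k ∈ s, conv f (φ k) := by
  classical
  induction s using Finset.induction_on with
  | empty =>
    funext x
    simp only [Finset.sum_empty, conv, Pi.zero_apply]
    exact map_zero f
  | insert a s ha ih => rw [Finset.sum_insert ha, Finset.sum_insert ha, conv_add, ih]

end DistributionConvolution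

/-! ### Distributions and superpositions of translates -/

section Interchange

open scoped BoundedContinuousFunction

/-- A test function as a bounded continuous function. -/
noncomputable def testBcf (g : Test d) : Rd d →ᵇ ℂ :=
  BoundedContinuousFunction.ofNormedAddCommGroup g g.continuous
    (Classical.choose (g.continuous.bounded_above_of_compact_support g.hasCompactSupport))
    (Classical.choose_spec (g.continuous.bounded_above_of_compact_support g.hasCompactSupport))

/-- The derivatives of order at most `N` of a test function. -/
noncomputable def derivBcf (N : ℕ) : Test d →ₗ[ℂ] ({l // l ∈ listsLE d N} → (Rd d →ᵇ ℂ)) where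
  toFun := fun θ l => testBcf (testPd l.1 θ)
  map_add' := fun θ η => by
    funext l
    ext x
    change iterPd l.1 (⇑(θ + η)) x = iterPd l.1 θ x + iterPd l.1 η x
    rw [Test.coe_add, iterPd_add (test_contDiff _) (test_contDiff _)]
    rfl
  map_smul' := fun c θ => by
    funext l
    ext x
    change iterPd l.1 (⇑(c • θ)) x = c • iterPd l.1 θ x
    rw [Test.coe_smul, iterPd_const_smul (test_contDiff _)]
    rfl

theorem derivBcf_apply (N : ℕ) (θ : Test d) (l : {l // l ∈ listsLE d N}) (x : Rd d) :
    derivBcf N θ l x = iterPd l.1 θ x := rfl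

theorem norm_iterPd_le_norm_derivBcf (N : ℕ) (θ : Test d) {l : List (Fin d)} (hl : l.length ≤ N)
    (x : Rd d) : ‖iterPd l θ x‖ ≤ ‖derivBcf N θ‖ :=
  ((derivBcf N θ ⟨l, mem_listsLE.2 hl⟩).norm_coe_le_norm x).trans
    (norm_le_pi_norm (derivBcf N θ) ⟨l, mem_listsLE.2 hl⟩)

/-- On test functions supported in a fixed compact set a distribution is given by a continuous
functional of finitely many derivatives. -/
theorem exists_extension_derivBcf (f : Distrib d) {K : Set (Rd d)} (hK : IsCompact K) :
    ∃ (N : ℕ) (Λ : ({l // l ∈ listsLE d N} → (Rd d →ᵇ ℂ)) →L[ℂ] ℂ),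
      ∀ θ : Test d, tsupport θ ⊆ K → f θ = Λ (derivBcf N θ) := by
  obtain ⟨N, C, hC, hb⟩ := exists_norm_apply_le f hK
  -- On `p`, the functions supported in `K`, the tuple of derivatives determines the function
  -- through the empty list. So `f` factors through the range of `J`, is bounded there by the
  -- finite-order estimate, and extends by Hahn–Banach.
  let p : Submodule ℂ (Test d) :=
    { carrier := {θ | ∀ x ∉ K, θ x = 0}
      add_mem' := fun {a b} ha hb x hx => by
        rw [Test.coe_add, Pi.add_apply, ha x hx, hb x hx, add_zero]
      zero_mem' := fun x _ => rfl
      smul_mem' := fun c a ha x hx => by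
        rw [Test.coe_smul, Pi.smul_apply, ha x hx, smul_zero] }
  have hp : ∀ θ ∈ p, tsupport θ ⊆ K := fun θ hθ =>
    closure_minimal (fun x hx => by
      by_contra hcon
      exact hx (hθ x hcon)) hK.isClosed
  let J := (derivBcf N).domRestrict p
  have hJ : Function.Injective J := by
    intro a b hab
    ext x
    have := congrArg (fun F => F ⟨[], mem_listsLE.2 (Nat.zero_le N)⟩ x) hab
    exact this
  let e := LinearEquiv.ofInjective J hJ
  let F : J.range →ₗ[ℂ] ℂ := ((f : Test d →ₗ[ℂ] ℂ) ∘ₗ p.subtype) ∘ₗ (e.symm : J.range →ₗ[ℂ] p)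
  have hF : ∀ θ : p, F (e θ) = f θ := fun θ => by
    change f (e.symm (e θ) : p) = f θ
    rw [e.symm_apply_apply]
  have hFb : ∀ v, ‖F v‖ ≤ C * ‖v‖ := by
    intro v
    obtain ⟨θ, rfl⟩ := e.surjective v
    rw [hF]
    exact hb θ (hp θ θ.2) _ (norm_nonneg _) fun l hl x => norm_iterPd_le_norm_derivBcf N θ hl x
  obtain ⟨Λ, hΛ, -⟩ := exists_extension_norm_eq J.range (F.mkContinuous C hFb)
  refine ⟨N, Λ, fun θ hθ => ?_⟩
  have hθp : θ ∈ p := fun x hx => image_eq_zero_of_notMem_tsupport fun h => hx (hθ h)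
  rw [← hF ⟨θ, hθp⟩]
  exact (hΛ (e ⟨θ, hθp⟩)).symm

theorem contDiff_convolution_test {ρ : Rd d → ℂ} (hρ : LocallyIntegrable ρ volume) (g : Test d) :
    ContDiff ℝ ∞ (convolution ρ g (ContinuousLinearMap.mul ℂ ℂ) volume) := by
  have := HasCompactSupport.contDiff_convolution_right (𝕜 := ℝ) (n := ⊤)
    ((ContinuousLinearMap.mul ℝ ℂ)) g.hasCompactSupport hρ (test_contDiff g)
  exact this

theorem convolution_apply (ρ g : Rd d → ℂ) (x : Rd d) :
    convolution ρ g (ContinuousLinearMap.mul ℂ ℂ) volume x = ∫ z, ρ z * g (x - z) := rfl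

theorem convolution_comm' (ρ g : Rd d → ℂ) :
    convolution ρ g (ContinuousLinearMap.mul ℂ ℂ) volume =
      convolution g ρ (ContinuousLinearMap.mul ℂ ℂ) volume := by
  conv_rhs => rw [← convolution_flip]
  congr 1
  ext
  simp

theorem pderiv_convolution {ρ g : Rd d → ℂ} (hρ : LocallyIntegrable ρ volume)
    (hg : ContDiff ℝ ∞ g) (hgc : HasCompactSupport g) (i : Fin d) :
    pderiv i (convolution ρ g (ContinuousLinearMap.mul ℂ ℂ) volume) =
      convolution ρ (pderiv i g) (ContinuousLinearMap.mul ℂ ℂ) volume := by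
  funext x
  have h1 : HasFDerivAt (convolution ρ g (ContinuousLinearMap.mul ℝ ℂ) volume) _ x :=
    hgc.hasFDerivAt_convolution_right (𝕜 := ℝ) (ContinuousLinearMap.mul ℝ ℂ) hρ
    (hg.of_le (by exact_mod_cast le_top)) x
  change fderiv ℝ (convolution ρ g (ContinuousLinearMap.mul ℝ ℂ) volume) x _ = _
  rw [h1.fderiv, convolution_precompR_apply _ hρ (hgc.fderiv (𝕜 := ℝ))
    (hg.continuous_fderiv (by simp))]
  rfl

theorem iterPd_convolution {ρ g : Rd d → ℂ} (hρ : LocallyIntegrable ρ volume)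
    (hg : ContDiff ℝ ∞ g) (hgc : HasCompactSupport g) (l : List (Fin d)) :
    iterPd l (convolution ρ g (ContinuousLinearMap.mul ℂ ℂ) volume) =
      convolution ρ (iterPd l g) (ContinuousLinearMap.mul ℂ ℂ) volume := by
  induction l with
  | nil => rfl
  | cons i l ih =>
    rw [iterPd_cons, ih, pderiv_convolution hρ (contDiff_iterPd hg l)
      (hasCompactSupport_iterPd hgc l)]
    rfl

/-- The convolution of a continuous compactly supported function and a test function. -/
noncomputable def testConv (ρ : Rd d → ℂ) (hρ : Continuous ρ) (hρc : HasCompactSupport ρ)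
    (g : Test d) : Test d :=
  mkTest (convolution ρ g (ContinuousLinearMap.mul ℂ ℂ) volume)
    (contDiff_convolution_test hρ.locallyIntegrable g)
    (HasCompactSupport.convolution _ hρc g.hasCompactSupport)

@[simp] theorem coe_testConv {ρ : Rd d → ℂ} (hρ : Continuous ρ) (hρc : HasCompactSupport ρ)
    (g : Test d) : ⇑(testConv ρ hρ hρc g) =
      convolution ρ g (ContinuousLinearMap.mul ℂ ℂ) volume := rfl

/-- Continuity in the sup norm is what makes superpositions of translates Bochner integrals in a
Banach space. It holds because each derivative of `g` is Lipschitz. -/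
theorem continuous_derivBcf_testTranslate (N : ℕ) (g : Test d) :
    Continuous (fun z => derivBcf N (testTranslate g z)) := by
  refine continuous_pi fun l => ?_
  obtain ⟨C, hC⟩ := exists_lipschitz_iterPd g l.1
  have : LipschitzWith C (fun z => derivBcf N (testTranslate g z) l) := by
    refine LipschitzWith.of_dist_le_mul fun z z' => ?_
    rw [BoundedContinuousFunction.dist_le (by positivity)]
    intro x
    rw [derivBcf_apply, derivBcf_apply, iterPd_testTranslate, iterPd_testTranslate]
    refine (hC.dist_le_mul _ _).trans (le_of_eq ?_)
    rw [dist_sub_left]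
  exact this.continuous

/-- A distribution commutes with superpositions of translates of a test function. -/
theorem apply_testConv (f : Distrib d) {ρ : Rd d → ℂ} (hρ : Continuous ρ)
    (hρc : HasCompactSupport ρ) (g : Test d) :
    f (testConv ρ hρ hρc g) = ∫ z, ρ z * f (testTranslate g z) := by
  obtain ⟨r, hr0, hr⟩ := exists_tsupport_subset_closedBall g
  obtain ⟨R, hR⟩ := hρc.isCompact.isBounded.subset_closedBall 0
  have hsub : ∀ z, ρ z ≠ 0 → tsupport (testTranslate g z) ⊆ Metric.closedBall 0 (r + R) := by
    intro z hz
    exact tsupport_testTranslate_subset g hr (by simpa using hR (subset_tsupport _ hz))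
  -- Replacing `f` by a functional `Λ` on a Banach space lets it pass under the integral sign.
  obtain ⟨N, Λ, hΛ⟩ := exists_extension_derivBcf f (isCompact_closedBall (0 : Rd d) (r + R))
  have hcont : Continuous (fun z => ρ z • derivBcf N (testTranslate g z)) :=
    hρ.smul (continuous_derivBcf_testTranslate N g)
  have hint : Integrable (fun z => ρ z • derivBcf N (testTranslate g z)) :=
    hcont.integrable_of_hasCompactSupport hρc.smul_right
  have h1 : ∀ z, ρ z * f (testTranslate g z) = Λ (ρ z • derivBcf N (testTranslate g z)) := by
    intro z
    rw [map_smul, smul_eq_mul]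
    by_cases hz : ρ z = 0
    · rw [hz, zero_mul, zero_mul]
    · rw [hΛ _ (hsub z hz)]
  simp only [h1]
  rw [Λ.integral_comp_comm hint, hΛ]
  · congr 1
    funext l
    ext x
    -- Point evaluations commute with the Bochner integral and identify its components with the
    -- derivatives of the convolution.
    let ev : ({l // l ∈ listsLE d N} → (Rd d →ᵇ ℂ)) →L[ℂ] ℂ :=
      (BoundedContinuousFunction.evalCLM ℂ x) ∘L (ContinuousLinearMap.proj l)
    change _ = ev _
    rw [← ev.integral_comp_comm hint, derivBcf_apply, coe_testConv,
      iterPd_convolution hρ.locallyIntegrable (test_contDiff g) g.hasCompactSupport,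
      convolution_apply]
    refine integral_congr_ae (Filter.Eventually.of_forall fun z => ?_)
    change _ = ρ z • iterPd l.1 (testTranslate g z) x
    rw [iterPd_testTranslate, smul_eq_mul]
  · refine closure_minimal ?_ Metric.isClosed_closedBall
    intro y hy
    by_contra hcon
    apply hy
    rw [coe_testConv, convolution_apply]
    refine integral_eq_zero_of_ae (Filter.Eventually.of_forall fun z => ?_)
    by_cases hz : ρ z = 0
    · simp [hz]
    · have : testTranslate g z y = 0 :=
        image_eq_zero_of_notMem_tsupport fun h => hcon (hsub z hz h)
      rw [coe_testTranslate] at this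
      simp [this]

theorem testRefl_apply (φ : Test d) (y : Rd d) : testRefl φ y = φ (-y) := by simp [testRefl]

/-- `⟨f, ρ ⋆ φˇ⟩ = ∫ (f ⋆ φ) ρ`. -/
theorem integral_conv_mul (f : Distrib d) {ρ : Rd d → ℂ} (hρ : Continuous ρ)
    (hρc : HasCompactSupport ρ) (φ : Test d) :
    ∫ z, conv f φ z * ρ z = f (testConv ρ hρ hρc (testRefl φ)) := by
  rw [apply_testConv, conv_eq]
  simp only [mul_comm]

/-- Associativity of the convolution. -/
theorem conv_testConv (f : Distrib d) (χ ψ : Test d) (x : Rd d) :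
    conv f (testConv χ χ.continuous χ.hasCompactSupport ψ) x = ∫ z, conv f χ (x - z) * ψ z := by
  have h1 : Continuous fun z => ψ (x - z) := ψ.continuous.comp (continuous_const.sub continuous_id)
  have h2 : HasCompactSupport fun z => ψ (x - z) :=
    ψ.hasCompactSupport.comp_homeomorph (Homeomorph.subLeft x)
  -- The reflected translate of `χ * ψ` is a superposition of translates of the reflected `χ` with
  -- density `ψ (x - ·)`, which allows the interchange above.
  have h3 : reflTranslate (testConv χ χ.continuous χ.hasCompactSupport ψ) x =
      testConv (fun z => ψ (x - z)) h1 h2 (testRefl χ) := by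
    ext y
    simp only [coe_reflTranslate, coe_testConv, convolution_apply, testRefl_apply]
    rw [← integral_sub_left_eq_self _ volume (x - y)]
    simp only [sub_sub_cancel]
    rw [← integral_sub_left_eq_self (fun z => ψ (x - z) * χ (-(y - z))) volume x]
    refine integral_congr_ae (Filter.Eventually.of_forall fun z => ?_)
    simp only [sub_sub_cancel]
    rw [mul_comm]
    congr 2
    abel
  rw [conv, h3, ← integral_conv_mul, ← integral_sub_left_eq_self _ volume x]
  simp only [sub_sub_cancel]

end Interchange

/-! ### The extended norms of `E` and `E_sl` -/

section FunctionSpaceNorms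

variable {E : Type*} [NormedAddCommGroup E] [NormedSpace ℂ E]
  {ι : E →ₗ[ℂ] (Rd d →ₘ[volume] ℂ)}

theorem memE_of_eNormE_lt_top {g : Rd d → ℂ} (h : eNormE ι g < ⊤) : MemE ι g := by
  unfold eNormE at h
  obtain ⟨e, he⟩ := iInf_lt_iff.1 h
  obtain ⟨he', -⟩ := iInf_lt_iff.1 he
  exact ⟨e, he'⟩

theorem coeFn_map_sub (e e' : E) : ι (e - e') =ᵐ[volume] fun x => ι e x - ι e' x := by
  rw [map_sub]; exact AEEqFun.coeFn_sub _ _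

theorem coeFn_map_add (e e' : E) : ι (e + e') =ᵐ[volume] fun x => ι e x + ι e' x := by
  rw [map_add]; exact AEEqFun.coeFn_add _ _

theorem coeFn_map_smul (c : ℂ) (e : E) : ι (c • e) =ᵐ[volume] fun x => c * ι e x := by
  rw [map_smul]; exact AEEqFun.coeFn_smul _ _

theorem coeFn_map_sum (e : ℕ → E) (n : ℕ) :
    ι (∑ j ∈ Finset.range n, e j) =ᵐ[volume] fun x => ∑ j ∈ Finset.range n, ι (e j) x := by
  induction n with
  | zero =>
    simp only [Finset.range_zero, Finset.sum_empty, map_zero]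
    exact AEEqFun.coeFn_zero
  | succ n ih =>
    rw [Finset.sum_range_succ]
    filter_upwards [coeFn_map_add (ι := ι) (∑ j ∈ Finset.range n, e j) (e n), ih] with x h1 h2
    rw [h1, h2, Finset.sum_range_succ]

theorem eNormE_lt_top_of_memE {g : Rd d → ℂ} (h : MemE ι g) : eNormE ι g < ⊤ := by
  obtain ⟨e, he⟩ := h
  exact (iInf₂_le e he).trans_lt enorm_lt_top

theorem MemE.add {g h : Rd d → ℂ} (hg : MemE ι g) (hh : MemE ι h) :
    MemE ι (fun x => g x + h x) := by
  obtain ⟨e, he⟩ := hg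
  obtain ⟨e', he'⟩ := hh
  refine ⟨e + e', ?_⟩
  filter_upwards [coeFn_map_add (ι := ι) e e', he, he'] with x h1 h2 h3
  rw [h1, h2, h3]

theorem MemE.const_mul {g : Rd d → ℂ} (hg : MemE ι g) (c : ℂ) : MemE ι (fun x => c * g x) := by
  obtain ⟨e, he⟩ := hg
  refine ⟨c • e, ?_⟩
  filter_upwards [coeFn_map_smul (ι := ι) c e, he] with x h1 h2
  rw [h1, h2]

theorem eNormSl_le_iff {g : Rd d → ℂ} {A : ℝ≥0∞} : eNormSl ι g ≤ A ↔
    ∀ R : ℝ, 0 < R → eNormE ι ((Metric.closedBall (0 : Rd d) R).indicator g) ≤ A :=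
  iSup₂_le_iff

theorem eNormE_indicator_le_eNormSl (g : Rd d → ℂ) {R : ℝ} (hR : 0 < R) :
    eNormE ι ((Metric.closedBall (0 : Rd d) R).indicator g) ≤ eNormSl ι g :=
  le_iSup₂ (f := fun (R : ℝ) (_ : 0 < R) =>
    eNormE ι ((Metric.closedBall (0 : Rd d) R).indicator g)) R hR

/-- On the ball of radius `R` the convolution sees `v` only on the ball of radius `R + ρ`. This
gives the continuity in `L^1_loc` behind the closed graph argument. -/
theorem enorm_convolution_le {v θ : Rd d → ℂ} {M ρ R : ℝ} (hM : ∀ x, ‖θ x‖ ≤ M)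
    (hθ : ∀ x, ρ < ‖x‖ → θ x = 0) {x : Rd d} (hx : ‖x‖ ≤ R) :
    ‖convolution v θ (ContinuousLinearMap.mul ℂ ℂ) volume x‖ₑ ≤
      ENNReal.ofReal M * ∫⁻ t in Metric.closedBall (0 : Rd d) (R + ρ), ‖v t‖ₑ := by
  rw [convolution_apply]
  refine (enorm_integral_le_lintegral_enorm _).trans ?_
  have : ∀ t, ‖v t * θ (x - t)‖ₑ ≤ ENNReal.ofReal M *
      (Metric.closedBall (0 : Rd d) (R + ρ)).indicator (fun t => ‖v t‖ₑ) t := by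
    intro t
    by_cases ht : t ∈ Metric.closedBall (0 : Rd d) (R + ρ)
    · rw [Set.indicator_of_mem ht, enorm_mul, mul_comm]
      gcongr
      rw [← ofReal_norm]
      exact ENNReal.ofReal_le_ofReal (hM _)
    · have h2 : ρ < ‖x - t‖ := by
        have h3 : R + ρ < ‖t‖ := by simpa using ht
        have h4 : ‖t‖ ≤ ‖x‖ + ‖x - t‖ := by
          have := norm_sub_le x (x - t)
          rwa [sub_sub_cancel] at this
        linarith
      rw [hθ _ h2, mul_zero, enorm_zero]
      exact zero_le
  refine (lintegral_mono this).trans ?_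
  rw [lintegral_const_mul' _ _ ENNReal.ofReal_ne_top,
    lintegral_indicator Metric.isClosed_closedBall.measurableSet]

variable [CompleteSpace E]

theorem eNormE_eq (hE : IsSolidTIBF ι) {e : E} {g : Rd d → ℂ} (h : ι e =ᵐ[volume] g) :
    eNormE ι g = ‖e‖ₑ := by
  refine le_antisymm (iInf₂_le e h) (le_iInf₂ fun e' h' => ?_)
  rw [hE.injective (AEEqFun.ext (h'.trans h.symm) : ι e' = ι e)]

theorem exists_eNormE_eq (hE : IsSolidTIBF ι) {g : Rd d → ℂ} (h : eNormE ι g < ⊤) :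
    ∃ e : E, ι e =ᵐ[volume] g ∧ eNormE ι g = ‖e‖ₑ := by
  obtain ⟨e, he⟩ := memE_of_eNormE_lt_top h
  exact ⟨e, he, eNormE_eq hE he⟩

/-- Solidity for extended norms. Measurability of `g` suffices, because local integrability is
inherited from the dominating element of `E`. -/
theorem eNormE_mono (hE : IsSolidTIBF ι) {g h : Rd d → ℂ} (hg : AEStronglyMeasurable g volume)
    (hgh : ∀ᵐ x, ‖g x‖ₑ ≤ ‖h x‖ₑ) : eNormE ι g ≤ eNormE ι h := by
  rcases eq_or_ne (eNormE ι h) ⊤ with htop | htop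
  · rw [htop]; exact le_top
  obtain ⟨e, he, hn⟩ := exists_eNormE_eq hE (lt_top_iff_ne_top.2 htop)
  have hle : ∀ᵐ x, ‖g x‖ ≤ ‖ι e x‖ := by
    filter_upwards [hgh, he] with x h1 h2
    rw [h2]
    exact enorm_le_iff_norm_le.1 h1
  obtain ⟨e', he', hn'⟩ := hE.solid e g ((hE.locallyIntegrable e).mono hg hle) hle
  rw [hn, eNormE_eq hE he']
  exact enorm_le_iff_norm_le.2 hn'

theorem memE_mono (hE : IsSolidTIBF ι) {g h : Rd d → ℂ} (hg : AEStronglyMeasurable g volume)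
    (hgh : ∀ᵐ x, ‖g x‖ₑ ≤ ‖h x‖ₑ) (hh : MemE ι h) : MemE ι g :=
  memE_of_eNormE_lt_top ((eNormE_mono hE hg hgh).trans_lt (eNormE_lt_top_of_memE hh))

theorem eNormE_zero (hE : IsSolidTIBF ι) : eNormE ι (0 : Rd d → ℂ) = 0 := by
  have : ι 0 =ᵐ[volume] (0 : Rd d → ℂ) := by rw [map_zero]; exact AEEqFun.coeFn_zero
  rw [eNormE_eq hE this, enorm_zero]

theorem eNormE_add_le (hE : IsSolidTIBF ι) (g h : Rd d → ℂ) :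
    eNormE ι (fun x => g x + h x) ≤ eNormE ι g + eNormE ι h := by
  rcases eq_or_ne (eNormE ι g) ⊤ with htop | htop
  · rw [htop, top_add]; exact le_top
  rcases eq_or_ne (eNormE ι h) ⊤ with htop' | htop'
  · rw [htop', add_top]; exact le_top
  obtain ⟨e, he, hn⟩ := exists_eNormE_eq hE (lt_top_iff_ne_top.2 htop)
  obtain ⟨e', he', hn'⟩ := exists_eNormE_eq hE (lt_top_iff_ne_top.2 htop')
  have : ι (e + e') =ᵐ[volume] fun x => g x + h x := by
    filter_upwards [coeFn_map_add (ι := ι) e e', he, he'] with x h1 h2 h3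
    rw [h1, h2, h3]
  rw [hn, hn', eNormE_eq hE this]
  exact enorm_add_le _ _

theorem eNormE_const_mul_le (hE : IsSolidTIBF ι) (c : ℂ) (g : Rd d → ℂ) :
    eNormE ι (fun x => c * g x) ≤ ‖c‖ₑ * eNormE ι g := by
  rcases eq_or_ne c 0 with rfl | hc
  · simp only [zero_mul]
    rw [show (fun _ : Rd d => (0 : ℂ)) = 0 from rfl, eNormE_zero hE]
    exact zero_le
  rcases eq_or_ne (eNormE ι g) ⊤ with htop | htop
  · rw [htop, ENNReal.mul_top (by simpa using hc)]; exact le_top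
  obtain ⟨e, he, hn⟩ := exists_eNormE_eq hE (lt_top_iff_ne_top.2 htop)
  have : ι (c • e) =ᵐ[volume] fun x => c * g x := by
    filter_upwards [coeFn_map_smul (ι := ι) c e, he] with x h1 h2
    rw [h1, h2]
  rw [hn, eNormE_eq hE this, enorm_smul]

theorem eNormE_le_of_le_mul (hE : IsSolidTIBF ι) {g h : Rd d → ℂ} {C : ℝ≥0}
    (hg : AEStronglyMeasurable g volume) (hgh : ∀ᵐ x, ‖g x‖ₑ ≤ C * ‖h x‖ₑ) :
    eNormE ι g ≤ C * eNormE ι h := by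
  have h1 : ‖((C : ℝ) : ℂ)‖ₑ = C := by
    rw [← ofReal_norm, Complex.norm_real, NNReal.norm_eq, ENNReal.ofReal_coe_nnreal]
  rw [← h1]
  refine (eNormE_mono hE hg ?_).trans (eNormE_const_mul_le hE _ h)
  filter_upwards [hgh] with x hx
  rwa [enorm_mul, h1]

theorem eNormE_norm_le (hE : IsSolidTIBF ι) {g : Rd d → ℂ} (hg : AEStronglyMeasurable g volume) :
    eNormE ι (fun x => ((‖g x‖ : ℝ) : ℂ)) ≤ eNormE ι g := by
  refine eNormE_mono hE (Complex.continuous_ofReal.comp_aestronglyMeasurable hg.norm) ?_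
  refine Filter.Eventually.of_forall fun x => ?_
  rw [enorm_le_iff_norm_le, Complex.norm_real, norm_norm]

theorem exists_lintegral_le_eNormE (hE : IsSolidTIBF ι) {K : Set (Rd d)} (hK : IsCompact K) :
    ∃ C : ℝ≥0, ∀ g : Rd d → ℂ, ∫⁻ x in K, ‖g x‖ₑ ≤ (C + 1) * eNormE ι g := by
  obtain ⟨C, hC⟩ := hE.continuous_inclusion K hK
  refine ⟨C.toNNReal, fun g => ?_⟩
  rcases eq_or_ne (eNormE ι g) ⊤ with htop | htop
  · rw [htop, ENNReal.mul_top (by simp)]; exact le_top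
  obtain ⟨e, he, hn⟩ := exists_eNormE_eq hE (lt_top_iff_ne_top.2 htop)
  have h1 : ∫⁻ x in K, ‖g x‖ₑ = ∫⁻ x in K, ‖ι e x‖ₑ := by
    refine lintegral_congr_ae (ae_restrict_of_ae ?_)
    filter_upwards [he] with x hx
    rw [hx]
  have h2 : IntegrableOn (ι e) K := (hE.locallyIntegrable e).integrableOn_isCompact hK
  rw [h1, hn, ← ofReal_integral_norm_eq_lintegral_enorm h2]
  refine (ENNReal.ofReal_le_ofReal (hC e)).trans ?_
  rw [ENNReal.ofReal_mul' (norm_nonneg _), ofReal_norm]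
  gcongr
  exact le_self_add

/-- Countable subadditivity of the norm. -/
theorem eNormE_le_tsum (hE : IsSolidTIBF ι) {g : ℕ → Rd d → ℂ} {h : Rd d → ℂ}
    (hg : ∀ j, AEStronglyMeasurable (g j) volume) (hh : AEStronglyMeasurable h volume)
    (hle : ∀ᵐ x, ‖h x‖ₑ ≤ ∑' j, ‖g j x‖ₑ) : eNormE ι h ≤ ∑' j, eNormE ι (g j) := by
  rcases eq_or_ne (∑' j, eNormE ι (g j)) ⊤ with htop | htop
  · rw [htop]; exact le_top
  -- With absolute values, which are in `E` by solidity, the series converges absolutely in `E` to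
  -- some `e₀`. It remains to see that `|e₀|` dominates the pointwise partial sums almost
  -- everywhere.
  have hfin : ∀ j, eNormE ι (fun x => ((‖g j x‖ : ℝ) : ℂ)) < ⊤ := fun j =>
    (eNormE_norm_le hE (hg j)).trans_lt
      ((ENNReal.le_tsum j).trans_lt (lt_top_iff_ne_top.2 htop))
  choose e he hn using fun j => exists_eNormE_eq hE (hfin j)
  have hsum : ∑' j, ‖e j‖ₑ ≤ ∑' j, eNormE ι (g j) :=
    ENNReal.tsum_le_tsum fun j => (hn j).symm.le.trans (eNormE_norm_le hE (hg j))
  have hsumm : Summable e := by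
    refine Summable.of_nnnorm (f := e) ?_
    rw [← ENNReal.tsum_coe_ne_top_iff_summable]
    exact ne_top_of_le_ne_top htop hsum
  set e₀ := ∑' j, e j with he₀
  have hpart : ∀ J, ∀ᵐ x, ∑ j ∈ Finset.range J, ‖g j x‖ₑ ≤ ‖ι e₀ x‖ₑ := by
    intro J
    have hball : ∀ R : ℕ, ∀ᵐ x, x ∈ Metric.closedBall (0 : Rd d) R →
        ∑ j ∈ Finset.range J, ‖g j x‖ₑ - ‖ι e₀ x‖ₑ = 0 := by
      intro R
      rw [← ae_restrict_iff' Metric.isClosed_closedBall.measurableSet]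
      obtain ⟨C, hC⟩ := exists_lintegral_le_eNormE hE (isCompact_closedBall (0 : Rd d) R)
      have hmeas : AEMeasurable (fun x => ∑ j ∈ Finset.range J, ‖g j x‖ₑ - ‖ι e₀ x‖ₑ)
          (volume.restrict (Metric.closedBall (0 : Rd d) R)) :=
        ((Finset.aemeasurable_fun_sum _ fun j _ => (hg j).enorm).sub
          (ι e₀).aestronglyMeasurable.enorm).restrict
      refine (lintegral_eq_zero_iff' hmeas).1 ?_
      -- For `J' ≥ J` the excess of the `J`-th partial sum over `|e₀|` is at most the absolute value
      -- of the `J'`-th partial sum minus `e₀`. By the continuous inclusion its integral over the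
      -- ball tends to zero with `J'`.
      have hlim : Filter.Tendsto (fun J' => ((C : ℝ≥0∞) + 1) *
          ‖∑ j ∈ Finset.range J', e j - e₀‖ₑ) Filter.atTop (nhds 0) := by
        have h1 : Filter.Tendsto (fun J' => ‖∑ j ∈ Finset.range J', e j - e₀‖ₑ) Filter.atTop
            (nhds 0) := by
          have := (hsumm.hasSum.tendsto_sum_nat.sub_const e₀).enorm
          simpa [he₀] using this
        have := ENNReal.Tendsto.const_mul (a := (C : ℝ≥0∞) + 1) h1 (Or.inr (by simp))
        simpa using this
      refine le_antisymm (ge_of_tendsto hlim ?_) zero_le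
      filter_upwards [Filter.eventually_ge_atTop J] with J' hJ'
      have hn' := hC (ι (∑ j ∈ Finset.range J', e j - e₀))
      rw [eNormE_eq hE (Filter.EventuallyEq.refl _ _)] at hn'
      refine le_trans (lintegral_mono_ae (ae_restrict_of_ae ?_)) hn'
      have hall : ∀ᵐ x, ∀ j, ι (e j) x = ((‖g j x‖ : ℝ) : ℂ) := ae_all_iff.2 he
      filter_upwards [coeFn_map_sub (ι := ι) (∑ j ∈ Finset.range J', e j) e₀,
        coeFn_map_sum (ι := ι) e J', hall] with x h1 h2 h3
      rw [h1, h2]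
      rw [tsub_le_iff_right]
      have h4 : ∑ j ∈ Finset.range J', ι (e j) x = ((∑ j ∈ Finset.range J', ‖g j x‖ : ℝ) : ℂ) := by
        push_cast
        exact Finset.sum_congr rfl fun j _ => h3 j
      have h5 : ∑ j ∈ Finset.range J, ‖g j x‖ₑ ≤ ‖∑ j ∈ Finset.range J', ι (e j) x‖ₑ := by
        rw [h4, ← ofReal_norm, Complex.norm_real,
          Real.norm_of_nonneg (Finset.sum_nonneg fun _ _ => norm_nonneg _),
          ENNReal.ofReal_sum_of_nonneg fun _ _ => norm_nonneg _]
        simp only [ofReal_norm]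
        exact Finset.sum_le_sum_of_subset (Finset.range_mono hJ')
      refine h5.trans ?_
      calc ‖∑ j ∈ Finset.range J', ι (e j) x‖ₑ
          = ‖(∑ j ∈ Finset.range J', ι (e j) x - ι e₀ x) + ι e₀ x‖ₑ := by rw [sub_add_cancel]
        _ ≤ _ := enorm_add_le _ _
    have hall : ∀ᵐ x, ∀ R : ℕ, x ∈ Metric.closedBall (0 : Rd d) R →
        ∑ j ∈ Finset.range J, ‖g j x‖ₑ - ‖ι e₀ x‖ₑ = 0 := ae_all_iff.2 hball
    filter_upwards [hall] with x hx
    obtain ⟨R, hR⟩ := exists_nat_ge ‖x‖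
    exact tsub_eq_zero_iff_le.1 (hx R (by simpa using hR))
  have hfinal : ∀ᵐ x, ‖h x‖ₑ ≤ ‖ι e₀ x‖ₑ := by
    filter_upwards [hle, ae_all_iff.2 hpart] with x h1 h2
    refine h1.trans ?_
    rw [ENNReal.tsum_eq_iSup_nat]
    exact iSup_le h2
  refine (eNormE_mono hE hh hfinal).trans ?_
  rw [eNormE_eq hE (Filter.EventuallyEq.refl _ _)]
  exact (enorm_tsum_le_tsum_enorm).trans hsum

theorem eNormE_le_sum (hE : IsSolidTIBF ι) {κ : Type*} (s : Finset κ) {g : κ → Rd d → ℂ}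
    {h : Rd d → ℂ} (hg : ∀ k ∈ s, AEStronglyMeasurable (g k) volume)
    (hh : AEStronglyMeasurable h volume)
    (hle : ∀ᵐ x, ‖h x‖ₑ ≤ ∑ k ∈ s, ‖g k x‖ₑ) : eNormE ι h ≤ ∑ k ∈ s, eNormE ι (g k) := by
  have key : eNormE ι (fun x => ((∑ k ∈ s, ‖g k x‖ : ℝ) : ℂ)) ≤ ∑ k ∈ s, eNormE ι (g k) := by
    clear hle
    classical
    induction s using Finset.induction_on with
    | empty =>
      simp only [Finset.sum_empty, Complex.ofReal_zero]
      rw [show (fun _ : Rd d => (0 : ℂ)) = 0 from rfl, eNormE_zero hE]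
    | insert a s ha ih =>
      simp only [Finset.sum_insert ha, Complex.ofReal_add]
      refine (eNormE_add_le hE _ _).trans ?_
      gcongr
      · exact eNormE_norm_le hE (hg a (Finset.mem_insert_self _ _))
      · exact ih fun k hk => hg k (Finset.mem_insert_of_mem hk)
  refine (eNormE_mono hE hh ?_).trans key
  filter_upwards [hle] with x hx
  refine hx.trans (le_of_eq ?_)
  rw [← ofReal_norm, Complex.norm_real,
    Real.norm_of_nonneg (Finset.sum_nonneg fun _ _ => norm_nonneg _),
    ENNReal.ofReal_sum_of_nonneg fun _ _ => norm_nonneg _]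
  simp only [ofReal_norm]

/-- Convolution with a fixed continuous compactly supported function is bounded on `E`. -/
theorem exists_eNormE_convolution_le (hE : IsSolidTIBF ι) {θ : Rd d → ℂ} (hθ : Continuous θ)
    (hθc : HasCompactSupport θ) : ∃ C : ℝ≥0, ∀ g : Rd d → ℂ,
      eNormE ι (convolution g θ (ContinuousLinearMap.mul ℂ ℂ) volume) ≤ (C + 1) * eNormE ι g := by
  choose T hT using fun e : E => hE.conv_mem e θ hθ hθc
  have hex : ∀ e : E, ConvolutionExists (ι e) θ (ContinuousLinearMap.mul ℂ ℂ) volume := fun e =>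
    hθc.convolutionExists_right _ (hE.locallyIntegrable e) hθ
  let Tl : E →ₗ[ℂ] E :=
    { toFun := T
      map_add' := fun a b => by
        apply hE.injective
        apply AEEqFun.ext
        refine (hT _).trans ?_
        rw [map_add, convolution_congr _ (AEEqFun.coeFn_add (ι a) (ι b))
          (Filter.EventuallyEq.refl _ θ), (hex a).add_distrib (hex b)]
        filter_upwards [coeFn_map_add (ι := ι) (T a) (T b), hT a, hT b] with x h1 h2 h3
        rw [h1, Pi.add_apply, h2, h3]
      map_smul' := fun c a => by
        apply hE.injective
        apply AEEqFun.ext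
        refine (hT _).trans ?_
        rw [convolution_congr _ (coeFn_map_smul (ι := ι) c a) (Filter.EventuallyEq.refl _ θ)]
        have := smul_convolution (f := ⇑(ι a)) (g := θ) (L := ContinuousLinearMap.mul ℂ ℂ)
          (μ := volume) (y := c)
        change convolution (c • ⇑(ι a)) θ _ _ =ᵐ[volume] _
        rw [this]
        filter_upwards [coeFn_map_smul (ι := ι) c (T a), hT a] with x h1 h2
        rw [RingHom.id_apply, h1, Pi.smul_apply, h2, smul_eq_mul] }
  obtain ⟨ρ, hρ⟩ := hθc.isCompact.isBounded.subset_closedBall 0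
  have hθ0 : ∀ x, ρ < ‖x‖ → θ x = 0 := fun x hx =>
    image_eq_zero_of_notMem_tsupport fun h => by
      have := hρ h
      rw [mem_closedBall_zero_iff] at this
      linarith
  obtain ⟨M, hM⟩ := hθ.bounded_above_of_compact_support hθc
  -- (A.3) yields only membership, so boundedness comes from the closed graph theorem. The graph is
  -- closed because convergence in `E` implies convergence in `L^1_loc`, where convolution with `θ`
  -- is continuous.
  have hzero : ∀ (u : ℕ → E) (z : E), Filter.Tendsto u Filter.atTop (nhds 0) →
      Filter.Tendsto (fun k => Tl (u k)) Filter.atTop (nhds z) → z = 0 := by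
    intro u z hu hz
    apply hE.injective
    rw [map_zero]
    apply AEEqFun.ext
    refine Filter.EventuallyEq.trans ?_ AEEqFun.coeFn_zero.symm
    have hball : ∀ R : ℕ, ∀ᵐ x, x ∈ Metric.closedBall (0 : Rd d) R → ‖ι z x‖ₑ = 0 := by
      intro R
      rw [← ae_restrict_iff' Metric.isClosed_closedBall.measurableSet]
      refine (lintegral_eq_zero_iff' (ι z).aestronglyMeasurable.enorm.restrict).1 ?_
      obtain ⟨C, hC⟩ := exists_lintegral_le_eNormE hE (isCompact_closedBall (0 : Rd d) R)
      obtain ⟨C', hC'⟩ := exists_lintegral_le_eNormE hE (isCompact_closedBall (0 : Rd d) (R + ρ))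
      set V := volume (Metric.closedBall (0 : Rd d) R) with hV
      have hVt : V ≠ ⊤ := measure_closedBall_lt_top.ne
      have hbound : ∀ k, ∫⁻ x in Metric.closedBall (0 : Rd d) R, ‖ι z x‖ₑ ≤
          (C + 1) * ‖z - Tl (u k)‖ₑ + (ENNReal.ofReal M * (C' + 1) * V) * ‖u k‖ₑ := by
        intro k
        have h1 : ∀ᵐ x, ‖ι z x‖ₑ ≤ ‖ι (z - Tl (u k)) x‖ₑ + ‖convolution (ι (u k)) θ
            (ContinuousLinearMap.mul ℂ ℂ) volume x‖ₑ := by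
          filter_upwards [coeFn_map_sub (ι := ι) z (Tl (u k)), hT (u k)] with x h1 h2
          rw [h1, ← h2]
          calc ‖ι z x‖ₑ = ‖(ι z x - ι (Tl (u k)) x) + ι (Tl (u k)) x‖ₑ := by rw [sub_add_cancel]
            _ ≤ _ := enorm_add_le _ _
        refine (lintegral_mono_ae (ae_restrict_of_ae h1)).trans ?_
        rw [lintegral_add_left' (ι _).aestronglyMeasurable.enorm.restrict]
        gcongr
        · have := hC (ι (z - Tl (u k)))
          rwa [eNormE_eq hE (Filter.EventuallyEq.refl _ _)] at this
        · have h2 := hC' (ι (u k))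
          rw [eNormE_eq hE (Filter.EventuallyEq.refl _ _)] at h2
          have h3 : ∀ x ∈ Metric.closedBall (0 : Rd d) R, ‖convolution (ι (u k)) θ
              (ContinuousLinearMap.mul ℂ ℂ) volume x‖ₑ ≤
              ENNReal.ofReal M * ((C' + 1) * ‖u k‖ₑ) := by
            intro x hx
            refine (enorm_convolution_le hM hθ0 (by simpa using hx)).trans ?_
            gcongr
          refine (setLIntegral_mono' Metric.isClosed_closedBall.measurableSet h3).trans ?_
          rw [setLIntegral_const]
          refine le_of_eq ?_
          ring
      have hlim : Filter.Tendsto (fun k => ((C : ℝ≥0∞) + 1) * ‖z - Tl (u k)‖ₑ +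
          (ENNReal.ofReal M * (C' + 1) * V) * ‖u k‖ₑ) Filter.atTop (nhds 0) := by
        have h1 : Filter.Tendsto (fun k => ‖z - Tl (u k)‖ₑ) Filter.atTop (nhds 0) := by
          simpa using (hz.const_sub z).enorm
        have h2 : Filter.Tendsto (fun k => ‖u k‖ₑ) Filter.atTop (nhds 0) := by
          simpa using hu.enorm
        have h3 := ENNReal.Tendsto.const_mul (a := (C : ℝ≥0∞) + 1) h1 (Or.inr (by simp))
        have h4 := ENNReal.Tendsto.const_mul (a := ENNReal.ofReal M * (C' + 1) * V) h2
          (Or.inr (by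
            refine ENNReal.mul_ne_top (ENNReal.mul_ne_top ENNReal.ofReal_ne_top (by simp)) hVt))
        simpa using h3.add h4
      exact le_antisymm (ge_of_tendsto hlim (Filter.Eventually.of_forall hbound)) zero_le
    filter_upwards [ae_all_iff.2 hball] with x hx
    obtain ⟨R, hR⟩ := exists_nat_ge ‖x‖
    simpa using hx R (by simpa using hR)
  have hcont : Continuous Tl := by
    refine LinearMap.continuous_of_seq_closed_graph Tl fun u x y hu hy => ?_
    have := hzero (fun k => u k - x) (y - Tl x) (by simpa using hu.sub_const x) (by
      simp only [map_sub]
      exact Filter.Tendsto.sub_const hy (Tl x))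
    exact sub_eq_zero.1 this
  let Tc : E →L[ℂ] E := ⟨Tl, hcont⟩
  refine ⟨‖Tc‖₊, fun g => ?_⟩
  rcases eq_or_ne (eNormE ι g) ⊤ with htop | htop
  · rw [htop, ENNReal.mul_top (by simp)]; exact le_top
  obtain ⟨e, he, hn⟩ := exists_eNormE_eq hE (lt_top_iff_ne_top.2 htop)
  rw [← convolution_congr _ he (Filter.EventuallyEq.refl _ θ), eNormE_eq hE (hT e), hn]
  have h1 : ‖Tc e‖ₑ ≤ ‖Tc‖ₑ * ‖e‖ₑ := ContinuousLinearMap.le_opENorm _ _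
  refine h1.trans ?_
  gcongr
  exact le_self_add

theorem eNormSl_le_tsum (hE : IsSolidTIBF ι) {g : ℕ → Rd d → ℂ} {h : Rd d → ℂ}
    (hg : ∀ j, AEStronglyMeasurable (g j) volume) (hh : AEStronglyMeasurable h volume)
    (hle : ∀ᵐ x, ‖h x‖ₑ ≤ ∑' j, ‖g j x‖ₑ) : eNormSl ι h ≤ ∑' j, eNormSl ι (g j) := by
  refine eNormSl_le_iff.2 fun R hR => ?_
  have hm := Metric.isClosed_closedBall (x := (0 : Rd d)) (ε := R).measurableSet
  refine (eNormE_le_tsum hE (g := fun j => (Metric.closedBall (0 : Rd d) R).indicator (g j))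
    (fun j => (hg j).indicator hm) (hh.indicator hm) ?_).trans
    (ENNReal.tsum_le_tsum fun j => eNormE_indicator_le_eNormSl _ hR)
  filter_upwards [hle] with x hx
  by_cases h : x ∈ Metric.closedBall (0 : Rd d) R
  · simpa only [Set.indicator_of_mem h] using hx
  · simp [Set.indicator_of_notMem h]

theorem eNormSl_le_sum (hE : IsSolidTIBF ι) {κ : Type*} (s : Finset κ) {g : κ → Rd d → ℂ}
    {h : Rd d → ℂ} (hg : ∀ k ∈ s, AEStronglyMeasurable (g k) volume)
    (hh : AEStronglyMeasurable h volume)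
    (hle : ∀ᵐ x, ‖h x‖ₑ ≤ ∑ k ∈ s, ‖g k x‖ₑ) : eNormSl ι h ≤ ∑ k ∈ s, eNormSl ι (g k) := by
  refine eNormSl_le_iff.2 fun R hR => ?_
  have hm := Metric.isClosed_closedBall (x := (0 : Rd d)) (ε := R).measurableSet
  refine (eNormE_le_sum hE s (g := fun j => (Metric.closedBall (0 : Rd d) R).indicator (g j))
    (fun j hj => (hg j hj).indicator hm) (hh.indicator hm) ?_).trans
    (Finset.sum_le_sum fun j _ => eNormE_indicator_le_eNormSl _ hR)
  filter_upwards [hle] with x hx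
  by_cases h : x ∈ Metric.closedBall (0 : Rd d) R
  · simpa only [Set.indicator_of_mem h] using hx
  · simp [Set.indicator_of_notMem h]

theorem eNormSl_le_of_le_mul (hE : IsSolidTIBF ι) {g h : Rd d → ℂ} {C : ℝ≥0}
    (hg : AEStronglyMeasurable g volume) (hgh : ∀ᵐ x, ‖g x‖ₑ ≤ C * ‖h x‖ₑ) :
    eNormSl ι g ≤ C * eNormSl ι h := by
  refine eNormSl_le_iff.2 fun R hR => ?_
  refine (eNormE_le_of_le_mul hE (h := (Metric.closedBall (0 : Rd d) R).indicator h)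
    (hg.indicator Metric.isClosed_closedBall.measurableSet) ?_).trans
    (by gcongr; exact eNormE_indicator_le_eNormSl _ hR)
  filter_upwards [hgh] with x hx
  by_cases h : x ∈ Metric.closedBall (0 : Rd d) R
  · simpa only [Set.indicator_of_mem h] using hx
  · simp [Set.indicator_of_notMem h]

/-- Every compact set lies in a ball, so solidity and `E ⊆ L^1_loc` recover the other two
requirements. Later estimates therefore need only treat the norm. -/
theorem memSl_of_eNormSl_lt_top (hE : IsSolidTIBF ι) {g : Rd d → ℂ}
    (hg : AEStronglyMeasurable g volume) (h : eNormSl ι g < ⊤) : MemSl ι g := by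
  have hball : ∀ R : ℝ, 0 < R → MemE ι ((Metric.closedBall (0 : Rd d) R).indicator g) :=
    fun R hR => memE_of_eNormE_lt_top ((eNormE_indicator_le_eNormSl g hR).trans_lt h)
  refine ⟨fun x => ?_, fun K hK => ?_, h⟩
  · obtain ⟨e, he⟩ := hball (‖x‖ + 1) (by positivity)
    refine ⟨Metric.closedBall (0 : Rd d) (‖x‖ + 1), ?_, ?_⟩
    · refine Filter.mem_of_superset (Metric.ball_mem_nhds x one_pos) fun y hy => ?_
      rw [mem_closedBall_zero_iff]
      have h1 : ‖y - x‖ < 1 := by simpa [dist_eq_norm] using hy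
      have h2 := norm_add_le (y - x) x
      rw [sub_add_cancel] at h2
      linarith
    · have h1 : IntegrableOn (ι e) (Metric.closedBall (0 : Rd d) (‖x‖ + 1)) :=
        (hE.locallyIntegrable e).integrableOn_isCompact (isCompact_closedBall _ _)
      refine h1.congr ?_
      have hm := Metric.isClosed_closedBall (x := (0 : Rd d)) (ε := ‖x‖ + 1).measurableSet
      filter_upwards [ae_restrict_of_ae he, ae_restrict_mem hm] with y h2 h3
      rw [h2, Set.indicator_of_mem h3]
  · obtain ⟨R, hR⟩ := hK.isBounded.subset_closedBall 0
    have hR' : K ⊆ Metric.closedBall 0 (max R 1) :=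
      hR.trans (Metric.closedBall_subset_closedBall (le_max_left _ _))
    refine memE_mono hE (hg.indicator hK.measurableSet) (Filter.Eventually.of_forall fun x => ?_)
      (hball (max R 1) (by positivity))
    by_cases hx : x ∈ K
    · rw [Set.indicator_of_mem hx, Set.indicator_of_mem (hR' hx)]
    · simp [hx]

end FunctionSpaceNorms

/-! ### Weights, and averages of jets as substitutes for local suprema -/

section WeightedEstimates

variable {E : Type*} [NormedAddCommGroup E] [NormedSpace ℂ E]
  {ι : E →ₗ[ℂ] (Rd d →ₘ[volume] ℂ)} {w : ℕ → Rd d → ℝ}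

theorem IsWeightSystem.mono (hw : IsWeightSystem w) {n m : ℕ} (h : n ≤ m) (x : Rd d) :
    w n x ≤ w m x :=
  monotone_nat_of_le_succ (f := fun n => w n x) (fun n => hw.increasing n x) h

theorem IsWeightSystem.pos (hw : IsWeightSystem w) (n : ℕ) (x : Rd d) : 0 < w n x :=
  zero_lt_one.trans_le (hw.one_le n x)

theorem WeakModerate.iterate (hwM : WeakModerate w) (k : ℕ) (m : ℕ) :
    ∃ n, m ≤ n ∧ ∃ C : ℝ, 0 < C ∧ ∀ x y, ‖y‖ ≤ k → w m (x + y) ≤ C * w n x := by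
  induction k with
  | zero =>
    refine ⟨m, le_rfl, 1, one_pos, fun x y hy => ?_⟩
    have : y = 0 := by simpa using hy
    simp [this]
  | succ k ih =>
    obtain ⟨n, hn, C, hC, h⟩ := ih
    obtain ⟨n', hn', C', hC', h'⟩ := hwM n
    refine ⟨n', hn.trans hn', C * C', mul_pos hC hC', fun x y hy => ?_⟩
    push_cast at hy
    have hk : (0 : ℝ) < k + 1 := by positivity
    -- Split a translation of length at most `k + 1` into parallel pieces of lengths at most `k` and
    -- `1`.
    set y₁ : Rd d := ((k : ℝ) / (k + 1)) • y with hy₁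
    set y₂ : Rd d := ((k + 1 : ℝ)⁻¹) • y with hy₂
    have h12 : y = y₂ + y₁ := by
      rw [hy₁, hy₂, ← add_smul]
      have : (k + 1 : ℝ)⁻¹ + k / (k + 1) = 1 := by field_simp; ring
      rw [this, one_smul]
    have hn1 : ‖y₁‖ ≤ k := by
      rw [hy₁, norm_smul, Real.norm_of_nonneg (by positivity), div_mul_eq_mul_div,
        div_le_iff₀ hk]
      gcongr
    have hn2 : ‖y₂‖ ≤ 1 := by
      rw [hy₂, norm_smul, Real.norm_of_nonneg (by positivity), inv_mul_le_iff₀ hk, mul_one]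
      exact hy
    rw [h12, ← add_assoc, mul_assoc]
    refine (h (x + y₂) y₁ hn1).trans ?_
    gcongr
    exact h' x y₂ (by simpa using hn2)

/-- The function `g / ρ`. -/
noncomputable def wdiv (ρ : Rd d → ℝ) (g : Rd d → ℂ) : Rd d → ℂ := fun x => (ρ x)⁻¹ • g x

theorem enorm_wdiv {ρ : Rd d → ℝ} {x : Rd d} (hρ : 0 < ρ x) (g : Rd d → ℂ) :
    ‖wdiv ρ g x‖ₑ = ENNReal.ofReal (ρ x)⁻¹ * ‖g x‖ₑ := by
  rw [wdiv, enorm_smul, Real.enorm_of_nonneg (by positivity)]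

theorem norm_wdiv {ρ : Rd d → ℝ} {x : Rd d} (hρ : 0 < ρ x) (g : Rd d → ℂ) :
    ‖wdiv ρ g x‖ = (ρ x)⁻¹ * ‖g x‖ := by
  rw [wdiv, norm_smul, Real.norm_of_nonneg (by positivity)]

theorem aestronglyMeasurable_wdiv (hw : IsWeightSystem w) (n : ℕ) {g : Rd d → ℂ}
    (hg : AEStronglyMeasurable g volume) : AEStronglyMeasurable (wdiv (w n) g) volume :=
  (hw.measurable n).inv.aestronglyMeasurable.smul hg

theorem exists_cutoff (d : ℕ) (R : ℝ) : ∃ θ : Rd d → ℝ, ContDiff ℝ ∞ θ ∧ HasCompactSupport θ ∧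
    (∀ x, 0 ≤ θ x) ∧ (∀ x, θ x ≤ 1) ∧ ∀ x, ‖x‖ ≤ R → θ x = 1 := by
  let b : ContDiffBump (0 : Rd d) := ⟨max R 1, max R 1 + 1, by positivity, by linarith⟩
  refine ⟨b, b.contDiff, b.hasCompactSupport, fun _ => b.nonneg, fun _ => b.le_one, fun x hx => ?_⟩
  exact b.one_of_mem_closedBall (by
    rw [mem_closedBall_zero_iff]; exact hx.trans (le_max_left _ _))

/-- The average of `jet P g` against the function `θ`. -/
noncomputable def avgJet (P : ℕ) (θ : Rd d → ℝ) (g : Rd d → ℂ) (x : Rd d) : ℝ :=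
  ∫ t, jet P g t * θ (x - t)

theorem integrable_jet_mul {θ : Rd d → ℝ} (hθ : Continuous θ) (hθc : HasCompactSupport θ) (P : ℕ)
    {g : Rd d → ℂ} (hg : ContDiff ℝ ∞ g) (x : Rd d) :
    Integrable fun t => jet P g t * θ (x - t) := by
  have h1 : Continuous fun t => θ (x - t) := hθ.comp (continuous_const.sub continuous_id)
  have h2 : HasCompactSupport fun t => θ (x - t) := hθc.comp_homeomorph (Homeomorph.subLeft x)
  exact ((continuous_jet P hg).mul h1).integrable_of_hasCompactSupport h2.mul_left

theorem continuous_avgJet {θ : Rd d → ℝ} (hθ : Continuous θ) (hθc : HasCompactSupport θ) (P : ℕ)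
    {g : Rd d → ℂ} (hg : ContDiff ℝ ∞ g) : Continuous (avgJet P θ g) :=
  hθc.continuous_convolution_right (𝕜 := ℝ) (ContinuousLinearMap.mul ℝ ℝ)
    (continuous_jet P hg).locallyIntegrable hθ

theorem avgJet_nonneg {θ : Rd d → ℝ} (h0 : ∀ x, 0 ≤ θ x) (P : ℕ) (g : Rd d → ℂ) (x : Rd d) :
    0 ≤ avgJet P θ g x :=
  integral_nonneg fun _ => mul_nonneg (jet_nonneg _ _ _) (h0 _)

theorem avgJet_iterPd_le {θ : Rd d → ℝ} (hθ : Continuous θ) (hθc : HasCompactSupport θ)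
    (h0 : ∀ x, 0 ≤ θ x) (P : ℕ) {L : ℕ} {l : List (Fin d)} (hl : l.length ≤ L)
    {g : Rd d → ℂ} (hg : ContDiff ℝ ∞ g) (x : Rd d) :
    avgJet P θ (iterPd l g) x ≤ avgJet (P + L) θ g x := by
  refine integral_mono (integrable_jet_mul hθ hθc P (contDiff_iterPd hg l) x)
    (integrable_jet_mul hθ hθc (P + L) hg x) fun t => ?_
  exact mul_le_mul_of_nonneg_right (jet_iterPd_le hl hg t) (h0 _)

/-- Derivatives near a point are controlled by averages of derivatives of higher order. -/
theorem exists_norm_iteratedFDeriv_le_avgJet {θ : Rd d → ℝ} (hθ : Continuous θ)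
    (hθc : HasCompactSupport θ) (h0 : ∀ x, 0 ≤ θ x) {ρ : ℝ} (h1 : ∀ x, ‖x‖ ≤ ρ + 1 → θ x = 1)
    (L : ℕ) : ∃ C : ℝ, 0 ≤ C ∧ ∀ g : Rd d → ℂ, ContDiff ℝ ∞ g → ∀ x z, ‖z‖ ≤ ρ →
      ‖iteratedFDeriv ℝ L g (x - z)‖ ≤ C * avgJet (d + 1 + L) θ g x := by
  obtain ⟨C, hC, hS⟩ := exists_norm_le_setIntegral_jet d
  -- The Sobolev inequality uses the unit ball around `x - z`, on which `θ (x - ·)` equals one;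
  -- hence the radius `ρ + 1` in the hypothesis on `θ`.
  have hbase : ∀ g : Rd d → ℂ, ContDiff ℝ ∞ g → ∀ x z, ‖z‖ ≤ ρ →
      ‖g (x - z)‖ ≤ C * avgJet (d + 1) θ g x := by
    intro g hg x z hz
    refine (hS g hg (x - z)).trans ?_
    gcongr
    rw [← integral_indicator Metric.isClosed_closedBall.measurableSet]
    refine integral_mono ?_ (integrable_jet_mul hθ hθc _ hg x) fun t => ?_
    · rw [integrable_indicator_iff Metric.isClosed_closedBall.measurableSet]
      exact (continuous_jet _ hg).continuousOn.integrableOn_compact (isCompact_closedBall _ _)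
    · by_cases ht : t ∈ Metric.closedBall (x - z) 1
      · rw [Set.indicator_of_mem ht, h1, mul_one]
        have h2 : ‖t - (x - z)‖ ≤ 1 := by simpa [dist_eq_norm] using ht
        have h3 : x - t = z - (t - (x - z)) := by abel
        rw [h3]
        exact (norm_sub_le _ _).trans (add_le_add hz h2)
      · rw [Set.indicator_of_notMem ht]
        exact mul_nonneg (jet_nonneg _ _ _) (h0 _)
  refine ⟨d ^ L * ((listsLE d L).card * C), by positivity, fun g hg x z hz => ?_⟩
  refine (norm_iteratedFDeriv_le_sum hg L _).trans ?_
  rw [mul_assoc, mul_assoc]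
  gcongr
  rw [← nsmul_eq_mul]
  refine Finset.sum_le_card_nsmul _ _ _ fun l hl => ?_
  refine (hbase _ (contDiff_iterPd hg l) x z hz).trans ?_
  gcongr
  exact avgJet_iterPd_le hθ hθc h0 _ (mem_listsLE.1 hl) hg x

variable [CompleteSpace E]

theorem eNormSl_wdiv_anti (hE : IsSolidTIBF ι) (hw : IsWeightSystem w) {n m : ℕ} (h : n ≤ m)
    {g : Rd d → ℂ} (hg : AEStronglyMeasurable g volume) :
    eNormSl ι (wdiv (w m) g) ≤ eNormSl ι (wdiv (w n) g) := by
  have := eNormSl_le_of_le_mul hE (C := 1) (aestronglyMeasurable_wdiv hw m hg)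
    (h := wdiv (w n) g) (Filter.Eventually.of_forall fun x => ?_)
  · simpa using this
  · rw [enorm_wdiv (hw.pos m x), enorm_wdiv (hw.pos n x), ENNReal.coe_one, one_mul]
    gcongr
    · exact hw.pos n x
    · exact hw.mono h x

/-- Averaging is convolution with a compactly supported function, hence bounded on `E`, and iterated
(wM) compares the weights at points whose distance is at most the radius of the support. The index
`n` depends on `m` and `θ` but not on the order `P`. -/
theorem exists_eNormSl_wdiv_avgJet_le (hE : IsSolidTIBF ι) (hw : IsWeightSystem w)
    (hwM : WeakModerate w) {θ : Rd d → ℝ} (hθ : Continuous θ) (hθc : HasCompactSupport θ)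
    (h0 : ∀ x, 0 ≤ θ x) (m : ℕ) : ∃ n, m ≤ n ∧ ∀ P : ℕ, ∃ C : ℝ≥0, ∀ g : Rd d → ℂ,
      ContDiff ℝ ∞ g → ∀ A : ℝ≥0∞, (∀ l ∈ listsLE d P, eNormSl ι (wdiv (w m) (iterPd l g)) ≤ A) →
      eNormSl ι (wdiv (w n) fun x => ((avgJet P θ g x : ℝ) : ℂ)) ≤ C * A := by
  obtain ⟨ρ', hρ'⟩ := hθc.isCompact.isBounded.subset_closedBall 0
  obtain ⟨ρ, hρ⟩ := exists_nat_ge ρ'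
  have hθ0 : ∀ x, (ρ : ℝ) < ‖x‖ → θ x = 0 := fun x hx =>
    image_eq_zero_of_notMem_tsupport fun h => by
      have := hρ' h
      rw [mem_closedBall_zero_iff] at this
      linarith
  obtain ⟨n, hmn, Cw, hCw, hwn⟩ := hwM.iterate ρ m
  refine ⟨n, hmn, fun P => ?_⟩
  have hθC : Continuous (fun x => ((θ x : ℝ) : ℂ)) := Complex.continuous_ofReal.comp hθ
  have hθCc : HasCompactSupport (fun x => ((θ x : ℝ) : ℂ)) :=
    hθc.comp_left (g := fun t : ℝ => (t : ℂ)) (by simp)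
  obtain ⟨Cθ, hconv⟩ := exists_eNormE_convolution_le hE hθC hθCc
  obtain ⟨C₁, hC₁, hjet⟩ := exists_jet_le_sum_iterPd d P
  refine ⟨Cw.toNNReal * ((Cθ + 1) * (C₁.toNNReal * (listsLE d P).card)), fun g hg A hA => ?_⟩
  refine eNormSl_le_iff.2 fun R hR => ?_
  have hmR := Metric.isClosed_closedBall (x := (0 : Rd d)) (ε := R).measurableSet
  have hmR' := Metric.isClosed_closedBall (x := (0 : Rd d)) (ε := R + ρ).measurableSet
  -- Only the ball of radius `R + ρ` influences the average on the ball of radius `R`. Truncating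
  -- there gives a function whose `E` norm is controlled by `E_sl` norms.
  let ur : Rd d → ℝ := (Metric.closedBall (0 : Rd d) (R + ρ)).indicator
    fun x => (w m x)⁻¹ * jet P g x
  let u : Rd d → ℂ := fun x => ((ur x : ℝ) : ℂ)
  have hur0 : ∀ x, 0 ≤ ur x := fun x => Set.indicator_nonneg
    (fun y _ => mul_nonneg (inv_nonneg.2 (hw.pos m y).le) (jet_nonneg _ _ _)) x
  have hurle : ∀ x, ur x ≤ jet P g x := fun x => by
    by_cases hx : x ∈ Metric.closedBall (0 : Rd d) (R + ρ)
    · have hu : ur x = (w m x)⁻¹ * jet P g x := Set.indicator_of_mem hx _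
      rw [hu]
      exact mul_le_of_le_one_left (jet_nonneg _ _ _) (inv_le_one_of_one_le₀ (hw.one_le m x))
    · have hu : ur x = 0 := Set.indicator_of_notMem hx _
      rw [hu]
      exact jet_nonneg _ _ _
  have hurm : AEStronglyMeasurable ur volume :=
    (((hw.measurable m).inv.aestronglyMeasurable).mul
      (continuous_jet P hg).aestronglyMeasurable).indicator hmR'
  have hum : AEStronglyMeasurable u volume :=
    Complex.continuous_ofReal.comp_aestronglyMeasurable hurm
  have hcont : Continuous (fun x => ((avgJet P θ g x : ℝ) : ℂ)) :=
    Complex.continuous_ofReal.comp (continuous_avgJet hθ hθc P hg)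
  have hpoint : ∀ x ∈ Metric.closedBall (0 : Rd d) R, (w n x)⁻¹ * avgJet P θ g x ≤
      Cw * ∫ t, ur t * θ (x - t) := by
    intro x hx
    rw [mem_closedBall_zero_iff] at hx
    unfold avgJet
    rw [← integral_const_mul, ← integral_const_mul]
    have hint := integrable_jet_mul hθ hθc P hg x
    have hθm : Continuous fun t => θ (x - t) := hθ.comp (continuous_const.sub continuous_id)
    have hint' : Integrable fun t => ur t * θ (x - t) := by
      refine hint.mono' (hurm.mul hθm.aestronglyMeasurable)
        (Filter.Eventually.of_forall fun t => ?_)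
      rw [Real.norm_of_nonneg (mul_nonneg (hur0 t) (h0 _))]
      exact mul_le_mul_of_nonneg_right (hurle t) (h0 _)
    refine integral_mono (hint.const_mul _) (hint'.const_mul _) fun t => ?_
    by_cases ht : ‖x - t‖ ≤ ρ
    · have htm : t ∈ Metric.closedBall (0 : Rd d) (R + ρ) := by
        rw [mem_closedBall_zero_iff]
        have := norm_sub_le x (x - t)
        rw [sub_sub_cancel] at this
        linarith
      have hu : ur t = (w m t)⁻¹ * jet P g t := Set.indicator_of_mem htm _
      have hwt : w m t ≤ Cw * w n x := by
        have := hwn x (t - x) (by rwa [norm_sub_rev])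
        rwa [add_sub_cancel] at this
      have hinv : (w n x)⁻¹ ≤ Cw * (w m t)⁻¹ := by
        rw [inv_le_iff_one_le_mul₀ (hw.pos n x), mul_assoc, mul_comm _ (w n x), ← mul_assoc,
          ← div_eq_mul_inv, one_le_div (hw.pos m t)]
        exact hwt
      simp only [hu]
      calc (w n x)⁻¹ * (jet P g t * θ (x - t))
          ≤ (Cw * (w m t)⁻¹) * (jet P g t * θ (x - t)) :=
            mul_le_mul_of_nonneg_right hinv (mul_nonneg (jet_nonneg _ _ _) (h0 _))
        _ = _ := by ring
    · simp [hθ0 _ (not_le.1 ht)]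
  have hstep1 : eNormE ι ((Metric.closedBall (0 : Rd d) R).indicator
      (wdiv (w n) fun x => ((avgJet P θ g x : ℝ) : ℂ))) ≤ Cw.toNNReal *
      eNormE ι (convolution u (fun x => ((θ x : ℝ) : ℂ)) (ContinuousLinearMap.mul ℂ ℂ) volume) := by
    refine eNormE_le_of_le_mul hE
      ((aestronglyMeasurable_wdiv hw n hcont.aestronglyMeasurable).indicator hmR)
      (Filter.Eventually.of_forall fun x => ?_)
    by_cases hx : x ∈ Metric.closedBall (0 : Rd d) R
    · rw [Set.indicator_of_mem hx]
      have e1 : convolution u (fun x => ((θ x : ℝ) : ℂ)) (ContinuousLinearMap.mul ℂ ℂ) volume x =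
          ((∫ t, ur t * θ (x - t) : ℝ) : ℂ) := by
        rw [convolution_apply, ← integral_complex_ofReal]
        simp [u]
      have e2 : 0 ≤ ∫ t, ur t * θ (x - t) := integral_nonneg fun t => mul_nonneg (hur0 t) (h0 _)
      rw [e1, ← ofReal_norm, ← ofReal_norm, Complex.norm_real, Real.norm_of_nonneg e2,
        norm_wdiv (hw.pos n x), Complex.norm_real, Real.norm_of_nonneg (avgJet_nonneg h0 _ _ _)]
      change _ ≤ ENNReal.ofReal Cw * _
      rw [← ENNReal.ofReal_mul hCw.le]
      exact ENNReal.ofReal_le_ofReal (hpoint x hx)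
    · rw [Set.indicator_of_notMem hx, enorm_zero]
      exact zero_le
  have hstep2 : eNormE ι u ≤ C₁.toNNReal * ((listsLE d P).card * A) := by
    have h1 : eNormE ι u ≤ C₁.toNNReal * eNormE ι (fun x => ((∑ l ∈ listsLE d P,
        ‖(Metric.closedBall (0 : Rd d) (R + ρ)).indicator (wdiv (w m)
          (iterPd l g)) x‖ : ℝ) : ℂ)) := by
      refine eNormE_le_of_le_mul hE hum (Filter.Eventually.of_forall fun x => ?_)
      rw [← ofReal_norm, ← ofReal_norm, Complex.norm_real, Complex.norm_real,
        Real.norm_of_nonneg (hur0 x),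
        Real.norm_of_nonneg (Finset.sum_nonneg fun _ _ => norm_nonneg _)]
      change _ ≤ ENNReal.ofReal C₁ * _
      rw [← ENNReal.ofReal_mul hC₁]
      refine ENNReal.ofReal_le_ofReal ?_
      by_cases hx : x ∈ Metric.closedBall (0 : Rd d) (R + ρ)
      · have hu : ur x = (w m x)⁻¹ * jet P g x := Set.indicator_of_mem hx _
        simp only [Set.indicator_of_mem hx, norm_wdiv (hw.pos m x)]
        rw [hu, ← Finset.mul_sum, mul_left_comm]
        exact mul_le_mul_of_nonneg_left (hjet g hg x) (inv_nonneg.2 (hw.pos m x).le)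
      · have hu : ur x = 0 := Set.indicator_of_notMem hx _
        simp [hu, Set.indicator_of_notMem hx]
    refine h1.trans ?_
    gcongr
    have hmeas : ∀ l, AEStronglyMeasurable ((Metric.closedBall (0 : Rd d) (R + ρ)).indicator
        (wdiv (w m) (iterPd l g))) volume := fun l => (aestronglyMeasurable_wdiv hw m
          (contDiff_iterPd hg l).continuous.aestronglyMeasurable).indicator hmR'
    refine (eNormE_le_sum hE (listsLE d P) (g := fun l =>
      (Metric.closedBall (0 : Rd d) (R + ρ)).indicator (wdiv (w m) (iterPd l g)))
      (fun l _ => hmeas l) ?_ (Filter.Eventually.of_forall fun x => ?_)).trans ?_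
    · exact Complex.continuous_ofReal.comp_aestronglyMeasurable
        (Finset.aestronglyMeasurable_fun_sum _ fun l _ => (hmeas l).norm)
    · rw [← ofReal_norm, Complex.norm_real,
        Real.norm_of_nonneg (Finset.sum_nonneg fun _ _ => norm_nonneg _),
        ENNReal.ofReal_sum_of_nonneg fun _ _ => norm_nonneg _]
      simp only [ofReal_norm]
      exact le_rfl
    · rw [← nsmul_eq_mul]
      refine Finset.sum_le_card_nsmul _ _ _ fun l hl => ?_
      exact (eNormE_indicator_le_eNormSl _ (by positivity)).trans (hA l hl)
  refine hstep1.trans ?_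
  push_cast
  rw [mul_assoc, mul_assoc, mul_assoc]
  gcongr
  exact (hconv u).trans (by gcongr)

end WeightedEstimates

/-! ### Scaled kernels and vanishing moments -/

section ScaledConvolution

theorem integral_mul_dil (G : Rd d → ℂ) (φ : Test d) (j : ℕ) :
    ∫ y, G y * dil φ j y = ∫ y, G (((2 : ℝ) ^ j)⁻¹ • y) * φ y := by
  have h := Measure.integral_comp_smul (volume : Measure (Rd d))
    (fun y => G (((2 : ℝ) ^ j)⁻¹ • y) * φ y) ((2 : ℝ) ^ j)
  have h2 : ∀ y : Rd d, ((2 : ℝ) ^ j)⁻¹ • (2 : ℝ) ^ j • y = y := fun y =>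
    inv_smul_smul₀ (pow_ne_zero j two_ne_zero) y
  simp only [h2, finrank_euclideanSpace, Fintype.card_fin] at h
  have h3 : ∫ y, G y * dil φ j y = (2 : ℂ) ^ (j * d) * ∫ y, G y * φ ((2 : ℝ) ^ j • y) := by
    rw [← integral_const_mul]
    refine integral_congr_ae (Filter.Eventually.of_forall fun y => ?_)
    simp only [coe_dil]
    ring
  rw [h3, h, ← pow_mul, abs_of_pos (by positivity), Complex.real_smul, ← mul_assoc]
  push_cast
  rw [mul_inv_cancel₀ (pow_ne_zero _ two_ne_zero), one_mul]

theorem integrable_norm_pow_mul (ψ : Test d) (k : ℕ) : Integrable fun y => ‖y‖ ^ k * ‖ψ y‖ :=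
  ((continuous_norm.pow k).mul ψ.continuous.norm).integrable_of_hasCompactSupport
    (HasCompactSupport.mul_left ψ.hasCompactSupport.norm)

theorem norm_smul_le_of_mem_tsupport {ψ : Test d} {ρ : ℝ} (hρ : tsupport ψ ⊆ Metric.closedBall 0 ρ)
    {s : ℝ} (hs0 : 0 ≤ s) (hs1 : s ≤ 1) {y : Rd d} (hy : ψ y ≠ 0) : ‖s • y‖ ≤ ρ := by
  have h1 : ‖y‖ ≤ ρ := by simpa using hρ (subset_tsupport _ hy)
  rw [norm_smul, Real.norm_of_nonneg hs0]
  exact (mul_le_of_le_one_left (norm_nonneg _) hs1).trans h1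

theorem norm_integral_comp_smul_le {g : Rd d → ℂ} {ψ : Test d} {ρ : ℝ}
    (hρ : tsupport ψ ⊆ Metric.closedBall 0 ρ) {s : ℝ} (hs0 : 0 ≤ s) (hs1 : s ≤ 1) {x : Rd d}
    {S : ℝ} (hS : ∀ z, ‖z‖ ≤ ρ → ‖g (x - z)‖ ≤ S) :
    ‖∫ y, g (x - s • y) * ψ y‖ ≤ S * ∫ y, ‖ψ y‖ := by
  rw [← integral_const_mul]
  refine norm_integral_le_of_norm_le ((ψ.continuous.integrable_of_hasCompactSupport
    ψ.hasCompactSupport).norm.const_mul S) (Filter.Eventually.of_forall fun y => ?_)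
  rw [norm_mul]
  by_cases hy : ψ y = 0
  · simp [hy]
  · exact mul_le_mul_of_nonneg_right (hS _ (norm_smul_le_of_mem_tsupport hρ hs0 hs1 hy))
      (norm_nonneg _)

/-- The product of coordinates is the monomial whose exponents are the cardinalities of the fibres
of `c`, of total degree `k`. -/
theorem integral_prod_mul_eq_zero {L : ℕ} {ψ : Test d} (hψ : VanishingMoments L ψ) {k : ℕ}
    (hk : k < L) (c : Fin k → Fin d) : ∫ y : Rd d, ((∏ i, y (c i) : ℝ) : ℂ) * ψ y = 0 := by
  have := hψ (fun i => (Finset.univ.filter fun a => c a = i).card) (by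
    unfold order
    rw [← Finset.card_eq_sum_card_fiberwise (fun a _ => Finset.mem_univ _)]
    simpa using hk)
  rw [← this]
  refine integral_congr_ae (Filter.Eventually.of_forall fun y => ?_)
  have e : ∏ a, y (c a) = ∏ i, y i ^ (Finset.univ.filter fun a => c a = i).card := ?_
  · simp only [e]
  rw [← Finset.prod_fiberwise_of_maps_to (g := c) (t := Finset.univ) fun a _ => Finset.mem_univ _]
  refine Finset.prod_congr rfl fun i _ => ?_
  rw [Finset.prod_congr rfl (g := fun _ => y i) fun a ha => by
    rw [(Finset.mem_filter.1 ha).2], Finset.prod_const]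

/-- Expansion in the standard basis turns the diagonal of `T` into a homogeneous polynomial of
degree `k`. These are the terms of a Taylor polynomial. -/
theorem integral_multilinear_mul_eq_zero {L : ℕ} {ψ : Test d} (hψ : VanishingMoments L ψ) {k : ℕ}
    (hk : k < L) (T : ContinuousMultilinearMap ℝ (fun _ : Fin k => Rd d) ℂ) (s : ℝ) :
    ∫ y : Rd d, T (fun _ => s • y) * ψ y = 0 := by
  have h1 : ∀ y : Rd d, T (fun _ => s • y) * ψ y = ∑ c : Fin k → Fin d,
      ((s : ℂ) ^ k * T fun a => EuclideanSpace.single (c a) 1) *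
        (((∏ i, y (c i) : ℝ) : ℂ) * ψ y) := by
    intro y
    have hy : s • y = ∑ i, (s * y i) • (EuclideanSpace.single i (1 : ℝ) : Rd d) := by
      simpa [mul_smul, Finset.smul_sum] using
        congrArg (fun v => s • v) ((EuclideanSpace.basisFun (Fin d) ℝ).sum_repr y).symm
    rw [hy, ContinuousMultilinearMap.map_sum, Finset.sum_mul]
    refine Finset.sum_congr rfl fun c _ => ?_
    rw [ContinuousMultilinearMap.map_smul_univ, Complex.real_smul, Finset.prod_mul_distrib,
      Finset.prod_const, Finset.card_univ, Fintype.card_fin]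
    push_cast
    ring
  simp only [h1]
  rw [integral_finsetSum]
  · refine Finset.sum_eq_zero fun c _ => ?_
    rw [integral_const_mul, integral_prod_mul_eq_zero hψ hk, mul_zero]
  · intro c _
    refine Integrable.const_mul ?_ _
    have hc : Continuous fun y : Rd d => ((∏ i, y (c i) : ℝ) : ℂ) := by fun_prop
    exact (hc.mul ψ.continuous).integrable_of_hasCompactSupport
      (HasCompactSupport.mul_left ψ.hasCompactSupport)

/-- Convolution with a scaled kernel with vanishing moments gains powers of the scale. -/
theorem norm_integral_comp_smul_le_of_vanishingMoments {g : Rd d → ℂ} (hg : ContDiff ℝ ∞ g)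
    {n : ℕ} {ψ : Test d} (hψ : VanishingMoments (n + 1) ψ) {ρ : ℝ}
    (hρ : tsupport ψ ⊆ Metric.closedBall 0 ρ) {s : ℝ} (hs0 : 0 ≤ s) (hs1 : s ≤ 1) {x : Rd d}
    {S : ℝ} (hS : ∀ z, ‖z‖ ≤ ρ → ‖iteratedFDeriv ℝ (n + 1) g (x - z)‖ ≤ S) :
    ‖∫ y, g (x - s • y) * ψ y‖ ≤ S * s ^ (n + 1) * ∫ y, ‖y‖ ^ (n + 1) * ‖ψ y‖ := by
  -- `Q` is the Taylor polynomial of degree `n` of `g` at `x` with increment `-s y`. The moment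
  -- condition kills its integral against `ψ`, so only the remainder counts.
  let Q : Rd d → ℂ := fun y => ∑ k ∈ Finset.range (n + 1),
    (k.factorial : ℝ)⁻¹ • iteratedFDeriv ℝ k g x (fun _ => (-s) • y)
  have hQc : ∀ k, Continuous fun y : Rd d => iteratedFDeriv ℝ k g x (fun _ => (-s) • y) :=
    fun k => (iteratedFDeriv ℝ k g x).cont.comp
      (continuous_pi fun _ => continuous_const_smul _)
  have hQi : ∀ k, Integrable fun y : Rd d =>
      iteratedFDeriv ℝ k g x (fun _ => (-s) • y) * ψ y := fun k =>
    ((hQc k).mul ψ.continuous).integrable_of_hasCompactSupport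
      (HasCompactSupport.mul_left ψ.hasCompactSupport)
  have hQψ : ∀ y, Q y * ψ y = ∑ k ∈ Finset.range (n + 1), ((k.factorial : ℝ)⁻¹ : ℂ) *
      (iteratedFDeriv ℝ k g x (fun _ => (-s) • y) * ψ y) := by
    intro y
    simp only [Q, Finset.sum_mul, Complex.real_smul]
    refine Finset.sum_congr rfl fun k _ => ?_
    push_cast
    ring
  have hQ0 : ∫ y, Q y * ψ y = 0 := by
    simp only [hQψ]
    rw [integral_finsetSum _ fun k _ => (hQi k).const_mul _]
    refine Finset.sum_eq_zero fun k hk => ?_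
    rw [integral_const_mul, integral_multilinear_mul_eq_zero hψ (Finset.mem_range.1 hk), mul_zero]
  have hQint : Integrable fun y => Q y * ψ y := by
    simp only [hQψ]
    exact integrable_finsetSum _ fun k _ => (hQi k).const_mul _
  have hgint : Integrable fun y => g (x - s • y) * ψ y :=
    ((hg.continuous.comp (continuous_const.sub (continuous_const_smul s))).mul
      ψ.continuous).integrable_of_hasCompactSupport (HasCompactSupport.mul_left ψ.hasCompactSupport)
  rw [← sub_zero (∫ y, g (x - s • y) * ψ y), ← hQ0, ← integral_sub hgint hQint,
    ← integral_const_mul]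
  refine norm_integral_le_of_norm_le ((integrable_norm_pow_mul ψ (n + 1)).const_mul _)
    (Filter.Eventually.of_forall fun y => ?_)
  by_cases hy : ψ y = 0
  · simp [hy]
  have hyρ := fun (t : ℝ) (ht0 : 0 ≤ t) (ht1 : t ≤ 1) =>
    norm_smul_le_of_mem_tsupport hρ (mul_nonneg ht0 hs0) (mul_le_one₀ ht1 hs0 hs1) hy
  have hT := map_add_eq_sum_add_integral_iteratedFDeriv (f := g) (x := x) (y := (-s) • y) (n := n)
    fun t _ => (hg.of_le (by exact_mod_cast le_top)).contDiffAt
  have e1 : x + (-s) • y = x - s • y := by rw [neg_smul, ← sub_eq_add_neg]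
  rw [e1] at hT
  have hrem : ‖g (x - s • y) - Q y‖ ≤ S * (s * ‖y‖) ^ (n + 1) := by
    rw [hT]
    simp only [Q]
    rw [add_sub_cancel_left, norm_smul]
    have h1 : ‖∫ t in (0 : ℝ)..1, (1 - t) ^ n •
        iteratedFDeriv ℝ (n + 1) g (x + t • (-s) • y) (fun _ => (-s) • y)‖ ≤
        S * (s * ‖y‖) ^ (n + 1) * |1 - 0| := by
      refine intervalIntegral.norm_integral_le_of_norm_le_const fun t ht => ?_
      rw [Set.uIoc_of_le zero_le_one] at ht
      have e2 : x + t • (-s) • y = x - (t * s) • y := by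
        rw [neg_smul, smul_neg, ← sub_eq_add_neg, smul_smul]
      rw [e2, norm_smul]
      have h2 := (iteratedFDeriv ℝ (n + 1) g (x - (t * s) • y)).le_opNorm (fun _ => (-s) • y)
      have h3 : ‖(1 - t) ^ n‖ ≤ 1 := by
        rw [norm_pow, Real.norm_of_nonneg (by linarith [ht.2])]
        exact pow_le_one₀ (by linarith [ht.2]) (by linarith [ht.1])
      refine (mul_le_of_le_one_left (norm_nonneg _) h3).trans (h2.trans ?_)
      rw [Finset.prod_const, Finset.card_univ, Fintype.card_fin, norm_smul, norm_neg,
        Real.norm_of_nonneg hs0]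
      gcongr
      exact hS _ (hyρ t ht.1.le ht.2)
    rw [sub_zero, abs_one, mul_one] at h1
    -- The factor `1 / n!` of the integral remainder is discarded.
    refine (mul_le_of_le_one_left (norm_nonneg _) ?_).trans h1
    rw [norm_inv, Real.norm_natCast]
    exact inv_le_one_of_one_le₀
      (by exact_mod_cast Nat.one_le_iff_ne_zero.2 (Nat.factorial_ne_zero n))
  rw [← sub_mul, norm_mul]
  refine (mul_le_mul_of_nonneg_right hrem (norm_nonneg _)).trans (le_of_eq ?_)
  ring

/-- The derivative first falls on `φ`, and integration by parts moves it to `F`. The compact support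
of `φ` removes boundary terms, with no growth condition on `F`. -/
theorem pderiv_convolution_left {F : Rd d → ℂ} (hF : ContDiff ℝ ∞ F) (φ : Test d) (i : Fin d) :
    pderiv i (convolution F φ (ContinuousLinearMap.mul ℂ ℂ) volume) =
      convolution (pderiv i F) φ (ContinuousLinearMap.mul ℂ ℂ) volume := by
  rw [pderiv_convolution hF.continuous.locallyIntegrable (test_contDiff φ) φ.hasCompactSupport]
  funext x
  rw [convolution_apply, convolution_apply]
  have hq : ContDiff ℝ ∞ fun t => φ (x - t) :=
    (test_contDiff φ).comp (contDiff_const.sub contDiff_id)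
  have hqc : HasCompactSupport fun t => φ (x - t) :=
    φ.hasCompactSupport.comp_homeomorph (Homeomorph.subLeft x)
  have hd : ∀ t, fderiv ℝ (fun t => φ (x - t)) t (EuclideanSpace.single i 1) =
      -pderiv i φ (x - t) := by
    intro t
    have h1 := iterPd_comp_sub (fun y => φ (-y)) x [i]
    rw [iterPd_cons, iterPd_nil, iterPd_cons, iterPd_nil, pderiv_comp_neg] at h1
    simp only [neg_sub] at h1
    exact congrFun h1 t
  have hdc : Continuous fun t => fderiv ℝ (fun t => φ (x - t)) t (EuclideanSpace.single i 1) :=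
    (contDiff_pderiv hq i).continuous
  have := integral_mul_fderiv_eq_neg_fderiv_mul_of_integrable (μ := volume) (f := F)
    (g := fun t => φ (x - t)) (v := (EuclideanSpace.single i 1 : Rd d))
    (((contDiff_pderiv hF i).continuous.mul hq.continuous).integrable_of_hasCompactSupport
      hqc.mul_left)
    ((hF.continuous.mul hdc).integrable_of_hasCompactSupport
      (hqc.fderiv_apply (𝕜 := ℝ) _).mul_left)
    ((hF.continuous.mul hq.continuous).integrable_of_hasCompactSupport hqc.mul_left)
    (fun t _ => hF.differentiable (by simp) t) (fun t _ => hq.differentiable (by simp) t)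
  simp only [hd, mul_neg, integral_neg, neg_inj] at this
  exact this

theorem iterPd_convolution_left {F : Rd d → ℂ} (hF : ContDiff ℝ ∞ F) (φ : Test d)
    (l : List (Fin d)) : iterPd l (convolution F φ (ContinuousLinearMap.mul ℂ ℂ) volume) =
      convolution (iterPd l F) φ (ContinuousLinearMap.mul ℂ ℂ) volume := by
  induction l with
  | nil => rfl
  | cons i l ih => rw [iterPd_cons, ih, pderiv_convolution_left (contDiff_iterPd hF l)]; rfl

end ScaledConvolution

/-! ### Smooth functions with derivatives in weighted `E_sl`; uniform bounds for their
mollifications -/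

section Multipliers

variable {E : Type*} [NormedAddCommGroup E] [NormedSpace ℂ E]
  {ι : E →ₗ[ℂ] (Rd d →ₘ[volume] ℂ)} {w : ℕ → Rd d → ℝ}

/-- The smooth functions all of whose derivatives belong to a weighted semi-local space. -/
structure IsSlSmooth (ι : E →ₗ[ℂ] (Rd d →ₘ[volume] ℂ)) (w : ℕ → Rd d → ℝ) (F : Rd d → ℂ) :
    Prop where
  contDiff : ContDiff ℝ ∞ F
  eNormSl_lt_top : ∀ l : List (Fin d), ∃ m, eNormSl ι (wdiv (w m) (iterPd l F)) < ⊤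

/-- The distribution `f` is given by integration against `F`. -/
def Represents (f : Distrib d) (F : Rd d → ℂ) : Prop := ∀ θ : Test d, f θ = ∫ x, F x * θ x

theorem Represents.conv_eq {f : Distrib d} {F : Rd d → ℂ} (h : Represents f F) (φ : Test d) :
    conv f φ = convolution F φ (ContinuousLinearMap.mul ℂ ℂ) volume := by
  funext x
  rw [conv, h, convolution_apply]
  rfl

theorem convolution_dil (g : Rd d → ℂ) (φ : Test d) (j : ℕ) (x : Rd d) :
    convolution g (dil φ j) (ContinuousLinearMap.mul ℂ ℂ) volume x =
      ∫ y, g (x - ((2 : ℝ) ^ j)⁻¹ • y) * φ y := by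
  rw [convolution_apply, ← integral_mul_dil (fun y => g (x - y)), ← integral_sub_left_eq_self _ _ x]
  simp only [sub_sub_cancel]

theorem inv_two_pow_nonneg (j : ℕ) : (0 : ℝ) ≤ ((2 : ℝ) ^ j)⁻¹ := by positivity

theorem inv_two_pow_le_one (j : ℕ) : ((2 : ℝ) ^ j)⁻¹ ≤ 1 :=
  inv_le_one_of_one_le₀ (one_le_pow₀ one_le_two)

theorem IsSlSmooth.iterPd (hF : IsSlSmooth ι w F) (l : List (Fin d)) :
    IsSlSmooth ι w (iterPd l F) :=
  ⟨contDiff_iterPd hF.contDiff l, fun l' => by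
    rw [← iterPd_append]; exact hF.eNormSl_lt_top _⟩

variable [CompleteSpace E]

theorem exists_forall_eNormSl_lt_top (hE : IsSolidTIBF ι) (hw : IsWeightSystem w)
    {F : Rd d → ℂ} (hF : IsSlSmooth ι w F) (s : Finset (List (Fin d))) :
    ∃ m, ∀ l ∈ s, eNormSl ι (wdiv (w m) (iterPd l F)) < ⊤ := by
  choose m hm using hF.eNormSl_lt_top
  refine ⟨s.sup m, fun l hl => lt_of_le_of_lt ?_ (hm l)⟩
  exact eNormSl_wdiv_anti hE hw (Finset.le_sup hl)
    (contDiff_iterPd hF.contDiff l).continuous.aestronglyMeasurable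

theorem boundedSl_of_eNormSl_le (hE : IsSolidTIBF ι) {S : Set (Rd d → ℂ)} {C : ℝ≥0∞} (hC : C < ⊤)
    (h : ∀ g ∈ S, AEStronglyMeasurable g volume ∧ eNormSl ι g ≤ C) : BoundedSl ι S := by
  refine ⟨C.toNNReal, fun g hg => ?_⟩
  rw [ENNReal.coe_toNNReal hC.ne]
  exact ⟨memSl_of_eNormSl_lt_top hE (h g hg).1 ((h g hg).2.trans_lt hC), (h g hg).2⟩

/-- Since `2 ^ (-j) ≤ 1`, the mollification at `x` involves only values of the derivative of `F`
within a fixed distance `ρ`. An average of its jet bounds these independently of `j`. -/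
theorem boundedSl_mderiv_conv_dil (hE : IsSolidTIBF ι) (hw : IsWeightSystem w)
    (hwM : WeakModerate w) {f : Distrib d} {F : Rd d → ℂ} (hF : IsSlSmooth ι w F)
    (hf : Represents f F) (φ : Test d) (α : Fin d → ℕ) : ∃ n : ℕ, BoundedSl ι
      {g | ∃ j : ℕ, g = fun x => (w n x)⁻¹ • mderiv α (conv f (dil φ j)) x} := by
  set l := indexList α
  obtain ⟨ρ, hρ0, hρ⟩ := exists_tsupport_subset_closedBall φ
  obtain ⟨θ, hθs, hθc, hθ0, -, hθ1⟩ := exists_cutoff d (ρ + 1)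
  have hθ := hθs.continuous
  obtain ⟨C, hC, hmax⟩ := exists_norm_iteratedFDeriv_le_avgJet hθ hθc hθ0 hθ1 0
  obtain ⟨m, hm⟩ := exists_forall_eNormSl_lt_top hE hw (hF.iterPd l) (listsLE d (d + 1))
  obtain ⟨n, -, hn⟩ := exists_eNormSl_wdiv_avgJet_le hE hw hwM hθ hθc hθ0 m
  -- The zero is kept to match the general order `d + 1 + L`, with `L = 0` here.
  obtain ⟨C', hC'⟩ := hn (d + 1 + 0)
  have hG := (hF.iterPd l).contDiff
  set A := ∑ l' ∈ listsLE d (d + 1), eNormSl ι (wdiv (w m) (iterPd l' (iterPd l F))) with hA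
  have hAt : A < ⊤ := ENNReal.sum_lt_top.2 hm
  have hB := hC' _ hG A fun l' hl' =>
    Finset.single_le_sum (f := fun l' => eNormSl ι (wdiv (w m) (iterPd l' (iterPd l F))))
      (fun _ _ => zero_le) hl'
  set I := ∫ y, ‖φ y‖ with hI
  have hI0 : 0 ≤ I := integral_nonneg fun _ => norm_nonneg _
  refine ⟨n, boundedSl_of_eNormSl_le hE (C := (C * I).toNNReal * (C' * A)) ?_ ?_⟩
  · exact ENNReal.mul_lt_top ENNReal.coe_lt_top (ENNReal.mul_lt_top ENNReal.coe_lt_top hAt)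
  rintro g ⟨j, rfl⟩
  have hmeas : AEStronglyMeasurable (wdiv (w n) (iterPd l (conv f (dil φ j)))) volume :=
    aestronglyMeasurable_wdiv hw n
      (contDiff_iterPd (contDiff_conv f _) l).continuous.aestronglyMeasurable
  have heq : (fun x => (w n x)⁻¹ • mderiv α (conv f (dil φ j)) x) =
      wdiv (w n) (iterPd l (conv f (dil φ j))) := by
    rw [mderiv_eq_iterPd]; rfl
  rw [heq]
  refine ⟨hmeas, le_trans (eNormSl_le_of_le_mul hE hmeas
    (h := wdiv (w n) fun x => ((avgJet (d + 1 + 0) θ (iterPd l F) x : ℝ) : ℂ))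
    (Filter.Eventually.of_forall fun x => ?_)) (by gcongr)⟩
  rw [← ofReal_norm, ← ofReal_norm, norm_wdiv (hw.pos n x), norm_wdiv (hw.pos n x),
    Complex.norm_real, Real.norm_of_nonneg (avgJet_nonneg hθ0 _ _ _)]
  change _ ≤ ENNReal.ofReal (C * I) * _
  rw [← ENNReal.ofReal_mul (by positivity)]
  refine ENNReal.ofReal_le_ofReal ?_
  rw [mul_left_comm]
  refine mul_le_mul_of_nonneg_left ?_ (inv_nonneg.2 (hw.pos n x).le)
  rw [hf.conv_eq, iterPd_convolution_left hF.contDiff, convolution_dil]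
  refine (norm_integral_comp_smul_le hρ (inv_two_pow_nonneg j) (inv_two_pow_le_one j)
    (S := C * avgJet (d + 1 + 0) θ (iterPd l F) x) fun z hz => ?_).trans (le_of_eq (by ring))
  have := hmax _ hG x z hz
  rwa [norm_iteratedFDeriv_zero] at this

end Multipliers

/-! ### Locally normally convergent series of smooth functions -/

section Series

/-- All derivatives of the series `∑ u j` converge normally on bounded sets. -/
def LocallyNormal (u : ℕ → Rd d → ℂ) : Prop :=
  ∀ (l : List (Fin d)) (R : ℝ), ∃ a : ℕ → ℝ, Summable a ∧
    ∀ j x, ‖x‖ ≤ R → ‖iterPd l (u j) x‖ ≤ a j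

theorem LocallyNormal.iterPd {u : ℕ → Rd d → ℂ} (h : LocallyNormal u) (l : List (Fin d)) :
    LocallyNormal fun j => iterPd l (u j) := fun l' R => by
  obtain ⟨a, ha, hb⟩ := h (l' ++ l) R
  exact ⟨a, ha, fun j x hx => by rw [← iterPd_append]; exact hb j x hx⟩

theorem LocallyNormal.summable {u : ℕ → Rd d → ℂ} (h : LocallyNormal u) (x : Rd d) :
    Summable fun j => u j x := by
  obtain ⟨a, ha, hb⟩ := h [] ‖x‖
  exact Summable.of_norm_bounded ha fun j => hb j x le_rfl

/-- Summable bounds for the first partial derivatives on a ball around the origin containing `x`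
allow termwise differentiation there. -/
theorem LocallyNormal.hasFDerivAt {u : ℕ → Rd d → ℂ} (hu : ∀ j, ContDiff ℝ ∞ (u j))
    (h : LocallyNormal u) (x : Rd d) : (Summable fun j => fderiv ℝ (u j) x) ∧
      HasFDerivAt (fun y => ∑' j, u j y) (∑' j, fderiv ℝ (u j) x) x := by
  choose a ha hb using fun i : Fin d => h [i] (‖x‖ + 1)
  have hsum : Summable fun j => ∑ i, a i j := summable_sum fun i _ => ha i
  have hbd : ∀ j, ∀ y ∈ Metric.ball (0 : Rd d) (‖x‖ + 1), ‖fderiv ℝ (u j) y‖ ≤ ∑ i, a i j := by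
    intro j y hy
    refine (norm_fderiv_le_sum (u j) y).trans (Finset.sum_le_sum fun i _ => ?_)
    exact hb i j y (by simpa using (mem_ball_zero_iff.1 hy).le)
  have hx : x ∈ Metric.ball (0 : Rd d) (‖x‖ + 1) := by simp
  refine ⟨Summable.of_norm_bounded hsum fun j => hbd j x hx, ?_⟩
  exact hasFDerivAt_tsum_of_isPreconnected hsum Metric.isOpen_ball
    (convex_ball _ _).isPreconnected
    (fun j y _ => ((hu j).differentiable (by simp) y).hasFDerivAt) hbd hx (h.summable x) hx

theorem LocallyNormal.pderiv_tsum {u : ℕ → Rd d → ℂ} (hu : ∀ j, ContDiff ℝ ∞ (u j))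
    (h : LocallyNormal u) (i : Fin d) :
    pderiv i (fun y => ∑' j, u j y) = fun y => ∑' j, pderiv i (u j) y := by
  funext x
  obtain ⟨h1, h2⟩ := h.hasFDerivAt hu x
  unfold pderiv
  rw [h2.fderiv]
  exact (ContinuousLinearMap.apply ℝ ℂ (EuclideanSpace.single i (1 : ℝ) : Rd d)).map_tsum h1

theorem LocallyNormal.iterPd_tsum {u : ℕ → Rd d → ℂ} (hu : ∀ j, ContDiff ℝ ∞ (u j))
    (h : LocallyNormal u) (l : List (Fin d)) :
    Mollif.iterPd l (fun y => ∑' j, u j y) = fun y => ∑' j, Mollif.iterPd l (u j) y := by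
  induction l with
  | nil => rfl
  | cons i l ih =>
    rw [iterPd_cons, ih, (h.iterPd l).pderiv_tsum fun j => contDiff_iterPd (hu j) l]
    rfl

theorem LocallyNormal.contDiff_tsum {u : ℕ → Rd d → ℂ} (hu : ∀ j, ContDiff ℝ ∞ (u j))
    (h : LocallyNormal u) : ContDiff ℝ ∞ (fun y => ∑' j, u j y) := by
  rw [contDiff_infty]
  intro n
  induction n generalizing u with
  | zero =>
    exact contDiff_zero.2
      (continuous_iff_continuousAt.2 fun x => (h.hasFDerivAt hu x).2.continuousAt)
  | succ n ih =>
    refine contDiff_of_pderiv (fun x => (h.hasFDerivAt hu x).2.differentiableAt) fun i => ?_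
    rw [h.pderiv_tsum hu]
    exact ih (fun j => contDiff_pderiv (hu j) i) (h.iterPd [i])

theorem LocallyNormal.tendsto_integral {u : ℕ → Rd d → ℂ} (hu : ∀ j, ContDiff ℝ ∞ (u j))
    (h : LocallyNormal u) (θ : Test d) :
    Filter.Tendsto (fun J => ∫ x, (∑ j ∈ Finset.range J, u j x) * θ x) Filter.atTop
      (nhds (∫ x, (∑' j, u j x) * θ x)) := by
  obtain ⟨R, -, hR⟩ := exists_tsupport_subset_closedBall θ
  obtain ⟨a, ha, hb⟩ := h [] R
  have hθi : Integrable θ := θ.continuous.integrable_of_hasCompactSupport θ.hasCompactSupport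
  refine tendsto_integral_of_dominated_convergence (fun x => (∑' j, |a j|) * ‖θ x‖) (fun J => ?_)
    (hθi.norm.const_mul _) (fun J => Filter.Eventually.of_forall fun x => ?_)
    (Filter.Eventually.of_forall fun x => ?_)
  · exact ((continuous_finsetSum _ fun j _ => (hu j).continuous).mul
      θ.continuous).aestronglyMeasurable
  · rw [norm_mul]
    by_cases hx : θ x = 0
    · simp [hx]
    · refine mul_le_mul_of_nonneg_right ?_ (norm_nonneg _)
      have hxR : ‖x‖ ≤ R := by simpa using hR (subset_tsupport _ hx)
      refine (norm_sum_le _ _).trans ((Finset.sum_le_sum fun j _ =>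
        (hb j x hxR).trans (le_abs_self _)).trans ?_)
      exact ha.abs.sum_le_tsum _ fun j _ => abs_nonneg _
  · exact ((h.summable x).hasSum.tendsto_sum_nat).mul_const _

end Series

/-! ### Summability in weighted `E_sl` norms -/

section SeriesNorm

variable {E : Type*} [NormedAddCommGroup E] [NormedSpace ℂ E]
  {ι : E →ₗ[ℂ] (Rd d →ₘ[volume] ℂ)} {w : ℕ → Rd d → ℝ} [CompleteSpace E]

/-- Weighted semi-local norms of derivatives control a smooth function on bounded sets. -/
theorem exists_enorm_le_sum_eNormSl (hE : IsSolidTIBF ι) (hw : IsWeightSystem w) (m : ℕ) {R : ℝ}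
    (hR : 0 < R) : ∃ C : ℝ≥0, ∀ u : Rd d → ℂ, ContDiff ℝ ∞ u → ∀ x, ‖x‖ ≤ R →
      ‖u x‖ₑ ≤ C * ∑ l ∈ listsLE d (d + 1), eNormSl ι (wdiv (w m) (iterPd l u)) := by
  obtain ⟨C, hC, hS⟩ := exists_norm_le_setIntegral_jet d
  obtain ⟨C₁, hC₁, hjet⟩ := exists_jet_le_sum_iterPd d (d + 1)
  set B := Metric.closedBall (0 : Rd d) (R + 1) with hB
  have hBm : MeasurableSet B := Metric.isClosed_closedBall.measurableSet
  have hBc : IsCompact B := isCompact_closedBall _ _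
  -- On a bounded set the weight costs only a constant. The inclusion `E ⊆ L^1_loc` and the local
  -- Sobolev inequality do the rest.
  obtain ⟨M, hM⟩ := hw.locallyBounded m B hBc
  obtain ⟨D, hD⟩ := exists_lintegral_le_eNormE hE hBc
  refine ⟨C.toNNReal * (C₁.toNNReal * (M.toNNReal * (D + 1))), fun u hu x hx => ?_⟩
  have hsub : Metric.closedBall x 1 ⊆ B := by
    intro y hy
    rw [hB, mem_closedBall_zero_iff]
    have h1 : ‖y - x‖ ≤ 1 := by simpa [dist_eq_norm] using hy
    have h2 := norm_add_le (y - x) x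
    rw [sub_add_cancel] at h2
    linarith
  have h1 : ∀ l, ∫⁻ y in B, ‖iterPd l u y‖ₑ ≤
      M.toNNReal * ((D + 1) * eNormSl ι (wdiv (w m) (iterPd l u))) := by
    intro l
    have h2 : ∀ y ∈ B, ‖iterPd l u y‖ₑ ≤
      M.toNNReal * ‖B.indicator (wdiv (w m) (iterPd l u)) y‖ₑ := by
      intro y hy
      rw [Set.indicator_of_mem hy, ← ofReal_norm, ← ofReal_norm, norm_wdiv (hw.pos m y)]
      change _ ≤ ENNReal.ofReal M * _
      have hM0 : 0 ≤ M := (hw.pos m y).le.trans (hM y hy)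
      rw [← ENNReal.ofReal_mul hM0]
      refine ENNReal.ofReal_le_ofReal ?_
      rw [← mul_assoc, ← div_eq_mul_inv]
      exact le_mul_of_one_le_left (norm_nonneg _) ((one_le_div (hw.pos m y)).2 (hM y hy))
    refine (setLIntegral_mono' hBm h2).trans ?_
    rw [lintegral_const_mul' _ _ ENNReal.coe_ne_top]
    gcongr
    refine (hD _).trans ?_
    gcongr
    exact eNormE_indicator_le_eNormSl _ (by positivity)
  have hji : IntegrableOn (jet (d + 1) u) B :=
    (continuous_jet _ hu).continuousOn.integrableOn_compact hBc
  have hjeq : ENNReal.ofReal (∫ y in B, jet (d + 1) u y) =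
    ∫⁻ y in B, ENNReal.ofReal (jet (d + 1) u y) :=
    ofReal_integral_eq_lintegral_ofReal hji (Filter.Eventually.of_forall fun y => jet_nonneg _ _ _)
  have h3 : ‖u x‖ ≤ C * ∫ y in B, jet (d + 1) u y := by
    refine (hS u hu x).trans (mul_le_mul_of_nonneg_left ?_ hC)
    exact setIntegral_mono_set hji (Filter.Eventually.of_forall fun y => jet_nonneg _ _ _)
      (Filter.Eventually.of_forall hsub)
  calc ‖u x‖ₑ = ENNReal.ofReal ‖u x‖ := (ofReal_norm _).symm
    _ ≤ ENNReal.ofReal C * ∫⁻ y in B, ENNReal.ofReal (jet (d + 1) u y) := by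
        rw [← hjeq, ← ENNReal.ofReal_mul hC]
        exact ENNReal.ofReal_le_ofReal h3
    _ ≤ ENNReal.ofReal C * (ENNReal.ofReal C₁ *
      ∑ l ∈ listsLE d (d + 1), ∫⁻ y in B, ‖iterPd l u y‖ₑ) := by
        gcongr
        rw [← lintegral_finsetSum' _ fun l _ =>
          (contDiff_iterPd hu l).continuous.aestronglyMeasurable.enorm,
          ← lintegral_const_mul' _ _ ENNReal.ofReal_ne_top]
        refine lintegral_mono fun y => ?_
        refine (ENNReal.ofReal_le_ofReal (hjet u hu y)).trans ?_
        rw [ENNReal.ofReal_mul hC₁, ENNReal.ofReal_sum_of_nonneg fun _ _ => norm_nonneg _]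
        simp only [ofReal_norm]
        exact le_rfl
    _ ≤ ENNReal.ofReal C * (ENNReal.ofReal C₁ * ∑ l ∈ listsLE d (d + 1),
          M.toNNReal * ((D + 1) * eNormSl ι (wdiv (w m) (iterPd l u)))) := by
        gcongr with l hl
        exact h1 l
    _ = _ := by
        rw [← Finset.mul_sum, ← Finset.mul_sum]
        push_cast
        change _ = ENNReal.ofReal C * (ENNReal.ofReal C₁ * (_ * (_ + 1))) * _
        ring

/-- Bounding suprema costs up to `d + 1` further derivatives, each summable for its own weight
index. Finitely many are involved, so the largest index serves for all. -/
theorem locallyNormal_of_tsum_eNormSl (hE : IsSolidTIBF ι) (hw : IsWeightSystem w)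
    {u : ℕ → Rd d → ℂ} (hu : ∀ j, ContDiff ℝ ∞ (u j))
    (h : ∀ l : List (Fin d), ∃ n, ∑' j, eNormSl ι (wdiv (w n) (iterPd l (u j))) < ⊤) :
    LocallyNormal u := by
  intro l R
  choose n hn using fun l' : List (Fin d) => h (l' ++ l)
  set m := (listsLE d (d + 1)).sup n with hm
  obtain ⟨C, hC⟩ := exists_enorm_le_sum_eNormSl hE hw m (R := max R 1) (by positivity)
  set b : ℕ → ℝ≥0∞ := fun j =>
    C * ∑ l' ∈ listsLE d (d + 1), eNormSl ι (wdiv (w m) (iterPd l' (iterPd l (u j)))) with hb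
  have hbt : ∑' j, b j < ⊤ := by
    rw [hb, ENNReal.tsum_mul_left]
    refine ENNReal.mul_lt_top ENNReal.coe_lt_top ?_
    rw [Summable.tsum_finsetSum fun _ _ => ENNReal.summable]
    refine ENNReal.sum_lt_top.2 fun l' hl' => lt_of_le_of_lt ?_ (hn l')
    refine ENNReal.tsum_le_tsum fun j => ?_
    rw [← iterPd_append]
    exact eNormSl_wdiv_anti hE hw (Finset.le_sup hl')
      (contDiff_iterPd (hu j) _).continuous.aestronglyMeasurable
  refine ⟨fun j => (b j).toReal, ENNReal.summable_toReal hbt.ne, fun j x hx => ?_⟩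
  have h1 := hC _ (contDiff_iterPd (hu j) l) x (hx.trans (le_max_left _ _))
  rw [← toReal_enorm]
  exact ENNReal.toReal_mono (ENNReal.ne_top_of_tsum_ne_top hbt.ne j) h1

theorem isSlSmooth_tsum (hE : IsSolidTIBF ι) (hw : IsWeightSystem w)
    {u : ℕ → Rd d → ℂ} (hu : ∀ j, ContDiff ℝ ∞ (u j))
    (h : ∀ l : List (Fin d), ∃ n, ∑' j, eNormSl ι (wdiv (w n) (iterPd l (u j))) < ⊤) :
    IsSlSmooth ι w (fun x => ∑' j, u j x) := by
  have hloc := locallyNormal_of_tsum_eNormSl hE hw hu h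
  have hs := hloc.contDiff_tsum hu
  refine ⟨hs, fun l => ?_⟩
  obtain ⟨n, hn⟩ := h l
  refine ⟨n, lt_of_le_of_lt (eNormSl_le_tsum hE (fun j => aestronglyMeasurable_wdiv hw n
    (contDiff_iterPd (hu j) l).continuous.aestronglyMeasurable) (aestronglyMeasurable_wdiv hw n
    (contDiff_iterPd hs l).continuous.aestronglyMeasurable)
    (Filter.Eventually.of_forall fun x => ?_)) hn⟩
  rw [enorm_wdiv (hw.pos n x), hloc.iterPd_tsum hu]
  simp only [enorm_wdiv (hw.pos n x)]
  rw [ENNReal.tsum_mul_left]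
  gcongr
  exact enorm_tsum_le_tsum_enorm

end SeriesNorm

/-! ### Approximate identities -/

section Approximation

theorem testRefl_dil (φ : Test d) (j : ℕ) : testRefl (dil φ j) = dil (testRefl φ) j := by
  ext y
  rw [testRefl_apply]
  simp only [coe_dil, smul_neg, testRefl_apply]

/-- The convolutions with the dilates of a test function of integral one converge to `f`. -/
theorem tendsto_integral_conv_dil (f : Distrib d) {φ : Test d} (hφ : ∫ x, φ x = 1) (θ : Test d) :
    Filter.Tendsto (fun j => ∫ x, conv f (dil φ j) x * θ x) Filter.atTop (nhds (f θ)) := by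
  obtain ⟨r, hr0, hr⟩ := exists_tsupport_subset_closedBall θ
  obtain ⟨ρ, hρ0, hρ⟩ := exists_tsupport_subset_closedBall (testRefl φ)
  have hφ' : ∫ x, testRefl φ x = 1 := by
    simp only [testRefl_apply]
    rw [integral_neg_eq_self (fun x => φ x) volume, hφ]
  -- By duality the mollification acts on `θ`. The supports of the mollified functions stay in a
  -- fixed ball, and each derivative converges uniformly at rate `2 ^ (-j)` because it is Lipschitz.
  simp only [integral_conv_mul f θ.continuous θ.hasCompactSupport, testRefl_dil]
  have hs1 : ∀ j, ∀ y, dil (testRefl φ) j y ≠ 0 → ‖y‖ ≤ ρ := by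
    intro j y hy
    have h1 : testRefl φ ((2 : ℝ) ^ j • y) ≠ 0 := fun h => hy (by simp only [coe_dil, h, mul_zero])
    have h2 := norm_smul_le_of_mem_tsupport hρ (inv_two_pow_nonneg j) (inv_two_pow_le_one j) h1
    rwa [inv_smul_smul₀ (pow_ne_zero j two_ne_zero)] at h2
  refine tendsto_apply_of_iterPd f (isCompact_closedBall (0 : Rd d) (r + ρ)) _ θ
    (Filter.Eventually.of_forall fun j => ?_)
    (hr.trans (Metric.closedBall_subset_closedBall (by linarith))) fun l ε hε => ?_
  · refine closure_minimal ((support_convolution_subset _).trans ?_) Metric.isClosed_closedBall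
    rintro y ⟨a, ha, b, hb, rfl⟩
    rw [mem_closedBall_zero_iff]
    refine (norm_add_le _ _).trans (add_le_add ?_ (hs1 j b hb))
    simpa using hr (subset_tsupport _ ha)
  · obtain ⟨C, hC⟩ := exists_lipschitz_iterPd θ l
    set I := ∫ y, ‖testRefl φ y‖ with hI
    have hlim : Filter.Tendsto (fun j : ℕ => (C * ρ * I) * ((2 : ℝ)⁻¹) ^ j)
      Filter.atTop (nhds 0) := by
      have := (tendsto_pow_atTop_nhds_zero_of_lt_one (r := (2 : ℝ)⁻¹) (by norm_num)
        (by norm_num)).const_mul (C * ρ * I)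
      rwa [mul_zero] at this
    filter_upwards [hlim.eventually (ge_mem_nhds hε)] with j hj x
    refine le_trans ?_ hj
    rw [coe_testConv, iterPd_convolution_left (test_contDiff θ), convolution_dil]
    have e1 : iterPd l θ x = ∫ y, iterPd l θ x * testRefl φ y := by
      rw [integral_const_mul, hφ', mul_one]
    have hcont := (contDiff_iterPd (test_contDiff θ) l).continuous
    have i1 : Integrable fun y => iterPd l θ (x - ((2 : ℝ) ^ j)⁻¹ • y) * testRefl φ y :=
      ((hcont.comp (continuous_const.sub (continuous_const_smul _))).mul
        (testRefl φ).continuous).integrable_of_hasCompactSupport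
        (HasCompactSupport.mul_left (testRefl φ).hasCompactSupport)
    have i0 : Integrable (testRefl φ) :=
      (testRefl φ).continuous.integrable_of_hasCompactSupport (testRefl φ).hasCompactSupport
    rw [e1, ← integral_sub i1 (i0.const_mul _)]
    have e2 : C * ρ * I * (2 : ℝ)⁻¹ ^ j = ∫ y, (C * ρ * (2 : ℝ)⁻¹ ^ j) * ‖testRefl φ y‖ := by
      rw [integral_const_mul]; ring
    rw [e2]
    refine norm_integral_le_of_norm_le (i0.norm.const_mul _)
      (Filter.Eventually.of_forall fun y => ?_)
    rw [← sub_mul, norm_mul]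
    by_cases hy : testRefl φ y = 0
    · simp [hy]
    · refine mul_le_mul_of_nonneg_right ?_ (norm_nonneg _)
      refine (hC.norm_sub_le _ _).trans ?_
      rw [sub_sub_cancel_left, norm_neg, norm_smul, Real.norm_of_nonneg (inv_two_pow_nonneg j),
        inv_pow, mul_assoc, mul_comm ρ]
      have : ‖y‖ ≤ ρ := by simpa using hρ (subset_tsupport _ hy)
      gcongr

end Approximation

/-! ### Scaling the identities of the MDFP -/

section ScaledFactorization

theorem pderiv_dil (φ : Test d) (j : ℕ) (i : Fin d) :
    pderiv i (dil φ j) = (2 : ℂ) ^ j • ⇑(dil (testPd [i] φ) j) := by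
  have h : ∀ x, fderiv ℝ (fun x => φ ((2 : ℝ) ^ j • x)) x =
    (2 : ℝ) ^ j • fderiv ℝ φ ((2 : ℝ) ^ j • x) :=
    fun x => fderiv_comp_smul (𝕜 := ℝ) (f := φ) ((2 : ℝ) ^ j) (x := x)
  have hs : ContDiff ℝ ∞ fun x => φ ((2 : ℝ) ^ j • x) :=
    (test_contDiff φ).comp (contDiff_const_smul _)
  rw [coe_dil]
  change pderiv i ((2 : ℂ) ^ (j * d) • fun x => φ ((2 : ℝ) ^ j • x)) = _
  rw [pderiv_const_smul hs]
  funext x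
  rw [Pi.smul_apply, Pi.smul_apply, coe_dil, coe_testPd, iterPd_cons, iterPd_nil]
  unfold pderiv
  rw [h, smul_apply, smul_eq_mul, smul_eq_mul, Complex.real_smul]
  push_cast
  ring

theorem testPd_dil (φ : Test d) (j : ℕ) (l : List (Fin d)) :
    testPd l (dil φ j) = (2 : ℂ) ^ (j * l.length) • dil (testPd l φ) j := by
  induction l with
  | nil => ext x; simp
  | cons i l ih =>
    ext x
    have h1 : iterPd l (dil φ j) = ⇑((2 : ℂ) ^ (j * l.length) • dil (testPd l φ) j) := by
      rw [← ih]; rfl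
    rw [coe_testPd, iterPd_cons, h1, Test.coe_smul, pderiv_const_smul (test_contDiff _), pderiv_dil,
      Test.coe_smul, Pi.smul_apply, Pi.smul_apply, Pi.smul_apply, smul_smul, ← pow_add,
      List.length_cons, mul_add, mul_one]
    rfl

theorem dil_testConv (χ ψ : Test d) (j : ℕ) :
    dil (testConv χ χ.continuous χ.hasCompactSupport ψ) j =
      testConv (dil χ j) (dil χ j).continuous (dil χ j).hasCompactSupport (dil ψ j) := by
  ext x
  rw [coe_testConv, convolution_comm', convolution_dil, coe_dil]
  simp only [coe_testConv, convolution_apply, coe_dil]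
  rw [← integral_const_mul]
  refine integral_congr_ae (Filter.Eventually.of_forall fun z => ?_)
  simp only [smul_sub, smul_inv_smul₀ (pow_ne_zero j (two_ne_zero (α := ℝ)))]
  ring

/-- Normalised dilation commutes with convolution, so a factorization through the `χ ℓ` holds at
every scale. Through it, information on `f * χ^ℓ_j` alone controls `f * η_j`. -/
theorem conv_dil_eq_sum (f : Distrib d) {χ ψ : Fin 2 → Test d} {η : Test d}
    (h : ∀ x, η x = ∑ ℓ, convolution (χ ℓ) (ψ ℓ) (ContinuousLinearMap.mul ℂ ℂ) volume x) (j : ℕ) :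
    conv f (dil η j) = ∑ ℓ, convolution (conv f (dil (χ ℓ) j)) (dil (ψ ℓ) j)
      (ContinuousLinearMap.mul ℂ ℂ) volume := by
  have h1 : dil η j = ∑ ℓ, testConv (dil (χ ℓ) j) (dil (χ ℓ) j).continuous
      (dil (χ ℓ) j).hasCompactSupport (dil (ψ ℓ) j) := by
    simp only [← dil_testConv]
    rw [Fin.sum_univ_two]
    ext x
    rw [Test.coe_add, Pi.add_apply]
    simp only [coe_dil, h, Fin.sum_univ_two, coe_testConv]
    ring
  rw [h1, conv_sum]
  refine Finset.sum_congr rfl fun ℓ _ => ?_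
  funext x
  rw [conv_testConv, convolution_comm', convolution_apply]
  simp only [mul_comm]

theorem laplacian_eq_sum_iterPd (ψ : Test d) (x : Rd d) :
    Laplacian.laplacian (ψ : Rd d → ℂ) x = ∑ i : Fin d, iterPd [i, i] ψ x := by
  rw [InnerProductSpace.laplacian_eq_iteratedFDeriv_orthonormalBasis (ψ : Rd d → ℂ)
    (EuclideanSpace.basisFun (Fin d) ℝ)]
  refine Finset.sum_congr rfl fun i _ => ?_
  rw [iteratedFDeriv_two_apply]
  simp only [Matrix.cons_val_zero, Matrix.cons_val_one, EuclideanSpace.basisFun_apply]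
  rw [iterPd_cons, iterPd_cons, iterPd_nil]
  unfold pderiv
  rw [fderiv_clm_apply ((((test_contDiff ψ).fderiv_right (m := ∞) (by simp)).differentiable
    (by simp)) x) (differentiableAt_const _)]
  simp

/-- Dilating the two-scale identity gives `φ_{j+1} - φ_j = (Δψ)_j = 4^{-j} Δ(ψ_j)`, and derivatives
pass through the convolution with `f`. -/
theorem conv_dil_succ_sub (f : Distrib d) {φ ψ : Test d}
    (h : ∀ x : Rd d, (2 : ℂ) ^ d * φ ((2 : ℝ) • x) - φ x = Laplacian.laplacian (ψ : Rd d → ℂ) x)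
    (j : ℕ) : conv f (dil φ (j + 1)) - conv f (dil φ j) =
      ((4 : ℂ) ^ j)⁻¹ • ∑ i : Fin d, iterPd [i, i] (conv f (dil ψ j)) := by
  have h1 : dil φ (j + 1) - dil φ j = ((4 : ℂ) ^ j)⁻¹ • ∑ i : Fin d, testPd [i, i] (dil ψ j) := by
    have h2 : ((4 : ℂ) ^ j)⁻¹ • ∑ i : Fin d, testPd [i, i] (dil ψ j) =
        ∑ i : Fin d, dil (testPd [i, i] ψ) j := by
      rw [Finset.smul_sum]
      refine Finset.sum_congr rfl fun i _ => ?_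
      rw [testPd_dil, smul_smul]
      have : ((4 : ℂ) ^ j)⁻¹ * 2 ^ (j * [i, i].length) = 1 := by
        rw [show [i, i].length = 2 from rfl, mul_comm j, pow_mul]
        norm_num
      rw [this, one_smul]
    rw [h2]
    have h3 : ∀ s : Finset (Fin d), ⇑(∑ i ∈ s, dil (testPd [i, i] ψ) j) =
        ∑ i ∈ s, ⇑(dil (testPd [i, i] ψ) j) := by
      intro s
      induction s using Finset.induction_on with
      | empty => rfl
      | insert a s ha ih => rw [Finset.sum_insert ha, Finset.sum_insert ha, Test.coe_add, ih]
    ext x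
    rw [h3, Finset.sum_apply, Test.coe_sub, Pi.sub_apply]
    simp only [coe_dil, coe_testPd]
    rw [← Finset.mul_sum, ← laplacian_eq_sum_iterPd, ← h, smul_smul, ← pow_succ']
    ring
  rw [← conv_sub, h1, conv_smul, conv_sum]
  simp only [iterPd_conv]

end ScaledFactorization

/-! ### Reconstruction of `f` from exponential growth: (iv) gives a smooth function -/

section Reconstruction

variable {E : Type*} [NormedAddCommGroup E] [NormedSpace ℂ E]
  {ι : E →ₗ[ℂ] (Rd d →ₘ[volume] ℂ)} {w : ℕ → Rd d → ℝ} [CompleteSpace E]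

/-- The weighted semi-local norms of the derivatives of the functions `g j ℓ` grow at most like
`2 ^ (r * j)`. -/
def ExpGrowth (ι : E →ₗ[ℂ] (Rd d →ₘ[volume] ℂ)) (w : ℕ → Rd d → ℝ) (r : ℝ)
    (g : ℕ → Fin 2 → Rd d → ℂ) : Prop :=
  ∀ l : List (Fin d), ∃ (m : ℕ) (A : ℝ≥0∞), A < ⊤ ∧ ∀ j ℓ,
    eNormSl ι (wdiv (w m) (iterPd l (g j ℓ))) ≤ ENNReal.ofReal (2 ^ (r * j)) * A

/-- Local suprema of derivatives inherit the growth rate `2 ^ (r * j)`, with weight index and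
constant uniform in the scale. -/
theorem ExpGrowth.exists_avgJet_le (hE : IsSolidTIBF ι) (hw : IsWeightSystem w)
    (hwM : WeakModerate w) {r : ℝ} {g : ℕ → Fin 2 → Rd d → ℂ} (hg : ∀ j ℓ, ContDiff ℝ ∞ (g j ℓ))
    (h : ExpGrowth ι w r g) {θ : Rd d → ℝ} (hθ : Continuous θ) (hθc : HasCompactSupport θ)
    (h0 : ∀ x, 0 ≤ θ x) (P : ℕ) : ∃ (n : ℕ) (A : ℝ≥0∞), A < ⊤ ∧ ∀ j ℓ,
      eNormSl ι (wdiv (w n) fun x => ((avgJet P θ (g j ℓ) x : ℝ) : ℂ)) ≤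
        ENNReal.ofReal (2 ^ (r * j)) * A := by
  choose m A hA hm using h
  obtain ⟨n, -, hn⟩ := exists_eNormSl_wdiv_avgJet_le hE hw hwM hθ hθc h0 ((listsLE d P).sup m)
  obtain ⟨C, hC⟩ := hn P
  refine ⟨n, C * ∑ l ∈ listsLE d P, A l,
    ENNReal.mul_lt_top ENNReal.coe_lt_top (ENNReal.sum_lt_top.2 fun l _ => hA l), fun j ℓ => ?_⟩
  rw [mul_left_comm]
  refine hC _ (hg j ℓ) _ fun l hl => ?_
  refine (eNormSl_wdiv_anti hE hw (Finset.le_sup (f := m) hl)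
    (contDiff_iterPd (hg j ℓ) l).continuous.aestronglyMeasurable).trans ((hm l j ℓ).trans ?_)
  gcongr
  exact Finset.single_le_sum (f := A) (fun _ _ => zero_le) hl

/-- The pieces of the telescoping decomposition of a distribution along the approximate identity
generated by `φ`. -/
noncomputable def telescope (f : Distrib d) (φ : Test d) : ℕ → Rd d → ℂ
  | 0 => conv f (dil φ 0)
  | j + 1 => conv f (dil φ (j + 1)) - conv f (dil φ j)

theorem contDiff_telescope (f : Distrib d) (φ : Test d) (j : ℕ) :
    ContDiff ℝ ∞ (telescope f φ j) := by
  cases j with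
  | zero => exact contDiff_conv f _
  | succ j => exact (contDiff_conv f _).sub (contDiff_conv f _)

theorem sum_telescope (f : Distrib d) (φ : Test d) (J : ℕ) :
    ∑ j ∈ Finset.range (J + 1), telescope f φ j = conv f (dil φ J) := by
  induction J with
  | zero => simp [telescope]
  | succ J ih => rw [Finset.sum_range_succ, ih, telescope, add_sub_cancel]

theorem norm_iterPd_telescope_zero_le (f : Distrib d) {χ φ : Fin 2 → Test d}
    (hφ : ∀ x, φ 0 x = ∑ ℓ, convolution (χ ℓ) (φ ℓ) (ContinuousLinearMap.mul ℂ ℂ) volume x)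
    {ρ : ℝ} (hρ : ∀ ℓ, tsupport (φ ℓ) ⊆ Metric.closedBall 0 ρ) (l : List (Fin d)) {x : Rd d}
    {S : Fin 2 → ℝ}
    (hS : ∀ ℓ z, ‖z‖ ≤ ρ → ‖iterPd l (conv f (dil (χ ℓ) 0)) (x - z)‖ ≤ S ℓ) :
    ‖iterPd l (telescope f (φ 0) 0) x‖ ≤ ∑ ℓ, S ℓ * ∫ y, ‖φ ℓ y‖ := by
  rw [telescope, conv_dil_eq_sum f hφ, iterPd_sum _ fun ℓ => contDiff_convolution_test
    (contDiff_conv f _).continuous.locallyIntegrable _, Finset.sum_apply]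
  refine norm_sum_le_of_le _ fun ℓ _ => ?_
  rw [iterPd_convolution_left (contDiff_conv f _), convolution_dil]
  exact norm_integral_comp_smul_le (hρ ℓ) (inv_two_pow_nonneg 0) (inv_two_pow_le_one 0) (hS ℓ)

/-- All derivatives, including the Laplacian, are put on `f * χ^ℓ_j`, leaving a convolution with the
dilate of `ψ ℓ`. Its vanishing moments yield the factor `2 ^ (-j (n + 1))`. -/
theorem norm_iterPd_telescope_succ_le (f : Distrib d) {χ φ ψ : Fin 2 → Test d}
    (hφψ : ∀ x : Rd d, (2 : ℂ) ^ d * φ 0 ((2 : ℝ) • x) - φ 0 x =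
      Laplacian.laplacian (ψ 0 : Rd d → ℂ) x)
    (hψ : ∀ x, ψ 0 x = ∑ ℓ, convolution (χ ℓ) (ψ ℓ) (ContinuousLinearMap.mul ℂ ℂ) volume x)
    {n : ℕ} (hm : ∀ ℓ, VanishingMoments (n + 1) (ψ ℓ))
    {ρ : ℝ} (hρ : ∀ ℓ, tsupport (ψ ℓ) ⊆ Metric.closedBall 0 ρ) (l : List (Fin d)) (j : ℕ) {x : Rd d}
    {S : Fin 2 → ℝ} (hS : ∀ ℓ i z, ‖z‖ ≤ ρ → ‖iteratedFDeriv ℝ (n + 1)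
      (iterPd (l ++ [i, i]) (conv f (dil (χ ℓ) j))) (x - z)‖ ≤ S ℓ) :
    ‖iterPd l (telescope f (φ 0) (j + 1)) x‖ ≤ (((2 : ℝ) ^ j)⁻¹) ^ (n + 1) *
      ∑ ℓ, S ℓ * (d * ∫ y, ‖y‖ ^ (n + 1) * ‖ψ ℓ y‖) := by
  have hc : ∀ ℓ, ContDiff ℝ ∞ (convolution (conv f (dil (χ ℓ) j)) (dil (ψ ℓ) j)
      (ContinuousLinearMap.mul ℂ ℂ) volume) := fun ℓ =>
    contDiff_convolution_test (contDiff_conv f _).continuous.locallyIntegrable _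
  have hs : ContDiff ℝ ∞ (∑ i : Fin d, iterPd [i, i] (conv f (dil (ψ 0) j))) := by
    rw [Finset.sum_fn]
    exact ContDiff.sum fun i _ => contDiff_iterPd (contDiff_conv f _) _
  rw [telescope, conv_dil_succ_sub f hφψ, iterPd_const_smul hs, Pi.smul_apply,
    iterPd_sum _ fun i => contDiff_iterPd (contDiff_conv f _) _, Finset.sum_apply, norm_smul]
  -- The gain `4 ^ (-j)` is not needed, since the number of moments is at our disposal.
  have h4 : ‖((4 : ℂ) ^ j)⁻¹‖ ≤ 1 := by
    rw [norm_inv, norm_pow]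
    exact inv_le_one_of_one_le₀ (one_le_pow₀ (by norm_num))
  refine (mul_le_of_le_one_left (norm_nonneg _) h4).trans ?_
  have hi : ∀ i : Fin d, ‖iterPd l (iterPd [i, i] (conv f (dil (ψ 0) j))) x‖ ≤
      ∑ ℓ, S ℓ * (((2 : ℝ) ^ j)⁻¹) ^ (n + 1) * ∫ y, ‖y‖ ^ (n + 1) * ‖ψ ℓ y‖ := by
    intro i
    rw [← iterPd_append, conv_dil_eq_sum f hψ, iterPd_sum _ hc, Finset.sum_apply]
    refine norm_sum_le_of_le _ fun ℓ _ => ?_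
    rw [iterPd_convolution_left (contDiff_conv f _), convolution_dil]
    exact norm_integral_comp_smul_le_of_vanishingMoments (contDiff_iterPd (contDiff_conv f _) _)
      (hm ℓ) (hρ ℓ) (inv_two_pow_nonneg j) (inv_two_pow_le_one j) fun z hz => hS ℓ i z hz
  refine (norm_sum_le_of_le _ fun i _ => hi i).trans (le_of_eq ?_)
  rw [Finset.sum_const, Finset.card_univ, Fintype.card_fin, nsmul_eq_mul, Finset.mul_sum,
    Finset.mul_sum]
  refine Finset.sum_congr rfl fun ℓ _ => ?_
  ring

theorem eNormSl_wdiv_le_sum (hE : IsSolidTIBF ι) (hw : IsWeightSystem w) (n : ℕ) {u : Rd d → ℂ}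
    (hu : Continuous u) {v : Fin 2 → Rd d → ℝ} (hv : ∀ ℓ, Continuous (v ℓ)) (hv0 : ∀ ℓ x, 0 ≤ v ℓ x)
    {c : Fin 2 → ℝ≥0} (h : ∀ x, ‖u x‖ ≤ ∑ ℓ, c ℓ * v ℓ x) :
    eNormSl ι (wdiv (w n) u) ≤ ∑ ℓ, c ℓ * eNormSl ι (wdiv (w n) fun x => ((v ℓ x : ℝ) : ℂ)) := by
  have hm : ∀ ℓ, AEStronglyMeasurable (wdiv (w n) fun x => ((c ℓ * v ℓ x : ℝ) : ℂ)) volume :=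
    fun ℓ => aestronglyMeasurable_wdiv hw n (Complex.continuous_ofReal.comp
      (continuous_const.mul (hv ℓ))).aestronglyMeasurable
  refine (eNormSl_le_sum hE Finset.univ (g := fun ℓ => wdiv (w n) fun x => ((c ℓ * v ℓ x : ℝ) : ℂ))
    (fun ℓ _ => hm ℓ) (aestronglyMeasurable_wdiv hw n hu.aestronglyMeasurable)
    (Filter.Eventually.of_forall fun x => ?_)).trans (Finset.sum_le_sum fun ℓ _ =>
      eNormSl_le_of_le_mul hE (hm ℓ) (Filter.Eventually.of_forall fun x => ?_))
  · simp only [enorm_wdiv (hw.pos n x)]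
    rw [← Finset.mul_sum]
    gcongr
    have hp : ∀ ℓ, 0 ≤ (c ℓ : ℝ) * v ℓ x := fun ℓ => mul_nonneg (c ℓ).2 (hv0 ℓ x)
    simp only [← ofReal_norm, Complex.norm_real, Real.norm_of_nonneg (hp _)]
    rw [← ENNReal.ofReal_sum_of_nonneg fun ℓ _ => hp ℓ]
    exact ENNReal.ofReal_le_ofReal (h x)
  · rw [enorm_wdiv (hw.pos n x), enorm_wdiv (hw.pos n x), mul_left_comm]
    gcongr
    rw [← ofReal_norm, ← ofReal_norm, Complex.norm_real, Complex.norm_real, norm_mul,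
      ENNReal.ofReal_mul (norm_nonneg _), NNReal.norm_eq, ENNReal.ofReal_coe_nnreal]

/-- A distribution whose convolutions with the dilates of a pair with the moment-wise
decomposition factorization property grow at most exponentially is a smooth function with
derivatives in weighted semi-local spaces. -/
theorem exists_represents_of_expGrowth (hE : IsSolidTIBF ι) (hw : IsWeightSystem w)
    (hwM : WeakModerate w) {χ : Fin 2 → Test d} (hχ : MDFP χ) (f : Distrib d) {r : ℝ}
    (h : ExpGrowth ι w r fun j ℓ => conv f (dil (χ ℓ) j)) :
    ∃ F, IsSlSmooth ι w F ∧ Represents f F := by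
  obtain ⟨K, hK, -, hfac⟩ := hχ
  -- With `n + 1 > r` vanishing moments the increments are dominated by a geometric series of ratio
  -- `2 ^ (r - (n + 1)) < 1`.
  obtain ⟨n, hn⟩ := exists_nat_gt r
  obtain ⟨φ, ψ, hsupp, hφψ, hint, hφ, hψ⟩ := hfac (n + 1)
  obtain ⟨ρ, hρ⟩ := hK.isBounded.subset_closedBall 0
  have hρφ := fun ℓ => (hsupp ℓ).2.1.trans hρ
  have hρψ := fun ℓ => (hsupp ℓ).2.2.1.trans hρ
  obtain ⟨θ, hθs, hθc, hθ0, -, hθ1⟩ := exists_cutoff d (ρ + 1)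
  have hθ := hθs.continuous
  have hg : ∀ j ℓ, ContDiff ℝ ∞ (conv f (dil (χ ℓ) j)) := fun j ℓ => contDiff_conv f _
  obtain ⟨C₀, hC₀, hmax₀⟩ := exists_norm_iteratedFDeriv_le_avgJet hθ hθc hθ0 hθ1 0
  obtain ⟨C₁, hC₁, hmax₁⟩ := exists_norm_iteratedFDeriv_le_avgJet hθ hθc hθ0 hθ1 (n + 1)
  have hu := contDiff_telescope f (φ 0)
  have hsum : ∀ l : List (Fin d), ∃ k,
      ∑' j, eNormSl ι (wdiv (w k) (iterPd l (telescope f (φ 0) j))) < ⊤ := by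
    intro l
    -- The order counts `d + 1` derivatives for Sobolev, `n + 1` for the Taylor remainder, and those
    -- of `l` and of the Laplacian.
    set Q := (d + 1 + (n + 1)) + (l.length + 2) with hQ
    obtain ⟨k, A, hA, hk⟩ := h.exists_avgJet_le hE hw hwM hg hθ hθc hθ0 Q
    have hav : ∀ j ℓ, Continuous (avgJet Q θ (conv f (dil (χ ℓ) j))) := fun j ℓ =>
      continuous_avgJet hθ hθc Q (hg j ℓ)
    refine ⟨k, ?_⟩
    -- The initial piece `f * φ_0` is not an increment. It uses the factorization of `φ 0` and no
    -- moments.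
    rw [tsum_eq_zero_add' ENNReal.summable]
    refine ENNReal.add_lt_top.2 ⟨?_, ?_⟩
    · have h1 : ∀ x, ‖iterPd l (telescope f (φ 0) 0) x‖ ≤ ∑ ℓ, ((C₀ * ∫ y, ‖φ ℓ y‖).toNNReal : ℝ) *
          avgJet Q θ (conv f (dil (χ ℓ) 0)) x := by
        intro x
        refine (norm_iterPd_telescope_zero_le f hφ hρφ l
          (S := fun ℓ => C₀ * avgJet Q θ (conv f (dil (χ ℓ) 0)) x) fun ℓ z hz => ?_).trans
          (le_of_eq (Finset.sum_congr rfl fun ℓ _ => ?_))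
        · have h2 := hmax₀ _ (contDiff_iterPd (hg 0 ℓ) l) x z hz
          rw [norm_iteratedFDeriv_zero] at h2
          refine h2.trans (mul_le_mul_of_nonneg_left ?_ hC₀)
          have e : Q = (d + 1 + 0) + (l.length + (n + 1 + 2)) := by omega
          rw [e]
          exact avgJet_iterPd_le hθ hθc hθ0 _ (by omega) (hg 0 ℓ) x
        · rw [Real.coe_toNNReal _ (mul_nonneg hC₀ (integral_nonneg fun _ => norm_nonneg _))]
          ring
      refine (eNormSl_wdiv_le_sum hE hw k (contDiff_iterPd (hu 0) l).continuous (hav 0)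
        (fun ℓ x => avgJet_nonneg hθ0 _ _ _) h1).trans_lt (ENNReal.sum_lt_top.2 fun ℓ _ => ?_)
      refine ENNReal.mul_lt_top ENNReal.coe_lt_top ((hk 0 ℓ).trans_lt ?_)
      exact ENNReal.mul_lt_top ENNReal.ofReal_lt_top hA
    · set c : Fin 2 → ℝ≥0 := fun ℓ => (C₁ * (d * ∫ y, ‖y‖ ^ (n + 1) * ‖ψ ℓ y‖)).toNNReal with hc
      have hc0 : ∀ ℓ, (c ℓ : ℝ) = C₁ * (d * ∫ y, ‖y‖ ^ (n + 1) * ‖ψ ℓ y‖) := fun ℓ =>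
        Real.coe_toNNReal _ (mul_nonneg hC₁ (mul_nonneg (Nat.cast_nonneg _)
          (integral_nonneg fun _ => by positivity)))
      set q : ℝ := 2 ^ (r - (n + 1)) with hq
      have hq0 : 0 < q := by positivity
      have hq1 : q < 1 := Real.rpow_lt_one_of_one_lt_of_neg one_lt_two (by linarith)
      have h1 : ∀ j x, ‖iterPd l (telescope f (φ 0) (j + 1)) x‖ ≤
          ∑ ℓ, (((((2 : ℝ≥0) ^ j)⁻¹) ^ (n + 1) * c ℓ : ℝ≥0) : ℝ) *
            avgJet Q θ (conv f (dil (χ ℓ) j)) x := by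
        intro j x
        refine (norm_iterPd_telescope_succ_le f hφψ hψ (fun ℓ => (hsupp ℓ).2.2.2) hρψ l j
          (S := fun ℓ => C₁ * avgJet Q θ (conv f (dil (χ ℓ) j)) x) fun ℓ i z hz => ?_).trans
          (le_of_eq ?_)
        · refine (hmax₁ _ (contDiff_iterPd (hg j ℓ) _) x z hz).trans
            (mul_le_mul_of_nonneg_left ?_ hC₁)
          exact avgJet_iterPd_le hθ hθc hθ0 _ (by simp) (hg j ℓ) x
        · rw [Finset.mul_sum]
          refine Finset.sum_congr rfl fun ℓ _ => ?_
          push_cast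
          rw [hc0]
          ring
      have h2 : ∀ j, eNormSl ι (wdiv (w k) (iterPd l (telescope f (φ 0) (j + 1)))) ≤
          (∑ ℓ, c ℓ * A) * ENNReal.ofReal q ^ j := by
        intro j
        refine (eNormSl_wdiv_le_sum hE hw k (contDiff_iterPd (hu (j + 1)) l).continuous (hav j)
          (fun ℓ x => avgJet_nonneg hθ0 _ _ _) (h1 j)).trans ?_
        rw [Finset.sum_mul]
        refine Finset.sum_le_sum fun ℓ _ => ?_
        refine (mul_le_mul_right (hk j ℓ) _).trans (le_of_eq ?_)
        have e : ENNReal.ofReal q ^ j =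
            (((((2 : ℝ≥0) ^ j)⁻¹) ^ (n + 1) : ℝ≥0) : ℝ≥0∞) * ENNReal.ofReal (2 ^ (r * j)) := by
          rw [← ENNReal.ofReal_pow hq0.le, ← ENNReal.ofReal_coe_nnreal, ← ENNReal.ofReal_mul
            (NNReal.coe_nonneg _)]
          congr 1
          push_cast
          rw [hq, ← Real.rpow_natCast, ← Real.rpow_mul zero_le_two, sub_mul, Real.rpow_sub two_pos,
            div_eq_mul_inv, mul_comm]
          congr 1
          rw [inv_pow, ← pow_mul, ← Real.rpow_natCast]
          push_cast
          rw [mul_comm]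
        rw [e]
        push_cast
        ring
      refine (ENNReal.tsum_le_tsum h2).trans_lt ?_
      rw [ENNReal.tsum_mul_left]
      refine ENNReal.mul_lt_top (ENNReal.sum_lt_top.2 fun ℓ _ =>
        ENNReal.mul_lt_top ENNReal.coe_lt_top hA) ?_
      rw [ENNReal.tsum_geometric, ENNReal.inv_lt_top, tsub_pos_iff_lt]
      exact ENNReal.ofReal_lt_one.2 hq1
  refine ⟨_, isSlSmooth_tsum hE hw hu hsum, fun θ => ?_⟩
  have h1 := ((locallyNormal_of_tsum_eNormSl hE hw hu hsum).tendsto_integral hu θ).comp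
    (Filter.tendsto_add_atTop_nat 1)
  -- The partial sums are `f * φ_J`, which converge weakly both to `f` and to the sum of the series.
  refine tendsto_nhds_unique (tendsto_integral_conv_dil f hint θ) (h1.congr fun J => ?_)
  simp only [Function.comp_apply, ← sum_telescope, Finset.sum_apply]

end Reconstruction

/-! ### The spaces `Ḃ_𝒲` and `E^∞_𝒲`, and products with `IsSlSmooth` functions -/

section WeightedSmooth

variable {E : Type*} [NormedAddCommGroup E] [NormedSpace ℂ E]
  {ι : E →ₗ[ℂ] (Rd d →ₘ[volume] ℂ)} {w : ℕ → Rd d → ℝ}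

theorem memL0_mono {g h : Rd d → ℂ} (hg : AEStronglyMeasurable g volume)
    (hgh : ∀ᵐ x, ‖g x‖ₑ ≤ ‖h x‖ₑ) (hh : MemL0 h) : MemL0 g := by
  have hle : ∀ᵐ x, ‖g x‖ ≤ ‖h x‖ := hgh.mono fun x hx => enorm_le_iff_norm_le.1 hx
  refine ⟨hh.1.of_le hg hle, fun ε hε => ?_⟩
  obtain ⟨K, hK, hb⟩ := hh.2 ε hε
  refine ⟨K, hK, ?_⟩
  filter_upwards [hle, hb] with x h1 h2 hx
  exact h1.trans (h2 hx)

/-- Membership in `M^∞_𝒲` in terms of iterated partial derivatives. -/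
theorem mem_weightedSmooth_iff (hw : IsWeightSystem w) {M : (Rd d → ℂ) → Prop}
    (hM : ∀ g h : Rd d → ℂ, AEStronglyMeasurable g volume → (∀ᵐ x, ‖g x‖ₑ ≤ ‖h x‖ₑ) → M h → M g)
    {φ : Rd d → ℂ} : φ ∈ weightedSmooth M w ↔
      ContDiff ℝ ∞ φ ∧ ∀ n l, M (fun x => w n x • iterPd l φ x) := by
  constructor
  · intro h
    have hs := contDiff_of_mem_weightedSmooth h
    refine ⟨hs, fun n l => ?_⟩
    -- The definition couples the order of the derivative with the index of the weight. Passing to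
    -- the larger of the two decouples them, as the weights increase and `M` is solid.
    have h1 := (Set.mem_iInter.1 h (max n l.length)).2 (fun i => l.count i) (by
      rw [order_count]; exact le_max_right _ _)
    rw [← iterPd_eq_mderiv hs] at h1
    refine hM _ _ ((hw.measurable n).aestronglyMeasurable.smul
      (contDiff_iterPd hs l).continuous.aestronglyMeasurable)
      (Filter.Eventually.of_forall fun x => ?_) h1
    rw [enorm_smul, enorm_smul]
    gcongr
    rw [Real.enorm_of_nonneg (hw.pos _ _).le, Real.enorm_of_nonneg (hw.pos _ _).le]
    exact ENNReal.ofReal_le_ofReal (hw.mono (le_max_left _ _) x)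
  · rintro ⟨hs, h⟩
    refine Set.mem_iInter.2 fun n => ⟨hs.of_le (by exact_mod_cast le_top), fun α _ => ?_⟩
    rw [mderiv_eq_iterPd]
    exact h n _

theorem mem_dotB_iff (hw : IsWeightSystem w) {φ : Rd d → ℂ} : φ ∈ dotB w ↔
    ContDiff ℝ ∞ φ ∧ ∀ n l, MemL0 (fun x => w n x • iterPd l φ x) :=
  mem_weightedSmooth_iff hw fun _ _ => memL0_mono

theorem pderiv_mem_dotB (hw : IsWeightSystem w) {φ : Rd d → ℂ} (hφ : φ ∈ dotB w) (i : Fin d) :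
    pderiv i φ ∈ dotB w := by
  rw [mem_dotB_iff hw] at hφ ⊢
  refine ⟨contDiff_pderiv hφ.1 i, fun n l => ?_⟩
  have := hφ.2 n (l ++ [i])
  rwa [iterPd_append] at this

theorem mem_dotB_of_hasCompactSupport (hw : IsWeightSystem w) {φ : Rd d → ℂ}
    (hφ : ContDiff ℝ ∞ φ) (hc : HasCompactSupport φ) : φ ∈ dotB w := by
  rw [mem_dotB_iff hw]
  refine ⟨hφ, fun n l => ?_⟩
  have hl := contDiff_iterPd hφ l
  have hlc := hasCompactSupport_iterPd hc l
  obtain ⟨M, hM⟩ := hw.locallyBounded n _ hlc.isCompact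
  obtain ⟨B, hB⟩ := hl.continuous.bounded_above_of_compact_support hlc
  have h0 : ∀ x, x ∉ tsupport (iterPd l φ) → w n x • iterPd l φ x = 0 := fun x hx => by
    rw [image_eq_zero_of_notMem_tsupport hx, smul_zero]
  refine ⟨memLp_top_of_bound ((hw.measurable n).aestronglyMeasurable.smul
    hl.continuous.aestronglyMeasurable) (|M| * |B|) (Filter.Eventually.of_forall fun x => ?_),
    fun ε hε => ⟨_, hlc.isCompact, Filter.Eventually.of_forall fun x hx => ?_⟩⟩
  · by_cases hx : x ∈ tsupport (iterPd l φ)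
    · rw [norm_smul, Real.norm_of_nonneg (hw.pos n x).le]
      exact mul_le_mul ((hM x hx).trans (le_abs_self _)) ((hB x).trans (le_abs_self _))
        (norm_nonneg _) (abs_nonneg _)
    · rw [h0 x hx, norm_zero]
      positivity
  · change ‖w n x • iterPd l φ x‖ ≤ ε
    rw [h0 x hx, norm_zero]
    exact hε.le

variable [CompleteSpace E]

theorem mem_gelfandShilov_iff (hE : IsSolidTIBF ι) (hw : IsWeightSystem w) {φ : Rd d → ℂ} :
    φ ∈ gelfandShilov ι w ↔
      ContDiff ℝ ∞ φ ∧ ∀ n l, MemE ι (fun x => w n x • iterPd l φ x) :=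
  mem_weightedSmooth_iff hw fun _ _ => memE_mono hE

open scoped Classical in
/-- The product of a function of `E_sl` and a function of `L^0` belongs to `E`. -/
theorem memE_mul_of_memL0 (hE : IsSolidTIBF ι) {b G : Rd d → ℂ} (hb : MemL0 b)
    (hG : AEStronglyMeasurable G volume) (hGt : eNormSl ι G < ⊤) : MemE ι (fun x => b x * G x) := by
  choose K hK hbK using fun k : ℕ => hb.2 ((2 : ℝ)⁻¹ ^ k) (by positivity)
  choose ρ hρ using fun k => (hK k).isBounded.subset_closedBall 0
  -- The balls contain the sets `K k`, outside which `‖b‖ ≤ 2 ^ (-k)`, and they exhaust the space.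
  set R : ℕ → ℝ := fun k => max (ρ k) (k + 1) with hR
  have hR0 : ∀ k, 0 < R k := fun k => lt_max_of_lt_right (by positivity)
  -- The aim is `|b G| ≤ ∑ c k |1_{B(R k)} G|`, a series of finite norm. The shift of index reflects
  -- that a point first caught by ball `k + 1` lies outside ball `k`, hence outside `K k`.
  set c : ℕ → ℝ≥0 := fun k => Nat.casesOn k (eLpNorm b ⊤ volume).toNNReal fun k => 2⁻¹ ^ k with hc
  have hbB : ∀ᵐ x, ‖b x‖ₑ ≤ c 0 := by
    filter_upwards [ae_le_eLpNormEssSup (f := b) (μ := volume)] with x hx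
    change _ ≤ ((eLpNorm b ⊤ volume).toNNReal : ℝ≥0∞)
    rwa [ENNReal.coe_toNNReal hb.1.2.ne, eLpNorm_exponent_top]
  have hball : ∀ k, MeasurableSet (Metric.closedBall (0 : Rd d) (R k)) := fun k =>
    Metric.isClosed_closedBall.measurableSet
  let u : ℕ → Rd d → ℂ := fun k x =>
    ((c k : ℝ) : ℂ) * (Metric.closedBall (0 : Rd d) (R k)).indicator G x
  have hnc : ∀ k, ‖((c k : ℝ) : ℂ)‖ₑ = c k := fun k => by
    rw [← ofReal_norm, Complex.norm_real, NNReal.norm_eq, ENNReal.ofReal_coe_nnreal]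
  have hum : ∀ k, AEStronglyMeasurable (u k) volume := fun k =>
    (hG.indicator (hball k)).const_mul _
  refine memE_of_eNormE_lt_top ((eNormE_le_tsum hE (h := fun x => b x * G x) hum
    (hb.1.1.mul hG) ?_).trans_lt ?_)
  · filter_upwards [hbB, ae_all_iff.2 hbK] with x h0 h1
    have hex : ∃ k, x ∈ Metric.closedBall (0 : Rd d) (R k) := by
      obtain ⟨k, hk⟩ := exists_nat_ge ‖x‖
      refine ⟨k, mem_closedBall_zero_iff.2 (hk.trans ((le_max_right _ _).trans' (by simp)))⟩
    have hkey : ‖b x‖ₑ ≤ c (Nat.find hex) := by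
      rcases hk : Nat.find hex with _ | k
      · exact h0
      · have h2 := Nat.find_min hex (m := k) (by omega)
        have h3 : x ∉ K k := fun h => h2 (Metric.closedBall_subset_closedBall (le_max_left _ _)
          (hρ k h))
        have h4 := h1 k h3
        rw [← ofReal_norm, ← ENNReal.ofReal_coe_nnreal]
        refine ENNReal.ofReal_le_ofReal (h4.trans (le_of_eq ?_))
        simp [hc]
    refine le_trans ?_ (ENNReal.le_tsum (Nat.find hex))
    simp only [u]
    rw [enorm_mul, enorm_mul, hnc, Set.indicator_of_mem (Nat.find_spec hex)]
    gcongr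
  · have hle : ∀ k, eNormE ι (u k) ≤ c k * eNormSl ι G := fun k => by
      refine (eNormE_const_mul_le hE _ _).trans ?_
      rw [hnc]
      gcongr
      exact eNormE_indicator_le_eNormSl G (hR0 k)
    refine (ENNReal.tsum_le_tsum hle).trans_lt ?_
    rw [ENNReal.tsum_mul_right]
    refine ENNReal.mul_lt_top ?_ hGt
    rw [tsum_eq_zero_add' ENNReal.summable]
    refine ENNReal.add_lt_top.2 ⟨ENNReal.coe_lt_top, ?_⟩
    have e : ∀ k, ((c (k + 1) : ℝ≥0) : ℝ≥0∞) = 2⁻¹ ^ k := fun k => by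
      simp [hc, ENNReal.inv_pow]
    simp only [e]
    rw [ENNReal.tsum_geometric, ENNReal.inv_lt_top, tsub_pos_iff_lt]
    exact ENNReal.inv_lt_one.2 ENNReal.one_lt_two

/-- Write `w n |F φ| = w n w m |F / w m| |φ|`. The product of weights is at most `w k ^ 2 ≤ C w N`,
so `w N φ ∈ L^0` multiplies `F / w m ∈ E_sl` into `E`. -/
theorem memE_smul_mul_of_mem_dotB (hE : IsSolidTIBF ι) (hw : IsWeightSystem w) (hsq : Squarable w)
    {F φ : Rd d → ℂ} (hF : IsSlSmooth ι w F) (hφ : φ ∈ dotB w) (n : ℕ) :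
    MemE ι (fun x => w n x • (F x * φ x)) := by
  obtain ⟨m, hm⟩ := hF.eNormSl_lt_top []
  set k := max n m
  obtain ⟨N, -, hN⟩ := hsq k
  set C := (eLpNorm (fun x => w k x ^ 2 / w N x) ⊤ volume).toReal with hC
  have hCae : ∀ᵐ x, w k x ^ 2 ≤ C * w N x := by
    filter_upwards [ae_le_eLpNormEssSup (f := fun x => w k x ^ 2 / w N x) (μ := volume)] with x hx
    rw [← eLpNorm_exponent_top, ← ENNReal.ofReal_toReal hN.2.ne, ← ofReal_norm] at hx
    have h1 := (ENNReal.ofReal_le_ofReal_iff ENNReal.toReal_nonneg).1 hx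
    rw [Real.norm_of_nonneg (div_nonneg (sq_nonneg _) (hw.pos N x).le),
      div_le_iff₀ (hw.pos N x)] at h1
    exact h1
  rw [mem_dotB_iff hw] at hφ
  have hFc := hF.contDiff.continuous
  have hmem := (memE_mul_of_memL0 hE (hφ.2 N []) (aestronglyMeasurable_wdiv hw m
    hFc.aestronglyMeasurable) hm).const_mul (C : ℂ)
  refine memE_mono hE ((hw.measurable n).aestronglyMeasurable.smul
    (hFc.mul hφ.1.continuous).aestronglyMeasurable) ?_ hmem
  filter_upwards [hCae] with x hx
  rw [enorm_le_iff_norm_le, norm_smul, norm_mul, norm_mul, norm_mul, norm_smul,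
    Complex.norm_real, Real.norm_of_nonneg (hw.pos n x).le, Real.norm_of_nonneg (hw.pos N x).le,
    norm_wdiv (hw.pos m x), Real.norm_of_nonneg ENNReal.toReal_nonneg]
  simp only [iterPd_nil]
  have h1 : w n x ≤ C * w N x * (w m x)⁻¹ := by
    rw [← div_eq_mul_inv, le_div_iff₀ (hw.pos m x)]
    refine le_trans ?_ hx
    rw [sq]
    exact mul_le_mul (hw.mono (le_max_left _ _) x) (hw.mono (le_max_right _ _) x)
      (hw.pos m x).le (hw.pos k x).le
  calc w n x * (‖F x‖ * ‖φ x‖) ≤ C * w N x * (w m x)⁻¹ * (‖F x‖ * ‖φ x‖) := by gcongr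
    _ = _ := by ring

theorem IsSlSmooth.mul_mem_gelfandShilov (hE : IsSolidTIBF ι) (hw : IsWeightSystem w)
    (hsq : Squarable w) {F φ : Rd d → ℂ} (hF : IsSlSmooth ι w F) (hφ : φ ∈ dotB w) :
    F * φ ∈ gelfandShilov ι w := by
  have hs := ((mem_dotB_iff hw).1 hφ).1
  rw [mem_gelfandShilov_iff hE hw]
  refine ⟨hF.contDiff.mul hs, fun n l => ?_⟩
  -- The innermost derivative is peeled off, so that Leibniz applies to `F φ` itself and leaves two
  -- products of the same kind, with a derivative of `F` or of `φ` as new factor.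
  induction l using List.reverseRecOn generalizing F φ with
  | nil => exact memE_smul_mul_of_mem_dotB hE hw hsq hF hφ n
  | append_singleton l i ih =>
    have hFi := hF.iterPd [i]
    have hφi := pderiv_mem_dotB hw hφ i
    have h1 := ih hFi hφ hs
    have h2 := ih hF hφi (contDiff_pderiv hs i)
    rw [iterPd_concat, pderiv_mul hF.contDiff hs,
      iterPd_add (g := pderiv i F * φ) (h := F * pderiv i φ)
        ((contDiff_pderiv hF.contDiff i).mul hs) (hF.contDiff.mul (contDiff_pderiv hs i))]
    have h3 := h1.add h2
    simp only [← smul_add] at h3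
    exact h3

theorem mem_multiplierSpace_of_represents (hE : IsSolidTIBF ι) (hw : IsWeightSystem w)
    (hsq : Squarable w) {f : Distrib d} {F : Rd d → ℂ} (hF : IsSlSmooth ι w F)
    (hf : Represents f F) : f ∈ multiplierSpace ι w w := fun φ hφ =>
  ⟨F * φ, hF.mul_mem_gelfandShilov hE hw hsq hφ, fun θ => by
    rw [hf]
    refine integral_congr_ae (Filter.Eventually.of_forall fun x => ?_)
    simp only [coe_smoothMul, Pi.mul_apply]
    ring⟩

end WeightedSmooth

/-! ### The gliding hump -/

section GlidingHump

variable {w : ℕ → Rd d → ℝ}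

/-- The envelope of the functions `2 ^ (-k) / w k` on the balls of radius `R (k + 1)`. -/
noncomputable def envelope (w : ℕ → Rd d → ℝ) (R : ℕ → ℝ) (y : Rd d) : ℝ :=
  ⨆ k : ℕ, (Metric.closedBall (0 : Rd d) (R (k + 1))).indicator
    (fun y => (2 : ℝ)⁻¹ ^ k * (w k y)⁻¹) y

theorem envelope_nonneg (hw : IsWeightSystem w) (R : ℕ → ℝ) (y : Rd d) : 0 ≤ envelope w R y :=
  Real.iSup_nonneg fun k => Set.indicator_nonneg
    (fun z _ => mul_nonneg (by positivity) (inv_nonneg.2 (hw.pos k z).le)) y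

theorem indicator_le_one (hw : IsWeightSystem w) (R : ℕ → ℝ) (k : ℕ) (y : Rd d) :
    (Metric.closedBall (0 : Rd d) (R (k + 1))).indicator
      (fun y => (2 : ℝ)⁻¹ ^ k * (w k y)⁻¹) y ≤ 1 := by
  refine Set.indicator_apply_le' (fun _ => ?_) fun _ => zero_le_one
  exact mul_le_one₀ (pow_le_one₀ (by norm_num) (by norm_num)) (inv_nonneg.2 (hw.pos k y).le)
    (inv_le_one_of_one_le₀ (hw.one_le k y))

theorem envelope_le_one (hw : IsWeightSystem w) (R : ℕ → ℝ) (y : Rd d) : envelope w R y ≤ 1 :=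
  ciSup_le fun k => indicator_le_one hw R k y

theorem le_envelope (hw : IsWeightSystem w) {R : ℕ → ℝ} {k : ℕ} {y : Rd d} (hy : ‖y‖ ≤ R (k + 1)) :
    (2 : ℝ)⁻¹ ^ k * (w k y)⁻¹ ≤ envelope w R y := by
  have h := le_ciSup (f := fun k : ℕ => (Metric.closedBall (0 : Rd d) (R (k + 1))).indicator
    (fun y => (2 : ℝ)⁻¹ ^ k * (w k y)⁻¹) y) ⟨1, by
      rintro _ ⟨k, rfl⟩; exact indicator_le_one hw R k y⟩ k
  rwa [Set.indicator_of_mem (mem_closedBall_zero_iff.2 hy)] at h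

/-- Beyond radius `R k` the terms of index below `k` vanish, and the remaining ones decrease in the
index. -/
theorem envelope_le (hw : IsWeightSystem w) {R : ℕ → ℝ} (hR : Monotone R) {k : ℕ} {y : Rd d}
    (hy : R k < ‖y‖) : envelope w R y ≤ (2 : ℝ)⁻¹ ^ k * (w k y)⁻¹ := by
  have h0 : 0 ≤ (2 : ℝ)⁻¹ ^ k * (w k y)⁻¹ :=
    mul_nonneg (by positivity) (inv_nonneg.2 (hw.pos k y).le)
  refine ciSup_le fun i => Set.indicator_apply_le' (fun hi => ?_) fun _ => h0
  have hki : k ≤ i := by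
    by_contra! hlt
    have h1 := hR (show i + 1 ≤ k from hlt)
    linarith [mem_closedBall_zero_iff.1 hi]
  gcongr ?_ * ?_
  · exact inv_nonneg.2 (hw.pos i y).le
  · exact pow_le_pow_of_le_one (by norm_num) (by norm_num) hki
  · exact inv_anti₀ (hw.pos k y) (hw.mono hki y)

theorem locallyIntegrable_envelope (hw : IsWeightSystem w) (R : ℕ → ℝ) :
    LocallyIntegrable (fun y => ((envelope w R y : ℝ) : ℂ)) volume := by
  have hm : AEMeasurable (envelope w R) volume := AEMeasurable.iSup fun k =>
    ((hw.measurable k).inv.const_mul _).indicator Metric.isClosed_closedBall.measurableSet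
  refine (locallyIntegrable_const (1 : ℂ)).mono
    (Complex.continuous_ofReal.comp_aestronglyMeasurable hm.aestronglyMeasurable)
    (Filter.Eventually.of_forall fun y => ?_)
  rw [Complex.norm_real, Real.norm_of_nonneg (envelope_nonneg hw R y), norm_one]
  exact envelope_le_one hw R y

/-- Mollifications of the envelope belong to `Ḃ_𝒲`. -/
theorem convolution_envelope_mem_dotB (hw : IsWeightSystem w) (hwM : WeakModerate w) {R : ℕ → ℝ}
    (hR : Monotone R) (θ : Test d) :
    convolution (fun y => ((envelope w R y : ℝ) : ℂ)) θ (ContinuousLinearMap.mul ℂ ℂ) volume ∈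
      dotB w := by
  have hloc := locallyIntegrable_envelope hw R
  have hs := contDiff_convolution_test hloc θ
  refine (mem_dotB_iff hw).2 ⟨hs, fun n l => ?_⟩
  obtain ⟨ρ', -, hρ'⟩ := exists_tsupport_subset_closedBall θ
  obtain ⟨ρ, hρ⟩ := exists_nat_ge ρ'
  have hθ0 : ∀ z, (ρ : ℝ) < ‖z‖ → iterPd l θ z = 0 := fun z hz =>
    image_eq_zero_of_notMem_tsupport fun h => by
      have := mem_closedBall_zero_iff.1 (hρ' (tsupport_iterPd_subset _ _ h))
      linarith
  obtain ⟨n', -, C, hC, hwn⟩ := hwM.iterate ρ n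
  set I := ∫ z, ‖iterPd l θ z‖ with hI
  have hI0 : 0 ≤ I := integral_nonneg fun _ => norm_nonneg _
  have hint : Integrable (iterPd l θ) := (testPd l θ).continuous.integrable_of_hasCompactSupport
    (testPd l θ).hasCompactSupport
  -- By iterated (wM) the weight moves under the integral, so bounds on `w n' * envelope` near `x`
  -- bound every derivative of the mollification there.
  have key : ∀ x S, (∀ y, ‖x - y‖ ≤ ρ → w n' y * envelope w R y ≤ S) →
      ‖w n x • iterPd l (convolution (fun y => ((envelope w R y : ℝ) : ℂ)) θ
        (ContinuousLinearMap.mul ℂ ℂ) volume) x‖ ≤ C * S * I := by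
    intro x S hS
    rw [iterPd_convolution hloc (test_contDiff θ) θ.hasCompactSupport, convolution_apply, norm_smul,
      Real.norm_of_nonneg (hw.pos n x).le, ← le_div_iff₀' (hw.pos n x), hI,
      ← integral_sub_left_eq_self (fun z => ‖iterPd l θ z‖) volume x, mul_div_right_comm,
      ← integral_const_mul]
    refine norm_integral_le_of_norm_le ((hint.comp_sub_left x).norm.const_mul _)
      (Filter.Eventually.of_forall fun y => ?_)
    rw [norm_mul, Complex.norm_real, Real.norm_of_nonneg (envelope_nonneg hw R y)]
    by_cases hy : ‖x - y‖ ≤ ρ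
    · gcongr
      rw [le_div_iff₀' (hw.pos n x)]
      have h1 := hwn y (x - y) hy
      rw [add_sub_cancel] at h1
      calc w n x * envelope w R y ≤ C * w n' y * envelope w R y := by
            gcongr; exact envelope_nonneg hw R y
        _ = C * (w n' y * envelope w R y) := by ring
        _ ≤ C * S := by gcongr; exact hS y hy
    · rw [hθ0 _ (not_le.1 hy), norm_zero, mul_zero, mul_zero]
  -- The factor `1 / w k` cancels the weight and the factor `2 ^ (-k)` provides the decay at
  -- infinity required by `L^0`.
  have hfar : ∀ k, n' ≤ k → ∀ y, R k < ‖y‖ → w n' y * envelope w R y ≤ (2 : ℝ)⁻¹ ^ k := by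
    intro k hk y hy
    refine (mul_le_mul_of_nonneg_left (envelope_le hw hR hy) (hw.pos n' y).le).trans ?_
    rw [mul_left_comm]
    refine mul_le_of_le_one_right (by positivity) ?_
    rw [← div_eq_mul_inv, div_le_one (hw.pos k y)]
    exact hw.mono hk y
  obtain ⟨M, hM⟩ := hw.locallyBounded n' _ (isCompact_closedBall (0 : Rd d) (R n'))
  have hall : ∀ y, w n' y * envelope w R y ≤ max M 1 := by
    intro y
    by_cases hy : ‖y‖ ≤ R n'
    · exact (mul_le_of_le_one_right (hw.pos n' y).le (envelope_le_one hw R y)).trans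
        ((hM y (mem_closedBall_zero_iff.2 hy)).trans (le_max_left _ _))
    · exact (hfar n' le_rfl y (not_le.1 hy)).trans
        ((pow_le_one₀ (by norm_num) (by norm_num)).trans (le_max_right _ _))
  refine ⟨memLp_top_of_bound ((hw.measurable n).aestronglyMeasurable.smul
    (contDiff_iterPd hs l).continuous.aestronglyMeasurable) (C * max M 1 * I)
    (Filter.Eventually.of_forall fun x => key x _ fun y _ => hall y), fun ε hε => ?_⟩
  have hlim : Filter.Tendsto (fun k : ℕ => C * (2 : ℝ)⁻¹ ^ k * I) Filter.atTop (nhds 0) := by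
    have := ((tendsto_pow_atTop_nhds_zero_of_lt_one (r := (2 : ℝ)⁻¹) (by norm_num)
      (by norm_num)).const_mul C).mul_const I
    rwa [mul_zero, zero_mul] at this
  obtain ⟨k, hk1, hk2⟩ := ((hlim.eventually (ge_mem_nhds hε)).and
    (Filter.eventually_ge_atTop n')).exists
  refine ⟨_, isCompact_closedBall (0 : Rd d) (R k + ρ), Filter.Eventually.of_forall fun x hx => ?_⟩
  refine (key x _ fun y hy => hfar k hk2 y ?_).trans hk1
  rw [mem_closedBall_zero_iff, not_le] at hx
  have := norm_add_le (x - y) y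
  rw [sub_add_cancel] at this
  linarith

/-- For `‖x‖ ≤ R k` the mollifier sees only the ball of radius `R (k + 1)`, where the envelope is at
least `2 ^ (-k) / w k`. The moderation inequality replaces `w k` nearby by `w k'` at `x`. -/
theorem le_norm_convolution_envelope (hw : IsWeightSystem w) {R : ℕ → ℝ} {θ : Rd d → ℝ}
    (hθ : Continuous θ) (hθc : HasCompactSupport θ) (h0 : ∀ x, 0 ≤ θ x) {ρ : ℝ}
    (hρ : ∀ z, ρ < ‖z‖ → θ z = 0) {k k' : ℕ} {C : ℝ}
    (hwk : ∀ x y : Rd d, ‖y‖ ≤ ρ → w k (x + y) ≤ C * w k' x) (hR : R k + ρ ≤ R (k + 1)) {x : Rd d}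
    (hx : ‖x‖ ≤ R k) : (2 : ℝ)⁻¹ ^ k * C⁻¹ * (∫ z, θ z) * (w k' x)⁻¹ ≤
      ‖convolution (fun y => ((envelope w R y : ℝ) : ℂ)) (fun y => ((θ y : ℝ) : ℂ))
        (ContinuousLinearMap.mul ℂ ℂ) volume x‖ := by
  have e : convolution (fun y => ((envelope w R y : ℝ) : ℂ)) (fun y => ((θ y : ℝ) : ℂ))
      (ContinuousLinearMap.mul ℂ ℂ) volume x = ((∫ y, envelope w R y * θ (x - y) : ℝ) : ℂ) := by
    rw [convolution_apply, ← integral_complex_ofReal]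
    simp
  have hm : AEStronglyMeasurable (envelope w R) volume := by
    have := Complex.continuous_re.comp_aestronglyMeasurable
      (locallyIntegrable_envelope hw R).aestronglyMeasurable
    exact this
  have hi : Integrable fun y => θ (x - y) :=
    (hθ.integrable_of_hasCompactSupport hθc).comp_sub_left x
  have hi2 : Integrable fun y => envelope w R y * θ (x - y) := by
    refine hi.mono (hm.mul hi.1) (Filter.Eventually.of_forall fun y => ?_)
    rw [norm_mul, Real.norm_of_nonneg (envelope_nonneg hw R y)]
    exact mul_le_of_le_one_left (norm_nonneg _) (envelope_le_one hw R y)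
  rw [e, Complex.norm_real, Real.norm_of_nonneg (integral_nonneg fun y =>
    mul_nonneg (envelope_nonneg hw R y) (h0 _)), ← integral_sub_left_eq_self θ volume x,
    mul_right_comm, ← integral_const_mul]
  refine integral_mono (hi.const_mul _) hi2 fun y => ?_
  by_cases hy : ‖x - y‖ ≤ ρ
  · refine mul_le_mul_of_nonneg_right ?_ (h0 _)
    have hyR : ‖y‖ ≤ R (k + 1) := by
      have := norm_sub_le x (x - y)
      rw [sub_sub_cancel] at this
      linarith
    refine le_trans ?_ (le_envelope hw hyR)
    rw [mul_assoc, ← mul_inv]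
    refine mul_le_mul_of_nonneg_left (inv_anti₀ (hw.pos k y) ?_) (by positivity)
    have := hwk x (y - x) (by rwa [norm_sub_rev])
    rwa [add_sub_cancel] at this
  · simp [hρ _ (not_le.1 hy)]

variable {E : Type*} [NormedAddCommGroup E] [NormedSpace ℂ E]
  {ι : E →ₗ[ℂ] (Rd d →ₘ[volume] ℂ)} [CompleteSpace E]

/-- A multiplier from `Ḃ_𝒲` to `E` belongs to a weighted semi-local space. -/
theorem exists_eNormSl_wdiv_lt_top (hE : IsSolidTIBF ι) (hw : IsWeightSystem w)
    (hwM : WeakModerate w) {G : Rd d → ℂ} (hG : Continuous G)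
    (h : ∀ φ ∈ dotB w, MemE ι (G * φ)) : ∃ m, eNormSl ι (wdiv (w m) G) < ⊤ := by
  by_contra! hcon
  obtain ⟨θ, hθs, hθc, hθ0, -, hθ1⟩ := exists_cutoff d 0
  have hθ := hθs.continuous
  let T : Test d := mkTest (fun x => ((θ x : ℝ) : ℂ)) (Complex.ofRealCLM.contDiff.comp hθs)
    (hθc.comp_left (g := fun t : ℝ => (t : ℂ)) (by simp))
  obtain ⟨ρ', hρ'⟩ := hθc.isCompact.isBounded.subset_closedBall 0
  obtain ⟨ρ, hρ⟩ := exists_nat_ge ρ'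
  have hθρ : ∀ z, (ρ : ℝ) < ‖z‖ → θ z = 0 := fun z hz =>
    image_eq_zero_of_notMem_tsupport fun h => by
      have := mem_closedBall_zero_iff.1 (hρ' h)
      linarith
  set I := ∫ z, θ z with hI
  have hIpos : 0 < I := hθ.integral_pos_of_hasCompactSupport_nonneg_nonzero hθc hθ0 (x := 0)
    (by rw [hθ1 0 (by simp)]; exact one_ne_zero)
  choose k' hk' C hC hwk using hwM.iterate ρ
  set c : ℕ → ℝ := fun k => (2 : ℝ)⁻¹ ^ k * (C k)⁻¹ * I with hc
  have hcpos : ∀ k, 0 < c k := fun k =>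
    mul_pos (mul_pos (by positivity) (inv_pos.2 (hC k))) hIpos
  -- The constant `c k` is the one in the lower bound `|φ| ≥ c k / w (k' k)` below. On the ball of
  -- radius `r k` this forces the norm of `G φ` above `k`.
  have hex : ∀ k : ℕ, ∃ r : ℝ, 0 < r ∧ ENNReal.ofReal (k * (c k)⁻¹) <
      eNormE ι ((Metric.closedBall (0 : Rd d) r).indicator (wdiv (w (k' k)) G)) := by
    intro k
    have h1 : ENNReal.ofReal (k * (c k)⁻¹) < eNormSl ι (wdiv (w (k' k)) G) :=
      ENNReal.ofReal_lt_top.trans_le (hcon _)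
    rw [eNormSl, lt_iSup_iff] at h1
    obtain ⟨r, h2⟩ := h1
    obtain ⟨hr, h3⟩ := lt_iSup_iff.1 h2
    exact ⟨r, hr, h3⟩
  choose r hr0 hr using hex
  -- Cumulative sums ensure `r k ≤ R k`, monotonicity, and gaps of at least `ρ` for the mollifier.
  set R : ℕ → ℝ := fun k => ∑ i ∈ Finset.range (k + 1), (r i + ρ) with hR
  have hRsucc : ∀ k, R (k + 1) = R k + (r (k + 1) + ρ) := fun k => Finset.sum_range_succ _ _
  have hRmono : Monotone R := monotone_nat_of_le_succ fun k => by
    rw [hRsucc]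
    have := (hr0 (k + 1)).le
    linarith [(Nat.cast_nonneg ρ : (0 : ℝ) ≤ ρ)]
  have hRr : ∀ k, r k ≤ R k := fun k => by
    have h1 := Finset.single_le_sum (f := fun i => r i + ρ)
      (fun i _ => add_nonneg (hr0 i).le (Nat.cast_nonneg ρ)) (Finset.self_mem_range_succ k)
    linarith [(Nat.cast_nonneg ρ : (0 : ℝ) ≤ ρ)]
  set φ := convolution (fun y => ((envelope w R y : ℝ) : ℂ)) T (ContinuousLinearMap.mul ℂ ℂ) volume
    with hφ
  have hmem := h φ (convolution_envelope_mem_dotB hw hwM hRmono T)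
  have hlt := eNormE_lt_top_of_memE hmem
  -- The same `φ` works for all `k`, so an index exceeding the finite norm of `G φ` gives the
  -- contradiction.
  obtain ⟨N, hN⟩ := exists_nat_gt (eNormE ι (G * φ)).toReal
  have hbound : eNormE ι ((Metric.closedBall (0 : Rd d) (r N)).indicator (wdiv (w (k' N)) G)) ≤
      (c N)⁻¹.toNNReal * eNormE ι (G * φ) := by
    refine eNormE_le_of_le_mul hE ((aestronglyMeasurable_wdiv hw _
      hG.aestronglyMeasurable).indicator Metric.isClosed_closedBall.measurableSet)
      (Filter.Eventually.of_forall fun x => ?_)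
    by_cases hx : x ∈ Metric.closedBall (0 : Rd d) (r N)
    · rw [Set.indicator_of_mem hx, ← ofReal_norm, ← ofReal_norm, norm_wdiv (hw.pos _ x)]
      change _ ≤ ENNReal.ofReal (c N)⁻¹ * _
      rw [← ENNReal.ofReal_mul (inv_nonneg.2 (hcpos N).le)]
      refine ENNReal.ofReal_le_ofReal ?_
      have h1 := le_norm_convolution_envelope hw hθ hθc hθ0 hθρ (hwk N) (R := R)
        (by rw [hRsucc]; linarith [(hr0 (N + 1)).le])
        ((mem_closedBall_zero_iff.1 hx).trans (hRr N))
      have h2 : c N * (w (k' N) x)⁻¹ ≤ ‖φ x‖ := h1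
      rw [Pi.mul_apply, norm_mul, le_inv_mul_iff₀ (hcpos N), mul_comm ‖G x‖]
      calc c N * ((w (k' N) x)⁻¹ * ‖G x‖) = c N * (w (k' N) x)⁻¹ * ‖G x‖ := by ring
        _ ≤ ‖φ x‖ * ‖G x‖ := by gcongr
    · rw [Set.indicator_of_notMem hx, enorm_zero]
      exact zero_le
  have h1 := (hr N).trans_le hbound
  rw [← ENNReal.ofReal_toReal hlt.ne] at h1
  change _ < ENNReal.ofReal (c N)⁻¹ * _ at h1
  rw [← ENNReal.ofReal_mul (inv_nonneg.2 (hcpos N).le), mul_comm] at h1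
  have h2 := (ENNReal.ofReal_lt_ofReal_iff'.1 h1).1
  exact absurd (lt_of_mul_lt_mul_left h2 (inv_nonneg.2 (hcpos N).le)) (not_lt.2 hN.le)

end GlidingHump

/-! ### Multipliers are smooth functions of class `IsSlSmooth` -/

section MultiplierFunctions

theorem eqOn_of_integral_mul_eq {U : Set (Rd d)} (hU : IsOpen U) {g h : Rd d → ℂ}
    (hg : Continuous g) (hh : Continuous h)
    (hgh : ∀ θ : Test d, tsupport θ ⊆ U → ∫ x, g x * θ x = ∫ x, h x * θ x) : Set.EqOn g h U := by
  have h1 : ∀ᵐ x, x ∈ U → (g - h) x = 0 := by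
    refine hU.ae_eq_zero_of_integral_contDiff_smul_eq_zero
      ((hg.sub hh).locallyIntegrable.locallyIntegrableOn U) fun η hη hηc hηU => ?_
    let T : Test d := mkTest (fun x => ((η x : ℝ) : ℂ)) (Complex.ofRealCLM.contDiff.comp hη)
      (hηc.comp_left (g := fun t : ℝ => (t : ℂ)) (by simp))
    have hTη : ∀ x, T x = η x := fun _ => rfl
    have hT : tsupport T ⊆ U := (closure_mono fun x hx => by
      intro h0
      exact hx (by rw [hTη, h0, Complex.ofReal_zero])).trans hηU
    have hint : ∀ {q : Rd d → ℂ}, Continuous q → Integrable fun x => q x * T x := fun hq =>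
      (hq.mul T.continuous).integrable_of_hasCompactSupport T.hasCompactSupport.mul_left
    have h2 := hgh T hT
    rw [← sub_eq_zero, ← integral_sub (hint hg) (hint hh)] at h2
    rw [← h2]
    refine integral_congr_ae (Filter.Eventually.of_forall fun x => ?_)
    simp only [hTη, Pi.sub_apply, Complex.real_smul]
    ring
  refine Measure.eqOn_open_of_ae_eq (μ := volume) ?_ hU hg.continuousOn hh.continuousOn
  refine (ae_restrict_iff' hU.measurableSet).2 ?_
  filter_upwards [h1] with x hx hxU
  exact sub_eq_zero.1 (hx hxU)

/-- A distribution that is a smooth function on every ball is a smooth function. -/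
theorem exists_represents_of_ball {f : Distrib d} {g : ℕ → Rd d → ℂ}
    (hg : ∀ N, ContDiff ℝ ∞ (g N))
    (h : ∀ (N : ℕ) (θ : Test d), tsupport θ ⊆ Metric.ball 0 N → f θ = ∫ x, g N x * θ x) :
    ∃ F, ContDiff ℝ ∞ F ∧ Represents f F := by
  have heq : ∀ N M, N ≤ M → Set.EqOn (g N) (g M) (Metric.ball 0 (N : ℝ)) := fun N M hNM =>
    eqOn_of_integral_mul_eq Metric.isOpen_ball (hg N).continuous (hg M).continuous fun θ hθ => by
      rw [← h N θ hθ, ← h M θ (hθ.trans (Metric.ball_subset_ball (by exact_mod_cast hNM)))]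
  -- The added one places `x` strictly inside the open ball on which the chosen local representative
  -- is valid.
  let F : Rd d → ℂ := fun x => g (⌈‖x‖⌉₊ + 1) x
  have hF : ∀ N : ℕ, Set.EqOn F (g (N + 1)) (Metric.ball 0 (N : ℝ)) := by
    intro N x hx
    have hx' : ‖x‖ < N := mem_ball_zero_iff.1 hx
    refine heq _ _ (Nat.succ_le_succ (Nat.ceil_le.2 hx'.le)) (mem_ball_zero_iff.2 ?_)
    push_cast
    exact (Nat.le_ceil _).trans_lt (lt_add_one _)
  refine ⟨F, contDiff_iff_contDiffAt.2 fun x => ?_, fun θ => ?_⟩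
  · obtain ⟨N, hN⟩ := exists_nat_gt ‖x‖
    refine ((hg (N + 1)).contDiffAt (x := x)).congr_of_eventuallyEq ?_
    filter_upwards [Metric.isOpen_ball.mem_nhds (mem_ball_zero_iff.2 hN)] with y hy
    exact hF N hy
  · obtain ⟨r, -, hr⟩ := exists_tsupport_subset_closedBall θ
    obtain ⟨N, hN⟩ := exists_nat_gt r
    have hs : tsupport θ ⊆ Metric.ball 0 (N : ℝ) := hr.trans (Metric.closedBall_subset_ball hN)
    rw [h (N + 1) θ (hs.trans (Metric.ball_subset_ball (by push_cast; linarith)))]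
    refine integral_congr_ae (Filter.Eventually.of_forall fun x => ?_)
    by_cases hx : x ∈ tsupport θ
    · simp only [hF N (hs hx)]
    · simp [image_eq_zero_of_notMem_tsupport hx]

variable {E : Type*} [NormedAddCommGroup E] [NormedSpace ℂ E]
  {ι : E →ₗ[ℂ] (Rd d →ₘ[volume] ℂ)} {w : ℕ → Rd d → ℝ}

/-- Cut-offs equal to one on large balls belong to `Ḃ_𝒲`, so `f` agrees with a smooth function on
every ball. -/
theorem exists_represents_of_mem_multiplierSpace (hw : IsWeightSystem w) {f : Distrib d}
    (hf : f ∈ multiplierSpace ι w w) : ∃ F, ContDiff ℝ ∞ F ∧ Represents f F := by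
  choose η hηs hηc _ _ hη1 using exists_cutoff d
  let φ : ℕ → Rd d → ℂ := fun N x => ((η N x : ℝ) : ℂ)
  have hφ : ∀ N, φ N ∈ dotB w := fun N =>
    mem_dotB_of_hasCompactSupport hw (Complex.ofRealCLM.contDiff.comp (hηs N))
      ((hηc N).comp_left (g := fun t : ℝ => (t : ℂ)) (by simp))
  choose g hg hfg using fun N => hf (φ N) (hφ N)
  refine exists_represents_of_ball (fun N => contDiff_of_mem_weightedSmooth (hg N)) fun N θ hθ => ?_
  rw [← hfg N]
  congr 1
  ext x
  rw [coe_smoothMul]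
  by_cases hx : x ∈ tsupport θ
  · simp [φ, hη1 N x (mem_ball_zero_iff.1 (hθ hx)).le]
  · simp [image_eq_zero_of_notMem_tsupport hx]

theorem mul_mem_gelfandShilov {f : Distrib d}
    (hf : f ∈ multiplierSpace ι w w) {F : Rd d → ℂ} (hF : ContDiff ℝ ∞ F) (hfF : Represents f F)
    {φ : Rd d → ℂ} (hφ : φ ∈ dotB w) : F * φ ∈ gelfandShilov ι w := by
  obtain ⟨g, hg, hfg⟩ := hf φ hφ
  have hs := contDiff_of_mem_weightedSmooth hφ
  have : F * φ = g := by
    rw [← Set.eqOn_univ]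
    refine eqOn_of_integral_mul_eq isOpen_univ (hF.mul hs).continuous
      (contDiff_of_mem_weightedSmooth hg).continuous fun θ _ => ?_
    rw [← hfg θ, hfF]
    refine integral_congr_ae (Filter.Eventually.of_forall fun x => ?_)
    simp only [coe_smoothMul, Pi.mul_apply]
    ring
  rwa [this]

variable [CompleteSpace E]

/-- Induction through `(∂ᵢ G) φ = ∂ᵢ (G φ) - G ∂ᵢ φ`, where `∂ᵢ φ` is again in `Ḃ_𝒲`. Carrying all
outer derivatives `l'` in the statement keeps the first term within the induction hypothesis. -/
theorem memE_iterPd_mul (hE : IsSolidTIBF ι) (hw : IsWeightSystem w) {F : Rd d → ℂ}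
    (hF : ContDiff ℝ ∞ F) (h : ∀ φ ∈ dotB w, F * φ ∈ gelfandShilov ι w) (l : List (Fin d)) :
    ∀ φ ∈ dotB w, ∀ n l', MemE ι (fun x => w n x • iterPd l' (iterPd l F * φ) x) := by
  induction l with
  | nil => exact fun φ hφ => ((mem_gelfandShilov_iff hE hw).1 (h φ hφ)).2
  | cons i l ih =>
    intro φ hφ n l'
    have hφs := contDiff_of_mem_weightedSmooth hφ
    have hl := contDiff_iterPd hF l
    have e : iterPd (i :: l) F * φ =
        pderiv i (iterPd l F * φ) + (-1 : ℂ) • (iterPd l F * pderiv i φ) := by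
      rw [pderiv_mul hl hφs, iterPd_cons]
      funext x
      simp
    have c1 : ContDiff ℝ ∞ (iterPd l F * φ) := hl.mul hφs
    have c2 : ContDiff ℝ ∞ (iterPd l F * pderiv i φ) := hl.mul (contDiff_pderiv hφs i)
    have c3 : ContDiff ℝ ∞ ((-1 : ℂ) • (iterPd l F * pderiv i φ)) := contDiff_const.smul c2
    have h1 := ih φ hφ n (l' ++ [i])
    have h2 := (ih _ (pderiv_mem_dotB hw hφ i) n l').const_mul (-1)
    have h3 := h1.add h2
    rw [e, iterPd_add (contDiff_pderiv c1 i) c3, iterPd_const_smul c2]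
    convert h3 using 2 with x
    rw [iterPd_concat]
    simp only [Pi.add_apply, Pi.smul_apply, smul_add, smul_eq_mul]
    rw [mul_smul_comm]

theorem isSlSmooth_of_mem_multiplierSpace (hE : IsSolidTIBF ι) (hw : IsWeightSystem w)
    (hwM : WeakModerate w) {f : Distrib d} (hf : f ∈ multiplierSpace ι w w) :
    ∃ F, IsSlSmooth ι w F ∧ Represents f F := by
  obtain ⟨F, hF, hfF⟩ := exists_represents_of_mem_multiplierSpace hw hf
  refine ⟨F, ⟨hF, fun l => ?_⟩, hfF⟩
  refine exists_eNormSl_wdiv_lt_top hE hw hwM (contDiff_iterPd hF l).continuous fun φ hφ => ?_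
  -- Membership in `E` alone is needed, so the weight `w 0 ≥ 1` is dropped by solidity.
  have h1 := memE_iterPd_mul hE hw hF (fun φ hφ => mul_mem_gelfandShilov hf hF hfF hφ) l φ hφ 0 []
  refine memE_mono hE ((contDiff_iterPd hF l).continuous.mul
    (contDiff_of_mem_weightedSmooth hφ).continuous).aestronglyMeasurable
    (Filter.Eventually.of_forall fun x => ?_) h1
  rw [iterPd_nil, enorm_le_iff_norm_le, norm_smul, Real.norm_of_nonneg (hw.pos 0 x).le]
  exact le_mul_of_one_le_left (norm_nonneg _) (hw.one_le 0 x)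

end MultiplierFunctions

/-! ### Comparison of bounded sets, and the cycle of implications -/

section Equivalence

variable {E : Type*} [NormedAddCommGroup E] [NormedSpace ℂ E]
  {ι : E →ₗ[ℂ] (Rd d →ₘ[volume] ℂ)} {w : ℕ → Rd d → ℝ}

theorem BoundedSl.union {S T : Set (Rd d → ℂ)} (hS : BoundedSl ι S) (hT : BoundedSl ι T) :
    BoundedSl ι (S ∪ T) := by
  obtain ⟨A, hA⟩ := hS
  obtain ⟨B, hB⟩ := hT
  refine ⟨max A B, ?_⟩
  rintro g (hg | hg)
  · exact ⟨(hA g hg).1, (hA g hg).2.trans (by exact_mod_cast le_max_left A B)⟩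
  · exact ⟨(hB g hg).1, (hB g hg).2.trans (by exact_mod_cast le_max_right A B)⟩

variable [CompleteSpace E]

theorem BoundedSl.of_le_mul (hE : IsSolidTIBF ι) {S T : Set (Rd d → ℂ)} (hS : BoundedSl ι S)
    (h : ∀ g ∈ T, AEStronglyMeasurable g volume ∧ ∃ g' ∈ S, ∀ x, ‖g x‖ ≤ ‖g' x‖) :
    BoundedSl ι T := by
  obtain ⟨C, hC⟩ := hS
  refine boundedSl_of_eNormSl_le hE (C := C) ENNReal.coe_lt_top fun g hg => ?_
  obtain ⟨hm, g', hg', hle⟩ := h g hg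
  refine ⟨hm, ?_⟩
  have := eNormSl_le_of_le_mul hE (C := 1) (h := g') hm (Filter.Eventually.of_forall fun x => by
    rw [ENNReal.coe_one, one_mul, enorm_le_iff_norm_le]; exact hle x)
  rw [ENNReal.coe_one, one_mul] at this
  exact this.trans (hC g' hg').2

theorem aestronglyMeasurable_scaled_mderiv (hw : IsWeightSystem w) (f : Distrib d) (φ : Test d)
    (α : Fin d → ℕ) (n : ℕ) (c : ℝ) : AEStronglyMeasurable
      (fun x => (c * (w n x)⁻¹) • mderiv α (conv f φ) x) volume := by
  rw [mderiv_eq_iterPd]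
  exact ((hw.measurable n).inv.const_mul c).aestronglyMeasurable.smul
    (contDiff_iterPd (contDiff_conv f φ) _).continuous.aestronglyMeasurable

theorem expGrowth_of_boundedSl (hE : IsSolidTIBF ι) (hw : IsWeightSystem w) {χ : Fin 2 → Test d}
    {f : Distrib d} {r : ℝ} (h : ∀ α : Fin d → ℕ, ∃ n : ℕ, BoundedSl ι
      {g | ∃ (j : ℕ) (ℓ : Fin 2), g = fun x => ((2 : ℝ) ^ (-(r * j)) * (w n x)⁻¹) •
        mderiv α (conv f (dil (χ ℓ) j)) x}) :
    ExpGrowth ι w r fun j ℓ => conv f (dil (χ ℓ) j) := by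
  intro l
  obtain ⟨n, C, hC⟩ := h fun i => l.count i
  refine ⟨n, C, ENNReal.coe_lt_top, fun j ℓ => ?_⟩
  have hs := contDiff_conv f (dil (χ ℓ) j)
  have h1 := (hC _ ⟨j, ℓ, rfl⟩).2
  refine le_trans (eNormSl_le_of_le_mul hE (C := ((2 : ℝ) ^ (r * j)).toNNReal)
    (aestronglyMeasurable_wdiv hw n (contDiff_iterPd hs l).continuous.aestronglyMeasurable)
    (Filter.Eventually.of_forall fun x => ?_)) (mul_le_mul_right h1 _)
  rw [← iterPd_eq_mderiv hs, ← ofReal_norm, ← ofReal_norm, norm_smul, norm_wdiv (hw.pos n x)]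
  change _ ≤ ENNReal.ofReal _ * _
  rw [← ENNReal.ofReal_mul (by positivity), Real.norm_of_nonneg (mul_nonneg (by positivity)
    (inv_nonneg.2 (hw.pos n x).le)), ← mul_assoc, ← mul_assoc, ← Real.rpow_add two_pos,
    add_neg_cancel, Real.rpow_zero, one_mul]

end Equivalence

end Mollif

theorem theoremt {d : ℕ} {E : Type*} [NormedAddCommGroup E] [NormedSpace ℂ E] [CompleteSpace E]
    (ι : E →ₗ[ℂ] (Mollif.Rd d →ₘ[volume] ℂ)) (hE : Mollif.IsSolidTIBF ι)
    (w : ℕ → Mollif.Rd d → ℝ) (hw : Mollif.IsWeightSystem w)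
    (hwM : Mollif.WeakModerate w) (hsq : Mollif.Squarable w)
    (χ : Fin 2 → Mollif.Test d) (hχ : Mollif.MDFP χ) (f : Mollif.Distrib d) :
    List.TFAE [
      f ∈ Mollif.multiplierSpace ι w w,
      ∀ (φ : Mollif.Test d) (α : Fin d → ℕ), ∃ n : ℕ,
        Mollif.BoundedSl ι
          {g | ∃ j : ℕ, g = fun x =>
            (w n x)⁻¹ • Mollif.mderiv α (Mollif.conv f (Mollif.dil φ j)) x},
      ∀ φ : Mollif.Test d, ∃ r : ℝ, 0 < r ∧ ∀ α : Fin d → ℕ, ∃ n : ℕ,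
        Mollif.BoundedSl ι
          {g | ∃ j : ℕ, g = fun x => ((2 : ℝ) ^ (-(r * j)) * (w n x)⁻¹) •
            Mollif.mderiv α (Mollif.conv f (Mollif.dil φ j)) x},
      ∃ r : ℝ, 0 < r ∧ ∀ α : Fin d → ℕ, ∃ n : ℕ,
        Mollif.BoundedSl ι
          {g | ∃ (j : ℕ) (ℓ : Fin 2), g = fun x => ((2 : ℝ) ^ (-(r * j)) * (w n x)⁻¹) •
            Mollif.mderiv α (Mollif.conv f (Mollif.dil (χ ℓ) j)) x}] := by
  tfae_have 1 → 2 := fun h φ α => by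
    obtain ⟨F, hF, hfF⟩ := Mollif.isSlSmooth_of_mem_multiplierSpace hE hw hwM h
    exact Mollif.boundedSl_mderiv_conv_dil hE hw hwM hF hfF φ α
  tfae_have 2 → 3 := fun h φ => by
    -- Any positive exponent would do, since `2 ^ (-(r * j)) ≤ 1`.
    refine ⟨1, one_pos, fun α => ?_⟩
    obtain ⟨n, hn⟩ := h φ α
    refine ⟨n, hn.of_le_mul hE ?_⟩
    rintro _ ⟨j, rfl⟩
    refine ⟨Mollif.aestronglyMeasurable_scaled_mderiv hw f _ α n _, _, ⟨j, rfl⟩, fun x => ?_⟩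
    rw [norm_smul, norm_smul, norm_mul]
    refine mul_le_mul_of_nonneg_right (mul_le_of_le_one_left (norm_nonneg _) ?_) (norm_nonneg _)
    rw [Real.norm_of_nonneg (by positivity)]
    exact Real.rpow_le_one_of_one_le_of_nonpos one_le_two (by simp)
  tfae_have 3 → 4 := fun h => by
    choose r hr n hn using fun ℓ => h (χ ℓ)
    -- Enlarging the exponent or the weight index only shrinks the functions, so the maxima serve
    -- both `χ 0` and `χ 1`.
    refine ⟨max (r 0) (r 1), lt_max_of_lt_left (hr 0), fun α => ⟨max (n 0 α) (n 1 α), ?_⟩⟩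
    have hrℓ : ∀ ℓ, r ℓ ≤ max (r 0) (r 1) :=
      Fin.forall_fin_two.2 ⟨le_max_left _ _, le_max_right _ _⟩
    have hnℓ : ∀ ℓ, n ℓ α ≤ max (n 0 α) (n 1 α) :=
      Fin.forall_fin_two.2 ⟨le_max_left _ _, le_max_right _ _⟩
    refine (Mollif.BoundedSl.union (hn 0 α) (hn 1 α)).of_le_mul hE ?_
    rintro _ ⟨j, ℓ, rfl⟩
    refine ⟨Mollif.aestronglyMeasurable_scaled_mderiv hw f _ α _ _, fun x =>
      ((2 : ℝ) ^ (-(r ℓ * j)) * (w (n ℓ α) x)⁻¹) •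
        Mollif.mderiv α (Mollif.conv f (Mollif.dil (χ ℓ) j)) x, ?_, fun x => ?_⟩
    · revert ℓ
      exact Fin.forall_fin_two.2 ⟨Or.inl ⟨j, rfl⟩, Or.inr ⟨j, rfl⟩⟩
    · rw [norm_smul, norm_smul]
      refine mul_le_mul_of_nonneg_right ?_ (norm_nonneg _)
      have h1 := hw.pos (n ℓ α) x
      have h2 := hw.pos (max (n 0 α) (n 1 α)) x
      rw [Real.norm_of_nonneg (by positivity), Real.norm_of_nonneg (by positivity)]
      refine mul_le_mul ?_ (inv_anti₀ h1 (hw.mono (hnℓ ℓ) x)) (by positivity) (by positivity)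
      refine Real.rpow_le_rpow_of_exponent_le one_le_two (neg_le_neg ?_)
      exact mul_le_mul_of_nonneg_right (hrℓ ℓ) (Nat.cast_nonneg j)
  tfae_have 4 → 1 := fun ⟨r, _, h⟩ => by
    obtain ⟨F, hF, hfF⟩ := Mollif.exists_represents_of_expGrowth hE hw hwM hχ f
      (Mollif.expGrowth_of_boundedSl hE hw h)
    exact Mollif.mem_multiplierSpace_of_represents hE hw hsq hF hfF
  tfae_finish
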